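/- **Setting.** Let $d\in\mathbb N$, let $\mathcal H_{spin}=\bigotimes_{i\in\mathbb Z^d}\mathbb C^2$ be the (complete, von Neumann) infinite tensor product, and let $\sigma_\alpha^i$ ($\alpha=1,2,3$) be the Pauli matrices acting on the $i$-th factor. For finite $V\subset\mathbb Z^d$ put $\sigma_3^V=|V|^{-1}\sum_{i\in V}\sigma_3^i$. Let $V$ run through any family (filter) $\mathcal V$ of finite subsets of $\mathbb Z^d$ with $|V|\to\infty$. The set $\mathcal F$ of relevant vectors consists of all $\Psi\in\mathcal H_{spin}$ with $\lim_V\sigma_3^V\Psi=\sigma_3^\infty\Psi$ for some $\sigma_3^\infty$ in the center of the von Neumann algebra generated by the spin operators, $\|\sigma_3^\infty\|\le1$. Let $n$ be the number of boson modes, with annihilation operators $a_1,\dots,a_n$ on Fock space $\mathcal H=\ell^2(\mathbb N^n)$, $N_j=a_j^\dagger a_j$, $M_j=N_j+1$. Let $\mathcal D$ be the common domain of all products of powers of $N_1,\dots,N_n$ (for $n=1$: $\mathcal D=\bigcap_k D(N^k)$), and let $\mathcal L^+(\mathcal D)$ be the algebra of the linear maps $X:\mathcal D\to\mathcal D$ whose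 adjoint is defined on $\mathcal D$ and maps $\mathcal D$ into itself. Let $\mathcal A=B(\mathcal H_{spin})\otimes\mathcal L^+(\mathcal D)$ (algebraic tensor product), acting on $\mathcal H_{spin}\otimes\mathcal D$. For $\Psi\in\mathcal H_{spin}$ and $X\in\mathcal A$ put $$\|X\|^\Psi=\sup\{|\langle\chi_1\otimes\chi_2,X(\Psi\otimes\phi_2)\rangle| : \|\chi_1\|,\|\chi_2\|,\|\phi_2\|\le1\},$$ so that $\|X_1\otimes X_2\|^\Psi=\|X_1\Psi\|\,\|X_2\|$. The topology $\tau$ on $\mathcal A$ is given by the seminorms $$\|X\|^{f,k,\Psi}=\max\{\|f(M)XM^k\|^\Psi,\ \|M^kXf(M)\|^\Psi\},$$ where $f(M)=\prod_jf_j(M_j)$, $M^k=\prod_jM_j^{k_j}$, the $k_j$ are non-negative integers, the $f_j$ are positive bounded continuous functions on $[0,\infty)$ decreasing faster than any inverse power, and $\Psi\in\mathcal F$. Let $J,\gamma_1,\dots,\gamma_n\in\mathbb R$, let $Q_{j,L}$ be the projection on at most $L$ bosons in mode $j$, $a_{j,L}=Q_{j,L}a_jQ_{j,L}$ ($=a_jQ_{j,L}$),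 and $$H_{V,L}=J|V|(\sigma_3^V)^2+\sum_{j=1}^n\gamma_j(a_{j,L}+a_{j,L}^\dagger)\sigma_3^V .$$ **Proposition 5.1.** The cut-off dynamics $\alpha_{V,L}^t(X)=e^{iH_{V,L}t}Xe^{-iH_{V,L}t}$ is well defined on $\mathcal A$ (the exponentials belong to $\mathcal A$), and for every $t\in\mathbb R$: 1. for every mode $j$, the limit of $\alpha_{V,L}^t(a_j)$ for $|V|$ and $L$ both diverging (jointly and independently) exists in $\mathcal A[\tau]$; 2. for every integer $r>1$, every $\alpha\in\{1,2,3\}$ and every site $i$ that eventually belongs to $V$, the limit of $\alpha_{V,L}^t(\sigma_\alpha^i)$ for $|V|,L\to\infty$ under the constraint $|V|=L^r$ exists in $\mathcal A[\tau]$. The case $n=1$ is the single-mode model $H_V=J|V|(\sigma_3^V)^2+\gamma(a+a^\dagger)\sigma_3^V$; general finite $n$ is its many-mode generalization. -/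

import Mathlib

open Filter Topology
open scoped TensorProduct ENNReal

namespace SpinBoson

noncomputable section

section SpinSpace

/-- Sites of the lattice `ℤ^d`. -/
abbrev Site (d : ℕ) : Type := Fin d → ℤ

/-- The two-dimensional complex Hilbert space attached to a site. -/
abbrev Qubit : Type := EuclideanSpace ℂ (Fin 2)

/-- Families `(φ_i)` of unit vectors, i.e. labels of the elementary product vectors `⊗_i φ_i`. -/
abbrev ProductVector (d : ℕ) : Type := Site d → Metric.sphere (0 : Qubit) 1

/-- Von Neumann's (strong) equivalence of unit product families: `∑_i |1 - ⟨φ_i, ψ_i⟩| < ∞`. -/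
def StronglyEquiv {d : ℕ} (φ ψ : ProductVector d) : Prop :=
  Summable fun i : Site d => ‖1 - inner ℂ (φ i : Qubit) (ψ i : Qubit)‖

theorem norm_site {d : ℕ} (φ : ProductVector d) (i : Site d) : ‖(φ i : Qubit)‖ = 1 := by
  simp

theorem StronglyEquiv.refl {d : ℕ} (φ : ProductVector d) : StronglyEquiv φ φ := by
  simp [StronglyEquiv, inner_self_eq_norm_sq_to_K]

theorem StronglyEquiv.symm {d : ℕ} {φ ψ : ProductVector d} (h : StronglyEquiv φ ψ) :
    StronglyEquiv ψ φ := by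
  unfold StronglyEquiv at *
  convert h using 2 with i
  rw [← inner_conj_symm (φ i : Qubit) (ψ i : Qubit), ← RCLike.norm_conj]
  simp

theorem dist_sq_le {x y : Qubit} (hx : ‖x‖ = 1) (hy : ‖y‖ = 1) :
    ‖x - y‖ ^ 2 ≤ 2 * ‖1 - inner ℂ x y‖ := by
  have h1 := @norm_sub_sq ℂ _ _ _ _ x y
  have h2 := Complex.re_le_norm (1 - inner ℂ x y)
  simp only [hx, hy, Complex.sub_re, Complex.one_re, RCLike.re_to_complex] at h1 h2
  linarith

theorem StronglyEquiv.trans {d : ℕ} {φ ψ χ : ProductVector d} (h : StronglyEquiv φ ψ)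
    (h' : StronglyEquiv ψ χ) : StronglyEquiv φ χ := by
  refine Summable.of_nonneg_of_le (fun i => norm_nonneg _) (fun i => ?_)
    ((h.add h').mul_left 2)
  have e : 1 - inner ℂ (φ i : Qubit) (χ i : Qubit) = (1 - inner ℂ (φ i : Qubit) (ψ i : Qubit))
      + (1 - inner ℂ (ψ i : Qubit) (χ i : Qubit))
      - inner ℂ ((φ i : Qubit) - ψ i) ((χ i : Qubit) - ψ i) := by
    simp only [inner_sub_left, inner_sub_right, inner_self_eq_norm_sq_to_K, norm_site]
    push_cast
    ring
  have h1 := dist_sq_le (norm_site φ i) (norm_site ψ i)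
  have h2 := dist_sq_le (norm_site ψ i) (norm_site χ i)
  have h3 := norm_inner_le_norm (𝕜 := ℂ) ((φ i : Qubit) - ψ i) ((χ i : Qubit) - ψ i)
  rw [norm_sub_rev (χ i : Qubit)] at h3
  have h4 := norm_sub_le ((1 - inner ℂ (φ i : Qubit) (ψ i : Qubit))
      + (1 - inner ℂ (ψ i : Qubit) (χ i : Qubit)))
      (inner ℂ ((φ i : Qubit) - ψ i) ((χ i : Qubit) - ψ i))
  have h5 := norm_add_le (1 - inner ℂ (φ i : Qubit) (ψ i : Qubit))
      (1 - inner ℂ (ψ i : Qubit) (χ i : Qubit))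
  rw [e]
  nlinarith [sq_nonneg (‖(φ i : Qubit) - ψ i‖ - ‖(ψ i : Qubit) - χ i‖)]

def stronglyEquivSetoid (d : ℕ) : Setoid (ProductVector d) :=
  ⟨StronglyEquiv, StronglyEquiv.refl, StronglyEquiv.symm, StronglyEquiv.trans⟩

open Classical in
/-- Inner product of the product vectors `⊗ φ_i` and `⊗ ψ_i` in the infinite tensor product: the
(absolutely convergent) product of the `⟨φ_i, ψ_i⟩` for equivalent families, and `0` otherwise. -/
def overlap {d : ℕ} (φ ψ : ProductVector d) : ℂ :=
  if StronglyEquiv φ ψ then ∏' i : Site d, inner ℂ (φ i : Qubit) (ψ i : Qubit) else 0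

/-- The overlaps as an operator-valued kernel on the set of product families. -/
def overlapKernel (d : ℕ) : Matrix (ProductVector d) (ProductVector d) (ℂ →L[ℂ] ℂ) :=
  Matrix.of fun φ ψ => overlap φ ψ • ContinuousLinearMap.id ℂ ℂ

open Classical in
theorem tendsto_overlap {d : ℕ} (φ ψ : ProductVector d) :
    Tendsto (fun s : Finset (Site d) => (if StronglyEquiv φ ψ then (1 : ℂ) else 0) *
      ∏ i ∈ s, inner ℂ (φ i : Qubit) (ψ i : Qubit)) atTop (𝓝 (overlap φ ψ)) := by
  by_cases h : StronglyEquiv φ ψ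
  · have h' : Summable fun i : Site d => ‖inner ℂ (φ i : Qubit) (ψ i : Qubit) - 1‖ := by
      exact h.congr fun i => norm_sub_rev _ _
    have := (multipliable_one_add_of_summable h').hasProd
    simpa [overlap, h, HasProd] using this
  · simp [overlap, h]

open Classical in
open scoped ComplexOrder in
theorem posSemidef_partial {d : ℕ} (t : Finset (ProductVector d)) (s : Finset (Site d)) :
    (Matrix.of fun φ ψ : t => (if StronglyEquiv φ.1 ψ.1 then (1 : ℂ) else 0) *
      ∏ i ∈ s, inner ℂ (φ.1 i : Qubit) (ψ.1 i : Qubit)).PosSemidef := by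
  induction s using Finset.induction_on with
  | empty =>
    let v : t → lp (fun _ : Quotient (stronglyEquivSetoid d) => ℂ) 2 :=
      fun φ => lp.single 2 (Quotient.mk (stronglyEquivSetoid d) φ.1) 1
    convert! Matrix.posSemidef_gram ℂ v using 1
    ext φ ψ
    have hq : Quotient.mk (stronglyEquivSetoid d) φ.1 = Quotient.mk (stronglyEquivSetoid d) ψ.1 ↔
      StronglyEquiv φ.1 ψ.1 := Quotient.eq (r := stronglyEquivSetoid d)
    simp only [Matrix.of_apply, Finset.prod_empty, mul_one, Matrix.gram_apply, v,
      lp.inner_single_left, lp.single_apply, Pi.single_apply, ← hq]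
    split_ifs <;> simp
  | insert a s ha ih =>
    have := ih.hadamard (Matrix.posSemidef_gram ℂ fun φ : t => (φ.1 a : Qubit))
    convert! this using 1
    ext φ ψ
    simp only [Matrix.of_apply, Matrix.hadamard, Finset.prod_insert ha, Matrix.gram_apply]
    ring

open scoped ComplexOrder in
theorem posSemidef_overlap {d : ℕ} (t : Finset (ProductVector d)) :
    (Matrix.of fun φ ψ : t => overlap φ.1 ψ.1).PosSemidef := by
  refine .of_dotProduct_mulVec_nonneg ?_ fun x => ?_
  · ext φ ψ
    refine tendsto_nhds_unique ((tendsto_overlap ψ.1 φ.1).star) ?_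
    refine (tendsto_overlap φ.1 ψ.1).congr fun s => ?_
    exact ((posSemidef_partial t s).isHermitian.apply φ ψ).symm
  · classical
    have hT : Tendsto (fun s : Finset (Site d) => star x ⬝ᵥ
        (Matrix.of fun φ ψ : t => (if StronglyEquiv φ.1 ψ.1 then (1 : ℂ) else 0) *
        ∏ i ∈ s, inner ℂ (φ.1 i : Qubit) (ψ.1 i : Qubit)).mulVec x) atTop
        (𝓝 (star x ⬝ᵥ (Matrix.of fun φ ψ : t => overlap φ.1 ψ.1).mulVec x)) := by
      simp only [dotProduct, Matrix.mulVec, Matrix.of_apply]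
      exact tendsto_finsetSum _ fun φ _ => tendsto_const_nhds.mul
        (tendsto_finsetSum _ fun ψ _ => (tendsto_overlap φ.1 ψ.1).mul tendsto_const_nhds)
    exact ge_of_tendsto' hT fun s => (posSemidef_partial t s).dotProduct_mulVec_nonneg x

open scoped ComplexOrder in
theorem overlap_conj {d : ℕ} (φ ψ : ProductVector d) :
    star (overlap ψ φ) = overlap φ ψ := by
  classical
  exact (posSemidef_overlap {φ, ψ}).isHermitian.apply ⟨φ, by simp⟩ ⟨ψ, by simp⟩

instance posSemidef_overlapKernel (d : ℕ) : Fact (overlapKernel d).PosSemidef := by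
  have key := (RKHS.posSemidef_tfae (K := overlapKernel d)).out 0 2
  refine ⟨key.mpr ⟨?_, fun v => ?_⟩⟩
  · ext φ ψ
    have h1 : star (ContinuousLinearMap.id ℂ ℂ) = ContinuousLinearMap.id ℂ ℂ := star_one _
    simp [overlapKernel, Matrix.conjTranspose_apply, ← overlap_conj φ ψ, h1]
  · have h : 0 ≤ (star (fun φ : v.support => v φ.1) ⬝ᵥ
        (Matrix.of fun φ ψ : v.support => overlap φ.1 ψ.1).mulVec (fun φ => v φ.1)).re := by
      open scoped ComplexOrder in
      exact (Complex.le_def.mp ((posSemidef_overlap v.support).dotProduct_mulVec_nonneg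
        (fun φ => v φ.1))).1
    convert! h using 1
    rw [RCLike.re_to_complex, ← Complex.conj_re]
    congr 1
    simp only [Finsupp.sum, map_sum, dotProduct, Matrix.mulVec, Matrix.of_apply, Pi.star_apply]
    rw [Finset.sum_comm, ← Finset.sum_coe_sort]
    refine Finset.sum_congr rfl fun φ _ => ?_
    rw [← Finset.sum_coe_sort, Finset.mul_sum]
    refine Finset.sum_congr rfl fun ψ _ => ?_
    simp [overlapKernel]

/-- The (complete, von Neumann) infinite tensor product `⊗_{i ∈ ℤ^d} ℂ²`: the completion of the
span of the product vectors, for the inner product given by `overlap` (see `inner_productVec`). -/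
def HSpin (d : ℕ) : Type := RKHS.OfKernel (overlapKernel d)

instance (d : ℕ) : NormedAddCommGroup (HSpin d) :=
  inferInstanceAs (NormedAddCommGroup (RKHS.OfKernel (overlapKernel d)))

instance (d : ℕ) : InnerProductSpace ℂ (HSpin d) :=
  inferInstanceAs (InnerProductSpace ℂ (RKHS.OfKernel (overlapKernel d)))

instance (d : ℕ) : CompleteSpace (HSpin d) :=
  inferInstanceAs (CompleteSpace (RKHS.OfKernel (overlapKernel d)))

/-- The Pauli matrices; the indices `0, 1, 2` stand for `x, y, z` (that is `1, 2, 3`). -/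
def pauli : Fin 3 → Matrix (Fin 2) (Fin 2) ℂ :=
  ![!![0, 1; 1, 0], !![0, -Complex.I; Complex.I, 0], !![1, 0; 0, -1]]

theorem inner_pauli (α : Fin 3) (x y : Qubit) :
    inner ℂ (Matrix.toEuclideanLin (pauli α) x) (Matrix.toEuclideanLin (pauli α) y)
      = inner ℂ x y := by
  have hI : Complex.I ^ 2 = -1 := Complex.I_sq
  fin_cases α <;>
  simp [pauli, PiLp.inner_apply, Fin.sum_univ_two, Matrix.toLpLin_apply, dotProduct] <;>
  grind

/-- The product family obtained by letting the Pauli matrix `σ_α` act on the `i`-th factor. -/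
def siteFlip {d : ℕ} (α : Fin 3) (i : Site d) (φ : ProductVector d) : ProductVector d :=
  open Classical in
  Function.update φ i ⟨Matrix.toEuclideanLin (pauli α) (φ i : Qubit), by
    have h := inner_pauli α (φ i : Qubit) (φ i : Qubit)
    rw [inner_self_eq_norm_sq_to_K, inner_self_eq_norm_sq_to_K] at h
    have h1 := norm_site φ i
    have h2 : ‖Matrix.toEuclideanLin (pauli α) (φ i : Qubit)‖ ^ 2 = ‖(φ i : Qubit)‖ ^ 2 := by
      exact_mod_cast h
    rw [mem_sphere_zero_iff_norm]
    nlinarith [norm_nonneg (Matrix.toEuclideanLin (pauli α) (φ i : Qubit))]⟩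

theorem inner_siteFlip {d : ℕ} (α : Fin 3) (i j : Site d) (φ ψ : ProductVector d) :
    inner ℂ (siteFlip α i φ j : Qubit) (siteFlip α i ψ j : Qubit) =
      inner ℂ (φ j : Qubit) (ψ j : Qubit) := by
  by_cases h : j = i
  · subst h
    simp [siteFlip, inner_pauli]
  · simp [siteFlip, h]

theorem overlap_siteFlip {d : ℕ} (α : Fin 3) (i : Site d) (φ ψ : ProductVector d) :
    overlap (siteFlip α i φ) (siteFlip α i ψ) = overlap φ ψ := by
  have h : StronglyEquiv (siteFlip α i φ) (siteFlip α i ψ) ↔ StronglyEquiv φ ψ := by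
    simp only [StronglyEquiv, inner_siteFlip]
  simp only [overlap, inner_siteFlip]
  split_ifs <;> simp_all

/-- The action of `σ_α^i` on finite linear combinations of product vectors. -/
def spinPre {d : ℕ} (α : Fin 3) (i : Site d) :
    RKHS.H₀ (overlapKernel d) →L[ℂ] RKHS.H₀ (overlapKernel d) :=
  LinearIsometry.toContinuousLinearMap
  { toLinearMap := Finsupp.lmapDomain ℂ ℂ (Prod.map (siteFlip α i) id)
    norm_map' := fun x => by
      have h : inner ℂ (Finsupp.lmapDomain ℂ ℂ (Prod.map (siteFlip α i) id) x :
          RKHS.H₀ (overlapKernel d)) (Finsupp.lmapDomain ℂ ℂ (Prod.map (siteFlip α i) id) x :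
          RKHS.H₀ (overlapKernel d)) = inner ℂ (x : RKHS.H₀ (overlapKernel d)) x := by
        change Finsupp.sum _ _ = Finsupp.sum _ _
        rw [Finsupp.lmapDomain_apply, Finsupp.sum_mapDomain_index (by simp) (by
          intro b m₁ m₂; simp only [← Finsupp.sum_add]; congr; ext; simp; ring)]
        refine Finsupp.sum_congr fun a _ => ?_
        obtain ⟨y, u⟩ := a
        refine (Finsupp.sum_mapDomain_index (by simp) (by intros; simp; ring)).trans ?_
        refine Finsupp.sum_congr fun b _ => ?_
        obtain ⟨z, v⟩ := b
        simp [overlapKernel, overlap_siteFlip]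
      rw [inner_self_eq_norm_sq_to_K, inner_self_eq_norm_sq_to_K] at h
      have h2 : ‖(Finsupp.lmapDomain ℂ ℂ (Prod.map (siteFlip α i) id) x :
          RKHS.H₀ (overlapKernel d))‖ ^ 2 = ‖(x : RKHS.H₀ (overlapKernel d))‖ ^ 2 := by
        exact_mod_cast h
      exact (sq_eq_sq₀ (norm_nonneg _) (norm_nonneg _)).mp h2 }

/-- The spin operator `σ_α^i` on the infinite tensor product: the bounded operator with
`⊗φ ↦ ⊗φ'`, where `φ'_i = σ_α φ_i` and `φ'_j = φ_j` for `j ≠ i` (see `spinOp_productVec`). -/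
def spinOp {d : ℕ} (α : Fin 3) (i : Site d) : HSpin d →L[ℂ] HSpin d :=
  (show RKHS.OfKernel (overlapKernel d) →L[ℂ] RKHS.OfKernel (overlapKernel d) from
    (spinPre α i).completion)

/-- The product vector `⊗_i φ_i`. -/
def productVec {d : ℕ} (φ : ProductVector d) : HSpin d :=
  (show RKHS.OfKernel (overlapKernel d) from
    ((Finsupp.single (φ, (1 : ℂ)) (1 : ℂ) : RKHS.H₀ (overlapKernel d)) :
      UniformSpace.Completion (RKHS.H₀ (overlapKernel d))))

theorem inner_productVec {d : ℕ} (φ ψ : ProductVector d) :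
    inner ℂ (productVec φ) (productVec ψ) = overlap φ ψ := by
  refine (UniformSpace.Completion.inner_coe (𝕜 := ℂ)
    (Finsupp.single (φ, (1 : ℂ)) (1 : ℂ) : RKHS.H₀ (overlapKernel d))
    (Finsupp.single (ψ, (1 : ℂ)) (1 : ℂ) : RKHS.H₀ (overlapKernel d))).trans ?_
  change Finsupp.sum _ _ = _
  have h := overlap_conj φ ψ
  simp only [RCLike.star_def] at h
  simp [overlapKernel, h]

theorem spinOp_productVec {d : ℕ} (α : Fin 3) (i : Site d) (φ : ProductVector d) :
    spinOp α i (productVec φ) = productVec (siteFlip α i φ) := by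
  refine (ContinuousLinearMap.completion_apply_coe (spinPre α i)
    (Finsupp.single (φ, (1 : ℂ)) (1 : ℂ) : RKHS.H₀ (overlapKernel d))).trans ?_
  exact congrArg _ Finsupp.mapDomain_single

end SpinSpace

section Boson

/-- Fock space of `n` boson modes in the occupation number representation: `ℓ²(ℕ^n)`, the basis
vector at `m` being the normalized `∏_j (a_j†)^{m_j} Φ₀`. For `n = 1` this is `ℓ²(ℕ)`. -/
def Fock (n : ℕ) : Type := lp (fun _ : Fin n → ℕ => ℂ) 2

instance (n : ℕ) : NormedAddCommGroup (Fock n) :=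
  inferInstanceAs (NormedAddCommGroup (lp (fun _ : Fin n → ℕ => ℂ) 2))

instance (n : ℕ) : InnerProductSpace ℂ (Fock n) :=
  inferInstanceAs (InnerProductSpace ℂ (lp (fun _ : Fin n → ℕ => ℂ) 2))

/-- Occupation number coefficients of a vector of Fock space. -/
def coeff {n : ℕ} : Fock n →ₗ[ℂ] ((Fin n → ℕ) → ℂ) where
  toFun φ := (show lp (fun _ : Fin n → ℕ => ℂ) 2 from φ)
  map_add' _ _ := rfl
  map_smul' _ _ := rfl

theorem coeff_injective {n : ℕ} : Function.Injective (coeff (n := n)) :=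
  fun _ _ h => Subtype.ext h

/-- The vector of Fock space with given square summable coefficients. -/
def ofCoeff {n : ℕ} (φ : (Fin n → ℕ) → ℂ) (h : Memℓp φ 2) : Fock n :=
  (show lp (fun _ : Fin n → ℕ => ℂ) 2 from ⟨φ, h⟩)

theorem coeff_ofCoeff {n : ℕ} (φ : (Fin n → ℕ) → ℂ) (h : Memℓp φ 2) :
    coeff (ofCoeff φ h) = φ := rfl

theorem inner_eq_tsum {n : ℕ} (φ ψ : Fock n) :
    inner ℂ φ ψ = ∑' m, inner ℂ (coeff φ m) (coeff ψ m) :=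
  lp.inner_eq_tsum (𝕜 := ℂ) (G := fun _ : Fin n → ℕ => ℂ) φ ψ

/-- The eigenvalue of `M_1 ⋯ M_n`, `M_j = N_j + 1`, at the occupation numbers `m`. -/
def weight {n : ℕ} (m : Fin n → ℕ) : ℝ := ∏ j, ((m j : ℝ) + 1)

/-- Coefficients of vectors in the domain of every power of `M_1 ⋯ M_n`. -/
def RapidDecay {n : ℕ} (φ : (Fin n → ℕ) → ℂ) : Prop :=
  ∀ k : ℕ, Summable fun m => (weight m ^ k * ‖φ m‖) ^ 2

theorem one_le_weight {n : ℕ} (m : Fin n → ℕ) : 1 ≤ weight m :=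
  Finset.prod_induction _ (fun x : ℝ => 1 ≤ x) (fun _ _ => one_le_mul_of_one_le_of_one_le) le_rfl
    fun j _ => by simp

theorem RapidDecay.memℓp {n : ℕ} {φ : (Fin n → ℕ) → ℂ} (h : RapidDecay φ) : Memℓp φ 2 := by
  rw [memℓp_gen_iff (by norm_num)]
  simpa using h 0

/-- The domain of all powers of the number operators. For one mode this is `⋂_k D(N^k)` (recall
`D(N^k) = D((N+1)^k)`); for several modes it is the completed tensor product of the one-mode
domains. -/
def domain (n : ℕ) : Submodule ℂ (Fock n) where
  carrier := {φ | RapidDecay (coeff φ)}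
  zero_mem' := fun k => by simp
  add_mem' := fun {φ ψ} hφ hψ k => by
    refine Summable.of_nonneg_of_le (fun m => sq_nonneg _) (fun m => ?_)
      (((hφ k).add (hψ k)).mul_left 2)
    have hw : 0 ≤ weight m ^ k := pow_nonneg (zero_le_one.trans (one_le_weight m)) k
    have h1 : weight m ^ k * ‖coeff (φ + ψ) m‖ ≤
        weight m ^ k * ‖coeff φ m‖ + weight m ^ k * ‖coeff ψ m‖ := by
      rw [← mul_add, map_add]
      exact mul_le_mul_of_nonneg_left (norm_add_le _ _) hw
    have h2 : 0 ≤ weight m ^ k * ‖coeff (φ + ψ) m‖ := by positivity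
    nlinarith [sq_nonneg (weight m ^ k * ‖coeff φ m‖ - weight m ^ k * ‖coeff ψ m‖)]
  smul_mem' := fun c φ hφ k => by
    refine ((hφ k).mul_left (‖c‖ ^ 2)).congr fun m => ?_
    simp only [map_smul, Pi.smul_apply, norm_smul]
    ring

/-- The domain `𝓓`, as an inner product space in its own right. -/
def D (n : ℕ) : Type := domain n

instance (n : ℕ) : NormedAddCommGroup (D n) := inferInstanceAs (NormedAddCommGroup (domain n))

instance (n : ℕ) : InnerProductSpace ℂ (D n) := inferInstanceAs (InnerProductSpace ℂ (domain n))

/-- The inclusion of `𝓓` into Fock space. -/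
def toFock {n : ℕ} : D n →ₗᵢ[ℂ] Fock n where
  toFun φ := (show domain n from φ)
  map_add' _ _ := rfl
  map_smul' _ _ := rfl
  norm_map' _ := rfl

theorem toFock_injective {n : ℕ} : Function.Injective (toFock (n := n)) :=
  fun _ _ h => Subtype.ext h

theorem rapidDecay_toFock {n : ℕ} (φ : D n) : RapidDecay (coeff (toFock φ)) :=
  (show domain n from φ).2

theorem D_inner_eq_tsum {n : ℕ} (φ ψ : D n) :
    inner ℂ φ ψ = ∑' m, inner ℂ (coeff (toFock φ) m) (coeff (toFock ψ) m) := by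
  rw [← toFock.inner_map_map, inner_eq_tsum]

/-- The operator on `𝓓` given by a linear map of coefficients that preserves rapid decay. -/
def mkOp {n : ℕ} (T : ((Fin n → ℕ) → ℂ) →ₗ[ℂ] ((Fin n → ℕ) → ℂ))
    (hT : ∀ φ, RapidDecay φ → RapidDecay (T φ)) : Module.End ℂ (D n) where
  toFun φ := (show domain n from ⟨ofCoeff (T (coeff (toFock φ)))
    (hT _ (rapidDecay_toFock φ)).memℓp, hT _ (rapidDecay_toFock φ)⟩)
  map_add' φ ψ := toFock_injective (coeff_injective
    (map_add T (coeff (toFock φ)) (coeff (toFock ψ))))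
  map_smul' c φ := toFock_injective (coeff_injective (map_smul T c (coeff (toFock φ))))

theorem coeff_mkOp {n : ℕ} (T : ((Fin n → ℕ) → ℂ) →ₗ[ℂ] ((Fin n → ℕ) → ℂ))
    (hT : ∀ φ, RapidDecay φ → RapidDecay (T φ)) (φ : D n) :
    coeff (toFock (mkOp T hT φ)) = T (coeff (toFock φ)) := rfl

/-- The algebra `𝓛⁺(𝓓)`: linear maps `X : 𝓓 → 𝓓` whose adjoint is defined on `𝓓` and maps `𝓓`
into itself (such an `X` is closable, its adjoint being densely defined). -/
def Lplus (n : ℕ) : Subalgebra ℂ (Module.End ℂ (D n)) where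
  carrier := {X | ∃ Y : Module.End ℂ (D n), ∀ φ ψ : D n, inner ℂ (Y ψ) φ = inner ℂ ψ (X φ)}
  mul_mem' := by
    rintro X X' ⟨Y, hY⟩ ⟨Y', hY'⟩
    exact ⟨Y' * Y, fun φ ψ => by simp [hY, hY']⟩
  add_mem' := by
    rintro X X' ⟨Y, hY⟩ ⟨Y', hY'⟩
    exact ⟨Y + Y', fun φ ψ => by
      rw [LinearMap.add_apply, LinearMap.add_apply, inner_add_left, inner_add_right, hY, hY']⟩
  algebraMap_mem' := fun c => ⟨algebraMap ℂ _ (starRingEnd ℂ c), fun φ ψ => by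
    simp [Module.algebraMap_end_apply, mul_comm]⟩

/-- Polynomially bounded functions of the occupation numbers. -/
def PolyGrowth {n : ℕ} (g : (Fin n → ℕ) → ℝ) : Prop :=
  ∃ C : ℝ, ∃ p : ℕ, ∀ m, |g m| ≤ C * weight m ^ p

/-- Multiplication of the coefficients by `g`. -/
def occMap {n : ℕ} (g : (Fin n → ℕ) → ℝ) : ((Fin n → ℕ) → ℂ) →ₗ[ℂ] ((Fin n → ℕ) → ℂ) :=
  LinearMap.pi fun m => (g m : ℂ) • LinearMap.proj m

theorem rapidDecay_occ {n : ℕ} {g : (Fin n → ℕ) → ℝ} (hg : PolyGrowth g)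
    (φ : (Fin n → ℕ) → ℂ) (hφ : RapidDecay φ) : RapidDecay (occMap g φ) := by
  obtain ⟨C, p, hC⟩ := hg
  intro k
  refine Summable.of_nonneg_of_le (fun m => sq_nonneg _) (fun m => ?_)
    ((hφ (k + p)).mul_left (C ^ 2))
  have hw : 0 ≤ weight m := zero_le_one.trans (one_le_weight m)
  rw [← mul_pow]
  refine pow_le_pow_left₀ (by positivity) ?_ 2
  simp only [occMap, LinearMap.pi_apply, LinearMap.smul_apply, LinearMap.proj_apply, smul_eq_mul,
    norm_mul, Complex.norm_real, Real.norm_eq_abs, pow_add]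
  calc weight m ^ k * (|g m| * ‖φ m‖) ≤ weight m ^ k * ((C * weight m ^ p) * ‖φ m‖) := by
        gcongr; exact hC m
    _ = _ := by ring

theorem inner_occ {n : ℕ} {g : (Fin n → ℕ) → ℝ} (hg : PolyGrowth g) (φ ψ : D n) :
    inner ℂ (mkOp (occMap g) (rapidDecay_occ hg) ψ) φ
      = inner ℂ ψ (mkOp (occMap g) (rapidDecay_occ hg) φ) := by
  rw [D_inner_eq_tsum, D_inner_eq_tsum]
  refine tsum_congr fun m => ?_
  simp [coeff_mkOp, occMap]
  ring

/-- The operator `g(N_1, …, N_n) ∈ 𝓛⁺(𝓓)`, for a polynomially bounded real function `g`. -/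
def occFun {n : ℕ} (g : (Fin n → ℕ) → ℝ) (hg : PolyGrowth g) : Lplus n :=
  ⟨mkOp (occMap g) (rapidDecay_occ hg), mkOp (occMap g) (rapidDecay_occ hg), inner_occ hg⟩

/-- Add a boson to mode `j`. -/
def up {n : ℕ} (j : Fin n) (m : Fin n → ℕ) : Fin n → ℕ := Function.update m j (m j + 1)

/-- Remove a boson from mode `j` (only used when there is one). -/
def down {n : ℕ} (j : Fin n) (m : Fin n → ℕ) : Fin n → ℕ := Function.update m j (m j - 1)

/-- `(a_j φ)(m) = √(m_j + 1) φ(m + e_j)`. -/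
def annMap {n : ℕ} (j : Fin n) : ((Fin n → ℕ) → ℂ) →ₗ[ℂ] ((Fin n → ℕ) → ℂ) :=
  LinearMap.pi fun m => ((Real.sqrt (m j + 1) : ℝ) : ℂ) • LinearMap.proj (up j m)

/-- `(a_j† φ)(m) = √(m_j) φ(m - e_j)`, which is `0` when `m_j = 0`. -/
def creMap {n : ℕ} (j : Fin n) : ((Fin n → ℕ) → ℂ) →ₗ[ℂ] ((Fin n → ℕ) → ℂ) :=
  LinearMap.pi fun m => ((Real.sqrt (m j) : ℝ) : ℂ) • LinearMap.proj (down j m)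

theorem down_up {n : ℕ} (j : Fin n) (m : Fin n → ℕ) : down j (up j m) = m := by
  simp [down, up]

theorem up_down {n : ℕ} (j : Fin n) (m : Fin n → ℕ) (h : m j ≠ 0) : up j (down j m) = m := by
  have : m j - 1 + 1 = m j := by omega
  simp [down, up, this]

theorem up_injective {n : ℕ} (j : Fin n) : Function.Injective (up (n := n) j) :=
  Function.LeftInverse.injective (down_up j)

theorem weight_up {n : ℕ} (j : Fin n) (m : Fin n → ℕ) :
    weight (up j m) * (m j + 1) = weight m * (m j + 2) := by
  unfold weight up
  rw [← Finset.mul_prod_erase _ _ (Finset.mem_univ j),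
    ← Finset.mul_prod_erase (a := j) _ (fun j => ((m j : ℝ) + 1)) (Finset.mem_univ j)]
  have : ∀ i ∈ Finset.univ.erase j,
      (((Function.update m j (m j + 1)) i : ℕ) : ℝ) + 1 = (m i : ℝ) + 1 := by
    intro i hi
    rw [Function.update_of_ne (Finset.ne_of_mem_erase hi)]
  rw [Finset.prod_congr rfl this]
  simp only [Function.update_self]
  push_cast
  ring

theorem le_weight {n : ℕ} (j : Fin n) (m : Fin n → ℕ) : (m j : ℝ) + 1 ≤ weight m := by
  unfold weight
  rw [← Finset.mul_prod_erase _ _ (Finset.mem_univ j)]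
  exact le_mul_of_one_le_right (by positivity) (Finset.prod_induction _
    (fun x : ℝ => 1 ≤ x) (fun _ _ => one_le_mul_of_one_le_of_one_le) le_rfl fun i _ => by simp)

theorem weight_le_up {n : ℕ} (j : Fin n) (m : Fin n → ℕ) : weight m ≤ weight (up j m) := by
  have h := weight_up j m
  have h1 := one_le_weight m
  have h2 : (0 : ℝ) < (m j : ℝ) + 1 := by positivity
  by_contra! hlt
  nlinarith

theorem weight_up_le {n : ℕ} (j : Fin n) (m : Fin n → ℕ) : weight (up j m) ≤ 2 * weight m := by
  have h := weight_up j m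
  have h1 := one_le_weight m
  have h2 : (0 : ℝ) ≤ (m j : ℝ) := by positivity
  by_contra! hlt
  nlinarith

theorem rapidDecay_ann {n : ℕ} (j : Fin n) (φ : (Fin n → ℕ) → ℂ) (hφ : RapidDecay φ) :
    RapidDecay (annMap j φ) := by
  intro k
  refine Summable.of_nonneg_of_le (fun m => sq_nonneg _) (fun m => ?_)
    ((hφ (k + 1)).comp_injective (up_injective j))
  have hw : 0 ≤ weight m := zero_le_one.trans (one_le_weight m)
  refine pow_le_pow_left₀ (by positivity) ?_ 2
  have h1 : Real.sqrt ((m j : ℝ) + 1) ≤ weight (up j m) :=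
    (Real.sqrt_le_iff.mpr ⟨by positivity, by nlinarith [(m j).cast_nonneg (α := ℝ)]⟩ : _ ≤ (m j : ℝ) + 1).trans ((le_weight j m).trans (weight_le_up j m))
  simp only [annMap, LinearMap.pi_apply, LinearMap.smul_apply, LinearMap.proj_apply, smul_eq_mul,
    norm_mul, Complex.norm_real, Real.norm_eq_abs, abs_of_nonneg (Real.sqrt_nonneg _), pow_succ]
  rw [← mul_assoc]
  gcongr
  · exact pow_nonneg (zero_le_one.trans (one_le_weight _)) k
  · exact weight_le_up j m

theorem rapidDecay_cre {n : ℕ} (j : Fin n) (φ : (Fin n → ℕ) → ℂ) (hφ : RapidDecay φ) :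
    RapidDecay (creMap j φ) := by
  intro k
  rw [← (up_injective j).summable_iff]
  · refine Summable.of_nonneg_of_le (fun m => sq_nonneg _) (fun m => ?_)
      ((hφ (k + 1)).mul_left ((2 ^ k) ^ 2))
    have hw : 0 ≤ weight m := zero_le_one.trans (one_le_weight m)
    rw [← mul_pow]
    refine pow_le_pow_left₀ (mul_nonneg (pow_nonneg
      (zero_le_one.trans (one_le_weight _)) k) (norm_nonneg _)) ?_ 2
    have h1 : Real.sqrt ((m j : ℝ) + 1) ≤ weight m :=
      (Real.sqrt_le_iff.mpr ⟨by positivity, by nlinarith [(m j).cast_nonneg (α := ℝ)]⟩ : _ ≤ (m j : ℝ) + 1).trans (le_weight j m)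
    simp only [creMap, LinearMap.pi_apply, LinearMap.smul_apply, LinearMap.proj_apply, smul_eq_mul,
      norm_mul, Complex.norm_real, Real.norm_eq_abs, abs_of_nonneg (Real.sqrt_nonneg _), down_up]
    have h2 : ((up j m j : ℕ) : ℝ) = (m j : ℝ) + 1 := by simp [up]
    rw [h2]
    calc weight (up j m) ^ k * (Real.sqrt ((m j : ℝ) + 1) * ‖φ m‖)
        ≤ (2 * weight m) ^ k * (weight m * ‖φ m‖) := by
          gcongr
          · exact zero_le_one.trans (one_le_weight _)
          · exact weight_up_le j m
      _ = _ := by ring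
  · intro m hm
    have h0 : m j = 0 := by
      by_contra h
      exact hm ⟨down j m, up_down j m h⟩
    simp [creMap, h0]

theorem inner_cre_ann {n : ℕ} (j : Fin n) (φ ψ : D n) :
    inner ℂ (mkOp (creMap j) (rapidDecay_cre j) ψ) φ
      = inner ℂ ψ (mkOp (annMap j) (rapidDecay_ann j) φ) := by
  rw [D_inner_eq_tsum, D_inner_eq_tsum,
    ← (up_injective j).tsum_eq]
  · refine tsum_congr fun m => ?_
    simp [coeff_mkOp, creMap, annMap, down_up]
    simp [up]
    ring
  · intro m hm
    by_contra h
    have h0 : m j = 0 := by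
      by_contra h'
      exact h ⟨down j m, up_down j m h'⟩
    simp [coeff_mkOp, creMap, h0] at hm

/-- The annihilation operator `a_j` of mode `j`. -/
def ann {n : ℕ} (j : Fin n) : Lplus n :=
  ⟨mkOp (annMap j) (rapidDecay_ann j), mkOp (creMap j) (rapidDecay_cre j), inner_cre_ann j⟩

/-- The creation operator `a_j†` of mode `j`. -/
def cre {n : ℕ} (j : Fin n) : Lplus n :=
  ⟨mkOp (creMap j) (rapidDecay_cre j), mkOp (annMap j) (rapidDecay_ann j), fun φ ψ => by
    have h := congrArg (starRingEnd ℂ) (inner_cre_ann j ψ φ)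
    rw [inner_conj_symm (𝕜 := ℂ), inner_conj_symm (𝕜 := ℂ)] at h
    exact h.symm⟩

end Boson

section Model

/-- The cut-off projection `Q_{j,L}` on at most `L` bosons in mode `j`. -/
def cutoff {n : ℕ} (j : Fin n) (L : ℕ) : Lplus n :=
  occFun (fun m => if m j ≤ L then 1 else 0) ⟨1, 0, fun m => by
    dsimp only
    split_ifs <;> simp⟩

/-- The regularized annihilation operator `a_{j,L} = Q_{j,L} a_j Q_{j,L}`. -/
def annCut {n : ℕ} (j : Fin n) (L : ℕ) : Lplus n := cutoff j L * ann j * cutoff j L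

/-- The regularized creation operator `a_{j,L}† = Q_{j,L} a_j† Q_{j,L}`. -/
def creCut {n : ℕ} (j : Fin n) (L : ℕ) : Lplus n := cutoff j L * cre j * cutoff j L

/-- The class `𝓒` of positive, bounded, continuous functions on `[0, ∞)` that decrease faster than
any inverse power (the values on the negative half-line play no role). -/
structure RapidFun where
  toFun : ℝ → ℝ
  pos : ∀ x, 0 ≤ x → 0 < toFun x
  bounded : ∃ C : ℝ, ∀ x, 0 ≤ x → toFun x ≤ C
  continuousOn : ContinuousOn toFun (Set.Ici 0)
  decay : ∀ k : ℕ, Tendsto (fun x : ℝ => x ^ k * toFun x) atTop (𝓝 0)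

theorem polyGrowth_rapidFun {n : ℕ} (f : Fin n → RapidFun) :
    PolyGrowth fun m : Fin n → ℕ => ∏ j, (f j).toFun (m j + 1) := by
  choose C hC using fun j => (f j).bounded
  refine ⟨∏ j, C j, 0, fun m => ?_⟩
  have h0 : ∀ j, 0 ≤ (f j).toFun ((m j : ℝ) + 1) := fun j => ((f j).pos _ (by positivity)).le
  rw [abs_of_nonneg (Finset.prod_nonneg fun j _ => h0 j), pow_zero, mul_one]
  exact Finset.prod_le_prod (fun j _ => h0 j) fun j _ => hC j _ (by positivity)

theorem polyGrowth_pow {n : ℕ} (k : Fin n → ℕ) :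
    PolyGrowth fun m : Fin n → ℕ => ∏ j, ((m j : ℝ) + 1) ^ k j := by
  refine ⟨1, ∑ j, k j, fun m => ?_⟩
  rw [abs_of_nonneg (Finset.prod_nonneg fun j _ => by positivity), one_mul,
    ← Finset.prod_pow_eq_pow_sum]
  exact Finset.prod_le_prod (fun j _ => by positivity) fun j _ =>
    pow_le_pow_left₀ (by positivity) (le_weight j m) _

/-- `f(M) = ∏_j f_j(M_j)`; for one mode this is `f(M)`, `M = N + 1`. -/
def opF {n : ℕ} (f : Fin n → RapidFun) : Lplus n :=
  occFun (fun m => ∏ j, (f j).toFun (m j + 1)) (polyGrowth_rapidFun f)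

/-- `M^k = ∏_j M_j^{k_j}`; for one mode this is `M^k`, `M = N + 1`. -/
def opM {n : ℕ} (k : Fin n → ℕ) : Lplus n :=
  occFun (fun m => ∏ j, ((m j : ℝ) + 1) ^ k j) (polyGrowth_pow k)

/-- The algebra `𝓐 = B(𝓗_spin) ⊗ 𝓛⁺(𝓓)`. -/
abbrev Obs (d n : ℕ) : Type := (HSpin d →L[ℂ] HSpin d) ⊗[ℂ] Lplus n

/-- The dense subspace `𝓗_spin ⊗ 𝓓` of `𝓗_spin ⊗ 𝓗`, with its Hilbert space inner product. -/
abbrev Dom (d n : ℕ) : Type := HSpin d ⊗[ℂ] D n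

/-- Bounded operators on `𝓗_spin` as linear maps. -/
def boundedToEnd (d : ℕ) : (HSpin d →L[ℂ] HSpin d) →ₐ[ℂ] Module.End ℂ (HSpin d) where
  __ := (ContinuousLinearMap.toLinearMapRingHom : (HSpin d →L[ℂ] HSpin d) →+* _)
  commutes' _ := rfl

/-- The action of `𝓐` on `𝓗_spin ⊗ 𝓓`: `(A ⊗ X)(Ψ ⊗ φ) = AΨ ⊗ Xφ`. -/
def act (d n : ℕ) : Obs d n →ₐ[ℂ] Module.End ℂ (Dom d n) :=
  Module.endTensorEndAlgHom.comp (Algebra.TensorProduct.map (boundedToEnd d) (Lplus n).val)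

theorem act_tmul {d n : ℕ} (A : HSpin d →L[ℂ] HSpin d) (X : Lplus n) (Ψ : HSpin d) (φ : D n) :
    act d n (A ⊗ₜ X) (Ψ ⊗ₜ φ) = A Ψ ⊗ₜ[ℂ] (X : Module.End ℂ (D n)) φ := rfl

/-- The mean magnetization `σ_3^V = |V|⁻¹ ∑_{i ∈ V} σ_3^i`. -/
def meanSpin {d : ℕ} (V : Finset (Site d)) : HSpin d →L[ℂ] HSpin d :=
  ((V.card : ℂ)⁻¹) • ∑ i ∈ V, spinOp 2 i

/-- The regularized Hamiltonian
`H_{V,L} = J |V| (σ_3^V)² + ∑_j γ_j (a_{j,L} + a_{j,L}†) σ_3^V`, an element of `𝓐`. -/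
def hamiltonian {d n : ℕ} (J : ℝ) (γ : Fin n → ℝ) (V : Finset (Site d)) (L : ℕ) : Obs d n :=
  ((J * V.card : ℝ) : ℂ) • ((meanSpin V ^ 2) ⊗ₜ[ℂ] (1 : Lplus n)) +
    ∑ j, ((γ j : ℝ) : ℂ) • (meanSpin V ⊗ₜ[ℂ] (annCut j L + creCut j L))

/-- `U ∈ 𝓐` is the exponential of `K ∈ 𝓐`: for all `v ∈ 𝓗_spin ⊗ 𝓓` the series `∑_p K^p v / p!`
converges to `U v` in Hilbert space norm. For bounded `K` this says that `U` is the restriction of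
the operator exponential. -/
def IsExp {d n : ℕ} (K U : Obs d n) : Prop :=
  ∀ v : Dom d n, HasSum (fun p : ℕ => ((p.factorial : ℂ)⁻¹) • act d n (K ^ p) v) (act d n U v)

/-- `α` is the cut-off dynamics `α_{V,L}^t(X) = e^{i t H_{V,L}} X e^{-i t H_{V,L}}` of `𝓐`. -/
def IsCutoffDynamics {d n : ℕ} (J : ℝ) (γ : Fin n → ℝ) (V : Finset (Site d)) (L : ℕ)
    (α : ℝ → Obs d n → Obs d n) : Prop :=
  ∀ t : ℝ, ∃ U U' : Obs d n,
    IsExp ((Complex.I * (t : ℂ)) • hamiltonian J γ V L) U ∧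
    IsExp (-(Complex.I * (t : ℂ)) • hamiltonian J γ V L) U' ∧
    ∀ X, α t X = U * X * U'

/-- All spin operators `σ_α^i`. -/
def spinOps (d : ℕ) : Set (HSpin d →L[ℂ] HSpin d) :=
  Set.range fun p : Fin 3 × Site d => spinOp p.1 p.2

/-- The set `𝓕` of relevant vectors, for volumes `V` running along `𝓥`: those `Ψ` for which
`σ_3^V Ψ → σ_3^∞ Ψ` with `‖σ_3^∞‖ ≤ 1` and `σ_3^∞` in the center of the von Neumann algebra
generated by the spin operators (the intersection of the commutant and the bicommutant). -/
def relevant {d : ℕ} (𝓥 : Filter (Finset (Site d))) : Set (HSpin d) :=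
  {Ψ | ∃ S : HSpin d →L[ℂ] HSpin d,
    S ∈ (spinOps d).centralizer ∩ (spinOps d).centralizer.centralizer ∧ ‖S‖ ≤ 1 ∧
    Tendsto (fun V => meanSpin V Ψ) 𝓥 (𝓝 (S Ψ))}

/-- The strong seminorm `‖X‖^Ψ = sup |⟨χ₁ ⊗ χ₂, X (Ψ ⊗ φ₂)⟩|` over vectors of norm at most `1`;
it equals `‖X₁ Ψ‖ ‖X₂‖` on `X₁ ⊗ X₂`. As `𝓓` is dense, `χ₂` and `φ₂` may be taken in `𝓓`. The value
is `∞` if the supremum is not finite. -/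
def strongSeminorm {d n : ℕ} (Ψ : HSpin d) (X : Obs d n) : ℝ≥0∞ :=
  ⨆ (χ₁ : HSpin d) (χ₂ : D n) (φ₂ : D n) (_ : ‖χ₁‖ ≤ 1) (_ : ‖χ₂‖ ≤ 1) (_ : ‖φ₂‖ ≤ 1),
    ‖inner ℂ (χ₁ ⊗ₜ[ℂ] χ₂) (act d n X (Ψ ⊗ₜ[ℂ] φ₂))‖ₑ

/-- The seminorms of the topology `τ`:
`‖X‖^{f,k,Ψ} = max (‖f(M) X M^k‖^Ψ) (‖M^k X f(M)‖^Ψ)`. -/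
def tauSeminorm {d n : ℕ} (f : Fin n → RapidFun) (k : Fin n → ℕ) (Ψ : HSpin d) (X : Obs d n) :
    ℝ≥0∞ :=
  max (strongSeminorm Ψ ((1 ⊗ₜ opF f) * X * (1 ⊗ₜ opM k)))
    (strongSeminorm Ψ ((1 ⊗ₜ opM k) * X * (1 ⊗ₜ opF f)))

/-- Convergence `Y → X` in `𝓐[τ]` along the filter `l`: all seminorms `‖Y - X‖^{f,k,Ψ}` with
`f` in `𝓒`, `k` an integer and `Ψ` relevant (along `𝓥`) tend to `0`. -/
def TauTendsto {d n : ℕ} {ι : Type*} (𝓥 : Filter (Finset (Site d))) (l : Filter ι)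
    (Y : ι → Obs d n) (X : Obs d n) : Prop :=
  ∀ (f : Fin n → RapidFun) (k : Fin n → ℕ), ∀ Ψ ∈ relevant 𝓥,
    Tendsto (fun p => tauSeminorm f k Ψ (Y p - X)) l (𝓝 0)

end Model

end

end SpinBoson

/-! Write `S = σ_3^V` and `B = ∑ γ_j (a_{j,L} + a_{j,L}†)`. Both have finite real spectral
decompositions inside their algebras: `S` is a mean of commuting involutions, and each summand of
`B` is a Hermitian matrix of size `L + 1` acting on the levels `0, …, L` of one mode. With `S = ∑
λ_i P_i` one gets `e^{itH} = ∑ P_i ⊗ e^{itJ|V|λ_i²} e^{itλ_i B}`, a finite sum, so the exponential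
lies in the algebraic tensor product and its conjugation action is explicit.

For `a_j` the scalar phases cancel, leaving `∑ P_i ⊗ e^{itλ_i B} a_j e^{-itλ_i B}`. The commutator
`[B, a_j]` equals `-γ_j` up to a `defect` supported near the cutoff level, so each block differs
from `a_j - iγ_j tλ_i` by an error of order `1/L`, uniformly in `|λ_i| ≤ 1` and hence in `V`. The
limit is `a_j - iγ_j t σ_3^∞`.

For `σ_a^i` with `a ≠ 2` (in the indexing `0, 1, 2`), anticommutation with `σ_3^i` shifts an
eigenvalue of `S` by `2/|V|` in absolute value. What survives is `σ_a^i` times `exp(-4itJ(σ_3^i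
σ_3^V - |V|⁻¹))`, strongly convergent on relevant vectors, times factors `e^{isB}` with `|s| =
2|t|/|V|`, which tend to `1` uniformly in `L`. Thus the joint limit exists without coupling `|V|` to
`L`, and the constrained limit is a special case.

The errors are controlled by integer powers, of either sign, of the weight `w = M_1 ⋯ M_n`. The key
estimate is `norm_wpow_weyl_le`: `e^{isB}` is bounded in the norm of `w^K` uniformly in `L`, because
`w^K a† w^{-K} - w^{-K} a† w^K` is bounded (`norm_twist_le`). Losing finitely many powers of `w` is
harmless in `τ`, since `f(M)` gains arbitrarily many (`exists_weightBound`). Uniformity in the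
number of spin blocks comes from their orthogonality (`strongBound_sum`). Finally `σ_3^∞` may depend
on the vector, so `exists_strongLimit` produces one operator that serves all relevant vectors. -/

namespace SpinBoson

noncomputable section

/-! ### Algebraic relations of the spin operators on the infinite tensor product. -/

section SpinAlgebra

variable {d : ℕ}

/-- A finite combination of labelled product vectors, as a vector of the infinite tensor product. -/
def ofPre (x : RKHS.H₀ (overlapKernel d)) : HSpin d :=
  (show RKHS.OfKernel (overlapKernel d) from (x : UniformSpace.Completion (RKHS.H₀ (overlapKernel d))))

theorem ofPre_add (x y : RKHS.H₀ (overlapKernel d)) : ofPre (x + y) = ofPre x + ofPre y :=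
  UniformSpace.Completion.coe_add x y

theorem denseRange_ofPre : DenseRange (ofPre (d := d)) :=
  UniformSpace.Completion.denseRange_coe

theorem inner_ofPre_single (φ ψ : ProductVector d) (u v c e : ℂ) :
    inner ℂ (ofPre (Finsupp.single (φ, u) c)) (ofPre (Finsupp.single (ψ, v) e)) =
      (starRingEnd ℂ) (c * u) * (e * v) * overlap φ ψ := by
  refine (UniformSpace.Completion.inner_coe (𝕜 := ℂ)
    (Finsupp.single (φ, u) c : RKHS.H₀ (overlapKernel d))
    (Finsupp.single (ψ, v) e : RKHS.H₀ (overlapKernel d))).trans ?_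
  change Finsupp.sum _ _ = _
  have h := overlap_conj φ ψ
  simp only [RCLike.star_def] at h
  simp [overlapKernel, h]
  ring

theorem spinOp_ofPre (α : Fin 3) (i : Site d) (x : RKHS.H₀ (overlapKernel d)) :
    spinOp α i (ofPre x) = ofPre (spinPre α i x) :=
  ContinuousLinearMap.completion_apply_coe (spinPre α i) x

theorem spinPre_single (α : Fin 3) (i : Site d) (φ : ProductVector d) (u c : ℂ) :
    spinPre α i (Finsupp.single (φ, u) c : RKHS.H₀ (overlapKernel d)) =
      (Finsupp.single (siteFlip α i φ, u) c : RKHS.H₀ (overlapKernel d)) :=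
  Finsupp.mapDomain_single

theorem spinOp_ofPre_single (α : Fin 3) (i : Site d) (φ : ProductVector d) (u c : ℂ) :
    spinOp α i (ofPre (Finsupp.single (φ, u) c)) = ofPre (Finsupp.single (siteFlip α i φ, u) c) := by
  rw [spinOp_ofPre, spinPre_single]

theorem ofPre_induction {p : HSpin d → Prop} (hc : IsClosed {x | p x}) (h0 : p 0)
    (hadd : ∀ x y, p x → p y → p (x + y))
    (hs : ∀ φ u c, p (ofPre (Finsupp.single (φ, u) c))) (x : HSpin d) : p x := by
  refine denseRange_ofPre.induction_on x hc fun y => ?_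
  induction y using Finsupp.induction_linear with
  | zero =>
    have : ofPre (0 : RKHS.H₀ (overlapKernel d)) = 0 := by
      have := ofPre_add (0 : RKHS.H₀ (overlapKernel d)) 0
      simpa using this
    rwa [this]
  | add f g hf hg => rw [ofPre_add]; exact hadd _ _ hf hg
  | single a b => exact hs a.1 a.2 b

theorem spin_ext {A B : HSpin d →L[ℂ] HSpin d}
    (h : ∀ φ u c, A (ofPre (Finsupp.single (φ, u) c)) = B (ofPre (Finsupp.single (φ, u) c))) :
    A = B := by
  ext x
  refine ofPre_induction (p := fun x => A x = B x) (isClosed_eq A.continuous B.continuous)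
    (by simp) (fun x y hx hy => by simp [hx, hy]) h x

/-- Formal combinations of labels have null vectors: multiplying one factor by a scalar gives a
different label. Relations of this kind become visible only through inner products with product
vectors. -/
theorem eq_zero_of_inner_single {x : HSpin d}
    (h : ∀ φ u c, inner ℂ x (ofPre (Finsupp.single (φ, u) c)) = 0) : x = 0 := by
  refine inner_self_eq_zero (𝕜 := ℂ).mp ?_
  refine ofPre_induction (p := fun y => inner ℂ x y = 0)
    (isClosed_eq (by fun_prop) (by fun_prop)) (by simp)
    (fun x y hx hy => by simp [hx, hy]) h x

theorem pauli_sq (α : Fin 3) : pauli α * pauli α = 1 := by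
  fin_cases α <;> ext i j <;> fin_cases i <;> fin_cases j <;> simp [pauli]

theorem siteFlip_apply_self (α : Fin 3) (i : Site d) (φ : ProductVector d) :
    (siteFlip α i φ i : Qubit) = Matrix.toEuclideanLin (pauli α) (φ i : Qubit) := by
  simp [siteFlip]

theorem siteFlip_apply_ne (α : Fin 3) {i j : Site d} (h : j ≠ i) (φ : ProductVector d) :
    siteFlip α i φ j = φ j := by
  simp [siteFlip, h]

theorem siteFlip_siteFlip (α : Fin 3) (i : Site d) (φ : ProductVector d) :
    siteFlip α i (siteFlip α i φ) = φ := by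
  funext j
  by_cases h : j = i
  · subst h
    apply Subtype.ext
    rw [siteFlip_apply_self, siteFlip_apply_self, ← LinearMap.comp_apply, ← Matrix.toLpLin_mul_same,
      pauli_sq]
    simp
  · rw [siteFlip_apply_ne _ h, siteFlip_apply_ne _ h]

theorem siteFlip_comm (α β : Fin 3) {i j : Site d} (h : i ≠ j) (φ : ProductVector d) :
    siteFlip α i (siteFlip β j φ) = siteFlip β j (siteFlip α i φ) := by
  funext l
  apply Subtype.ext
  by_cases hi : l = i
  · subst hi
    rw [siteFlip_apply_self, siteFlip_apply_ne _ h, siteFlip_apply_ne _ h, siteFlip_apply_self]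
  · rw [siteFlip_apply_ne _ hi]
    by_cases hj : l = j
    · subst hj
      rw [siteFlip_apply_self, siteFlip_apply_self, siteFlip_apply_ne _ hi]
    · rw [siteFlip_apply_ne _ hj, siteFlip_apply_ne _ hj, siteFlip_apply_ne _ hi]

theorem spinOp_mul_self (α : Fin 3) (i : Site d) : spinOp α i * spinOp α i = 1 := by
  refine spin_ext fun φ u c => ?_
  simp [spinOp_ofPre_single, siteFlip_siteFlip]

theorem spinOp_commute (α β : Fin 3) {i j : Site d} (h : i ≠ j) :
    Commute (spinOp α i) (spinOp β j) := by
  refine spin_ext fun φ u c => ?_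
  simp [spinOp_ofPre_single, siteFlip_comm α β h]

theorem norm_spinOp_apply (α : Fin 3) (i : Site d) (x : HSpin d) : ‖spinOp α i x‖ = ‖x‖ := by
  refine denseRange_ofPre.induction_on (p := fun x => ‖spinOp α i x‖ = ‖x‖) x
    (isClosed_eq (by fun_prop) (by fun_prop)) fun y => ?_
  rw [spinOp_ofPre]
  refine (UniformSpace.Completion.norm_coe (spinPre α i y)).trans ?_
  refine Eq.trans ?_ (UniformSpace.Completion.norm_coe y).symm
  unfold spinPre
  rw [LinearIsometry.coe_toContinuousLinearMap]
  exact LinearIsometry.norm_map _ y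

theorem inner_spinOp (α : Fin 3) (i : Site d) (x y : HSpin d) :
    inner ℂ (spinOp α i x) (spinOp α i y) = inner ℂ x y :=
  (LinearMap.norm_map_iff_inner_map_map (𝕜 := ℂ) (spinOp α i)).mp (norm_spinOp_apply α i) x y

theorem isSelfAdjoint_spinOp (α : Fin 3) (i : Site d) : IsSelfAdjoint (spinOp α i) := by
  rw [ContinuousLinearMap.isSelfAdjoint_iff_isSymmetric]
  intro x y
  have h : spinOp α i (spinOp α i y) = y := congrArg (fun A => A y) (spinOp_mul_self α i)
  conv_lhs => rw [← h]
  exact inner_spinOp α i x _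

/-- Changing one factor affects a single term of the series that defines strong equivalence, so the
equivalence class is kept and only the sign of one factor of the infinite product changes. -/
theorem overlap_neg {φ φ' ψ : ProductVector d} (i : Site d) (hi : (φ' i : Qubit) = -φ i)
    (hne : ∀ j, j ≠ i → φ' j = φ j) : overlap φ' ψ = -overlap φ ψ := by
  have hs : StronglyEquiv φ' ψ ↔ StronglyEquiv φ ψ := by
    unfold StronglyEquiv
    refine summable_congr_cofinite ?_
    filter_upwards [(Set.finite_singleton i).compl_mem_cofinite] with j hj
    rw [hne j hj]
  unfold overlap
  by_cases h : StronglyEquiv φ ψ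
  · rw [if_pos (hs.mpr h), if_pos h]
    have key : ∀ χ : ProductVector d, StronglyEquiv χ ψ →
        Multipliable fun j => inner ℂ (χ j : Qubit) (ψ j : Qubit) := fun χ hχ => by
      have h' : Summable fun i : Site d => ‖inner ℂ (χ i : Qubit) (ψ i : Qubit) - 1‖ :=
        hχ.congr fun i => norm_sub_rev _ _
      simpa using multipliable_one_add_of_summable h'
    have hb : ∀ j, inner ℂ (φ' j : Qubit) (ψ j : Qubit) =
        (if j = i then (-1 : ℂ) else 1) * inner ℂ (φ j : Qubit) (ψ j : Qubit) := fun j => by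
      by_cases hj : j = i
      · subst hj; simp [hi]
      · simp [hj, hne j hj]
    simp only [hb]
    have hp : HasProd (fun j => if j = i then (-1 : ℂ) else 1) (-1) := hasProd_ite_eq i (-1)
    rw [hp.multipliable.tprod_mul (key φ h), hp.tprod_eq]
    ring
  · rw [if_neg (hs.not.mpr h), if_neg h, neg_zero]

theorem pauli_anticomm {α : Fin 3} (h : α ≠ 2) : pauli α * pauli 2 = -(pauli 2 * pauli α) := by
  fin_cases α <;> first | exact absurd rfl h |
    (ext i j; fin_cases i <;> fin_cases j <;> simp [pauli])

/-- The two orders of the Pauli matrices give labels differing by a sign at site `i`. They are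
opposite as vectors but not as formal labels, hence the test against all product vectors. -/
theorem spinOp_anticomm {α : Fin 3} (h : α ≠ 2) (i : Site d) :
    spinOp α i * spinOp 2 i = -(spinOp 2 i * spinOp α i) := by
  refine spin_ext fun φ u c => ?_
  rw [← sub_eq_zero]
  refine eq_zero_of_inner_single fun ψ v e => ?_
  have hφ : overlap (siteFlip α i (siteFlip 2 i φ)) ψ =
      -overlap (siteFlip 2 i (siteFlip α i φ)) ψ := by
    refine overlap_neg i ?_ fun j hj => by simp [siteFlip_apply_ne _ hj]
    simp only [siteFlip_apply_self]
    rw [← LinearMap.comp_apply, ← Matrix.toLpLin_mul_same, pauli_anticomm h,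
      ← LinearMap.comp_apply, ← Matrix.toLpLin_mul_same]
    simp
  simp [spinOp_ofPre_single, inner_ofPre_single, hφ]

end SpinAlgebra

/-! ### Finite functional calculus in a complex algebra. -/

section SpectralMap

variable {A : Type*} [Ring A] [Algebra ℂ A] {ι κ : Type*} [Fintype ι] [Fintype κ]

/-- The element `∑ c_i E_i` with spectral family `E` and spectral values `c`. -/
def specMap (E : ι → A) (c : ι → ℂ) : A := ∑ i, c i • E i

theorem specMap_add (E : ι → A) (c c' : ι → ℂ) :
    specMap E (fun i => c i + c' i) = specMap E c + specMap E c' := by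
  simp [specMap, add_smul, Finset.sum_add_distrib]

theorem specMap_smul (E : ι → A) (z : ℂ) (c : ι → ℂ) :
    specMap E (fun i => z * c i) = z • specMap E c := by
  simp [specMap, mul_smul, Finset.smul_sum]

variable {E : ι → A} {F : κ → A} (hE : CompleteOrthogonalIdempotents E)
  (hF : CompleteOrthogonalIdempotents F)

include hE in
theorem specMap_one : specMap E (fun _ => 1) = 1 := by
  simp [specMap, hE.complete]

include hE in
theorem mul_specMap (c : ι → ℂ) (i : ι) : E i * specMap E c = c i • E i := by
  classical
  simp only [specMap, Finset.mul_sum, mul_smul_comm, hE.mul_eq]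
  simp

include hE in
theorem specMap_mul (c c' : ι → ℂ) :
    specMap E c * specMap E c' = specMap E (fun i => c i * c' i) := by
  rw [specMap, Finset.sum_mul]
  exact Finset.sum_congr rfl fun i _ => by rw [smul_mul_assoc, mul_specMap hE, smul_smul]

/-- The functional calculus of a spectral family, as a homomorphism of algebras. -/
def specHom : (ι → ℂ) →ₐ[ℂ] A :=
  AlgHom.ofLinearMap
    { toFun := specMap E
      map_add' := specMap_add E
      map_smul' := specMap_smul E }
    (specMap_one hE) fun c c' => (specMap_mul hE c c').symm

theorem specHom_apply (c : ι → ℂ) : specHom hE c = specMap E c := rfl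

include hE in
theorem specMap_pow (c : ι → ℂ) (p : ℕ) : specMap E c ^ p = specMap E (fun i => c i ^ p) :=
  (map_pow (specHom hE) c p).symm

include hE in
theorem specMap_eval (c : ι → ℂ) (p : Polynomial ℂ) :
    specMap E (fun i => p.eval (c i)) = Polynomial.aeval (specMap E c) p := by
  rw [← specHom_apply hE, ← specHom_apply hE, Polynomial.aeval_algHom_apply]
  congr 1
  funext i
  rw [Polynomial.aeval_pi_apply]
  simp

include hE hF in
/-- The functional calculus does not depend on the spectral family. -/
theorem specMap_comp_eq {a : ι → ℂ} {b : κ → ℂ} (h : specMap E a = specMap F b) (g : ℂ → ℂ) :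
    specMap E (fun i => g (a i)) = specMap F (fun k => g (b k)) := by
  classical
  -- Interpolating `g` on the union of both sets of spectral values replaces it by a single
  -- polynomial, and a polynomial in an element does not depend on the decomposition.
  let s : Finset ℂ := Finset.univ.image a ∪ Finset.univ.image b
  let p := Lagrange.interpolate s id g
  have hp : ∀ x ∈ s, p.eval x = g x := fun x hx =>
    Lagrange.eval_interpolate_at_node g (v := id) Function.injective_id.injOn hx
  have ha : (fun i => g (a i)) = fun i => p.eval (a i) := by
    funext i; rw [hp]; simp [s]
  have hb : (fun i => g (b i)) = fun i => p.eval (b i) := by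
    funext i; rw [hp]; simp [s]
  rw [ha, hb, specMap_eval hE, specMap_eval hF, h]

include hE hF in
omit [Algebra ℂ A] in
theorem COI_mul (hc : ∀ i k, Commute (E i) (F k)) :
    CompleteOrthogonalIdempotents (fun p : ι × κ => E p.1 * F p.2) := by
  classical
  rw [CompleteOrthogonalIdempotents.iff_ortho_complete]
  constructor
  · rintro ⟨i, k⟩ ⟨i', k'⟩ hne
    have : E i * F k * (E i' * F k') = (E i * E i') * (F k * F k') := by
      rw [mul_assoc, ← mul_assoc (F k), ← (hc i' k).eq]
      simp only [mul_assoc]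
    simp only [this, hE.mul_eq, hF.mul_eq]
    by_cases h : i = i'
    · have : k ≠ k' := fun h' => hne (by rw [h, h'])
      simp [this]
    · simp [h]
  · rw [Fintype.sum_prod_type]
    simp [← Finset.mul_sum, hE.complete, hF.complete]

theorem specMap_prod (f : ι → ℂ) (g : κ → ℂ) :
    specMap (fun p : ι × κ => E p.1 * F p.2) (fun p => f p.1 * g p.2) =
      specMap E f * specMap F g := by
  simp only [specMap, Fintype.sum_prod_type, Finset.sum_mul_sum, smul_mul_smul_comm]

include hF in
theorem specMap_fst (f : ι → ℂ) :
    specMap (fun p : ι × κ => E p.1 * F p.2) (fun p => f p.1) = specMap E f := by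
  have := specMap_prod (E := E) (F := F) f (fun _ => 1)
  simpa [specMap_one hF] using this

include hE in
theorem specMap_snd (g : κ → ℂ) :
    specMap (fun p : ι × κ => E p.1 * F p.2) (fun p => g p.2) = specMap F g := by
  have := specMap_prod (E := E) (F := F) (fun _ => 1) g
  simpa [specMap_one hE] using this

theorem COI_map {B : Type*} [Ring B] [Algebra ℂ B] (f : A →ₐ[ℂ] B)
    (hE : CompleteOrthogonalIdempotents E) : CompleteOrthogonalIdempotents (fun i => f (E i)) :=
  hE.map (f : A →+* B)

theorem specMap_map {B : Type*} [Ring B] [Algebra ℂ B] (f : A →ₐ[ℂ] B) (c : ι → ℂ) :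
    specMap (fun i => f (E i)) c = f (specMap E c) := by
  simp [specMap]

-- The algebra itself needs no topology: convergence is asserted only after a linear map `T` into a
-- topological vector space, such as evaluation at a vector, where finitely many scalar exponential
-- series are summed.
include hE in
theorem hasSum_exp_specMap {V : Type*} [AddCommGroup V] [Module ℂ V] [TopologicalSpace V]
    [ContinuousAdd V] [ContinuousSMul ℂ V] (T : A →ₗ[ℂ] V) (c : ι → ℂ) :
    HasSum (fun p : ℕ => ((p.factorial : ℂ)⁻¹) • T (specMap E c ^ p))
      (T (specMap E fun i => Complex.exp (c i))) := by
  simp only [specMap_pow hE]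
  simp only [specMap, map_sum, map_smul, Finset.smul_sum, smul_smul]
  refine hasSum_sum fun i _ => HasSum.smul_const ?_ _
  have := NormedSpace.expSeries_div_hasSum_exp (c i)
  rw [← Complex.exp_eq_exp_ℂ] at this
  simpa [div_eq_inv_mul] using this

theorem hasDerivAt_specMap {V : Type*} [NormedAddCommGroup V] [NormedSpace ℂ V]
    (T : A →ₗ[ℂ] V) (c : ι → ℂ) (r : ℝ) :
    HasDerivAt (fun r : ℝ => T (specMap E fun i => Complex.exp (r * c i)))
      (T (specMap E fun i => c i * Complex.exp (r * c i))) r := by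
  simp only [specMap, map_sum, map_smul]
  refine HasDerivAt.fun_sum fun i _ => HasDerivAt.smul_const ?_ _
  have h1 : HasDerivAt (fun r : ℝ => (r : ℂ) * c i) (c i) r := by
    simpa using (Complex.ofRealCLM.hasDerivAt (x := r)).mul_const (c i)
  simpa [mul_comm] using h1.cexp

theorem hasDerivAt_specMap₂ {V : Type*} [NormedAddCommGroup V] [NormedSpace ℂ V]
    (T : A →ₗ[ℂ] A →ₗ[ℂ] V) (c c' : ι → ℂ) (r : ℝ) :
    HasDerivAt (fun r : ℝ => T (specMap E fun i => Complex.exp (r * c i))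
        (specMap E fun i => Complex.exp (r * c' i)))
      (T (specMap E fun i => c i * Complex.exp (r * c i)) (specMap E fun i => Complex.exp (r * c' i))
        + T (specMap E fun i => Complex.exp (r * c i))
          (specMap E fun i => c' i * Complex.exp (r * c' i))) r := by
  have h1 : ∀ (c : ι → ℂ) i, HasDerivAt (fun r : ℝ => Complex.exp (r * c i))
      (c i * Complex.exp (r * c i)) r := fun c i => by
    have h1 : HasDerivAt (fun r : ℝ => (r : ℂ) * c i) (c i) r := by
      simpa using (Complex.ofRealCLM.hasDerivAt (x := r)).mul_const (c i)
    simpa [mul_comm] using h1.cexp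
  simp only [specMap, map_sum, map_smul, LinearMap.sum_apply, LinearMap.smul_apply,
    Finset.smul_sum, smul_smul, ← Finset.sum_add_distrib, ← add_smul]
  refine HasDerivAt.fun_sum fun i _ => HasDerivAt.fun_sum fun j _ => HasDerivAt.smul_const ?_ _
  exact ((h1 c' i).mul (h1 c j)).congr_deriv (by ring)

/-- `x` has a finite real spectral decomposition with spectral projections in `C`. -/
def HasRealSpectrum (C : Set A) (x : A) : Prop :=
  ∃ (ι : Type) (_ : Fintype ι) (E : ι → A) (l : ι → ℝ), CompleteOrthogonalIdempotents E ∧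
    (∀ i, E i ∈ C) ∧ specMap E (fun i => (l i : ℂ)) = x

theorem HasRealSpectrum.mono {C C' : Set A} {x : A} (h : HasRealSpectrum C x) (hC : C ⊆ C') :
    HasRealSpectrum C' x := by
  obtain ⟨ι, _, E, l, hE, hEC, hx⟩ := h
  exact ⟨ι, _, E, l, hE, fun i => hC (hEC i), hx⟩

theorem HasRealSpectrum.zero {C : Set A} (h : (1 : A) ∈ C) : HasRealSpectrum C (0 : A) :=
  ⟨Unit, inferInstance, fun _ => 1, fun _ => 0,
    CompleteOrthogonalIdempotents.unique_iff.mpr rfl, fun _ => h, by simp [specMap]⟩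

theorem HasRealSpectrum.smul {C : Set A} {x : A} (h : HasRealSpectrum C x) (s : ℝ) :
    HasRealSpectrum C ((s : ℂ) • x) := by
  obtain ⟨ι, _, E, l, hE, hEC, rfl⟩ := h
  exact ⟨ι, _, E, fun i => s * l i, hE, hEC, by simp [← specMap_smul]⟩

/-- Products of commuting spectral projections diagonalize both summands at once. The sets `C`, `C'`
and `C''` carry the commutation properties along, so that summands can be added by induction. -/
theorem HasRealSpectrum.add {C C' C'' : Set A} {x y : A} (hx : HasRealSpectrum C x)
    (hy : HasRealSpectrum C' y) (hc : ∀ a ∈ C, ∀ b ∈ C', Commute a b)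
    (hm : ∀ a ∈ C, ∀ b ∈ C', a * b ∈ C'') : HasRealSpectrum C'' (x + y) := by
  obtain ⟨ι, _, E, l, hE, hEC, rfl⟩ := hx
  obtain ⟨κ, _, F, l', hF, hFC, rfl⟩ := hy
  refine ⟨ι × κ, inferInstance, fun p => E p.1 * F p.2, fun p => l p.1 + l' p.2,
    COI_mul hE hF fun i k => hc _ (hEC i) _ (hFC k), fun p => hm _ (hEC _) _ (hFC _), ?_⟩
  have := specMap_add (fun p : ι × κ => E p.1 * F p.2) (fun p => (l p.1 : ℂ)) (fun p => (l' p.2 : ℂ))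
  rw [specMap_fst hF (fun i => (l i : ℂ)), specMap_snd hE (fun i => (l' i : ℂ))] at this
  simpa using this

end SpectralMap

/-! ### Strong limits of bounded operators and of their exponentials. -/

section StrongLimits

variable {H : Type*} [NormedAddCommGroup H] [InnerProductSpace ℂ H] [CompleteSpace H]
  {κ : Type*} {l : Filter κ}

/-- A uniformly bounded family of operators has a bounded operator inducing all its strong
limits. -/
theorem exists_strongLimit (l : Filter κ) (T : κ → H →L[ℂ] H) (C : ℝ) (hT : ∀ v, ‖T v‖ ≤ C) :
    ∃ S : H →L[ℂ] H, ∀ x y, Tendsto (fun v => T v x) l (𝓝 y) →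
      Tendsto (fun v => T v x) l (𝓝 (S x)) := by
  rcases l.eq_or_neBot with rfl | _
  · exact ⟨0, fun x y _ => tendsto_bot⟩
  -- The vectors on which the family converges form a subspace, on which the limit is linear and
  -- bounded by `C`.
  let G : Submodule ℂ H :=
    { carrier := {x | ∃ y, Tendsto (fun v => T v x) l (𝓝 y)}
      zero_mem' := ⟨0, by simp⟩
      add_mem' := by
        rintro x x' ⟨y, hy⟩ ⟨y', hy'⟩
        exact ⟨y + y', by simpa using hy.add hy'⟩
      smul_mem' := by
        rintro c x ⟨y, hy⟩
        exact ⟨c • y, by simpa using hy.const_smul c⟩ }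
  choose f hf using fun x : G => x.2
  let fl : G →ₗ[ℂ] H :=
    { toFun := f
      map_add' := fun x y => tendsto_nhds_unique (hf (x + y)) (by simpa using (hf x).add (hf y))
      map_smul' := fun c x =>
        tendsto_nhds_unique (hf (c • x)) (by simpa using (hf x).const_smul c) }
  let e : G →ₗ[ℂ] G.topologicalClosure := Submodule.inclusion G.le_topologicalClosure
  have hd : DenseRange e := by
    intro x
    rw [closure_subtype]
    convert x.2
    have : Subtype.val '' Set.range e = (G : Set H) := by
      ext y
      constructor
      · rintro ⟨_, ⟨z, rfl⟩, rfl⟩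
        exact z.2
      · intro hy
        exact ⟨e ⟨y, hy⟩, ⟨⟨y, hy⟩, rfl⟩, rfl⟩
    rw [this]
    rfl
  have hn : ∃ C, ∀ x, ‖fl x‖ ≤ C * ‖e x‖ := ⟨C, fun x =>
    le_of_tendsto (hf x).norm (.of_forall fun v =>
      ((T v).le_opNorm _).trans (mul_le_mul_of_nonneg_right (hT v) (norm_nonneg _)))⟩
  -- Extend by continuity to the closure of `G` and by zero on its orthogonal complement.
  refine ⟨(fl.extendOfNorm e) ∘L G.topologicalClosure.orthogonalProjectionOnto, fun x y hxy => ?_⟩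
  have hx : x ∈ G := ⟨y, hxy⟩
  have h1 : G.topologicalClosure.orthogonalProjectionOnto x = e ⟨x, hx⟩ :=
    Submodule.orthogonalProjectionOnto_mem_subspace_eq_self (e ⟨x, hx⟩)
  rw [ContinuousLinearMap.comp_apply, h1, LinearMap.extendOfNorm_eq hd hn]
  exact hf ⟨x, hx⟩

omit [CompleteSpace H] in
theorem norm_pow_apply_le {A : H →L[ℂ] H} {C : ℝ} (hA : ‖A‖ ≤ C) (p : ℕ) (x : H) :
    ‖(A ^ p) x‖ ≤ C ^ p * ‖x‖ := by
  induction p with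
  | zero => simp
  | succ p ih =>
    rw [pow_succ', pow_succ']
    calc ‖A ((A ^ p) x)‖ ≤ ‖A‖ * ‖(A ^ p) x‖ := A.le_opNorm _
      _ ≤ C * (C ^ p * ‖x‖) := mul_le_mul hA ih (norm_nonneg _) ((norm_nonneg _).trans hA)
      _ = _ := by ring

-- Telescoping gives `X^{p+1}x - Y^{p+1}x = X^p(Xx - Yx) + Y(X^p x - Y^p x)`. Commutation with `Y`
-- is what makes convergence at the single vector `x` sufficient.
omit [CompleteSpace H] in
theorem tendsto_pow_apply {X : κ → H →L[ℂ] H} {Y : H →L[ℂ] H} {C : ℝ} {x : H}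
    (hX : ∀ v, ‖X v‖ ≤ C) (hc : ∀ v, Commute (X v) Y)
    (h : Tendsto (fun v => X v x) l (𝓝 (Y x))) (p : ℕ) :
    Tendsto (fun v => (X v ^ p) x) l (𝓝 ((Y ^ p) x)) := by
  induction p with
  | zero => simpa using tendsto_const_nhds
  | succ p ih =>
    have h1 : Tendsto (fun v => (X v ^ p) (X v x - Y x)) l (𝓝 0) := by
      have h0 : Tendsto (fun v => C ^ p * ‖X v x - Y x‖) l (𝓝 0) := by
        have := (tendsto_sub_nhds_zero_iff.mpr h).norm
        simpa using this.const_mul (C ^ p)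
      exact squeeze_zero_norm (fun v => norm_pow_apply_le (hX v) p _) h0
    have h2 : Tendsto (fun v => Y ((X v ^ p) x)) l (𝓝 (Y ((Y ^ p) x))) :=
      (Y.continuous.tendsto _).comp ih
    have h3 := h1.add h2
    rw [zero_add] at h3
    convert h3 using 2 with v
    · have : Y ((X v ^ p) x) = (X v ^ p) (Y x) :=
        congrArg (fun A : H →L[ℂ] H => A x) ((hc v).pow_left p).eq.symm
      rw [this, map_sub, pow_succ]
      simp
    · rw [pow_succ']; rfl

/-- Dominated convergence in the exponential series, with majorant `C^p ‖x‖ / p!`. -/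
theorem tendsto_exp_apply {X : κ → H →L[ℂ] H} {Y : H →L[ℂ] H} {C : ℝ} {x : H}
    (hX : ∀ v, ‖X v‖ ≤ C) (hc : ∀ v, Commute (X v) Y)
    (h : Tendsto (fun v => X v x) l (𝓝 (Y x))) :
    Tendsto (fun v => NormedSpace.exp (X v) x) l (𝓝 (NormedSpace.exp Y x)) := by
  have key : ∀ A : H →L[ℂ] H, NormedSpace.exp A x = ∑' p : ℕ, ((p.factorial : ℂ)⁻¹) • (A ^ p) x :=
    fun A => by
      have h1 := NormedSpace.exp_series_hasSum_exp' (𝕂 := ℂ) A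
      exact ((ContinuousLinearMap.apply ℂ H x).hasSum h1).tsum_eq.symm
  simp only [key]
  refine tendsto_tsum_of_dominated_convergence (bound := fun p => (C ^ p / p.factorial) * ‖x‖)
    ((Real.summable_pow_div_factorial C).mul_right _)
    (fun p => (tendsto_pow_apply hX hc h p).const_smul _) (.of_forall fun v p => ?_)
  rw [norm_smul, norm_inv, Complex.norm_natCast, div_eq_inv_mul, mul_assoc]
  gcongr
  exact norm_pow_apply_le (hX v) p x

/-- Self-adjoint orthogonal idempotents have orthogonal ranges, so this is Pythagoras. Indices with
`E i = 0` are exempt because the value attached to them is arbitrary. -/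
theorem norm_specMap_apply_le {ι : Type*} [Fintype ι] {E : ι → H →L[ℂ] H}
    (hE : CompleteOrthogonalIdempotents E) (hs : ∀ i, IsSelfAdjoint (E i)) {z : ι → ℂ} {ε : ℝ}
    (hz : ∀ i, E i ≠ 0 → ‖z i‖ ≤ ε) (hε : 0 ≤ ε) (x : H) : ‖specMap E z x‖ ≤ ε * ‖x‖ := by
  have hsq : ∀ z : ι → ℂ, ‖specMap E z x‖ ^ 2 = ∑ i, ‖z i‖ ^ 2 * ‖E i x‖ ^ 2 := fun z => by
    classical
    have h1 : ∀ i j, inner ℂ (E i x) (E j x) = if i = j then ((‖E i x‖ ^ 2 : ℝ) : ℂ) else 0 := by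
      intro i j
      split_ifs with h
      · subst h; rw [inner_self_eq_norm_sq_to_K]; simp
      · have h2 := ContinuousLinearMap.isSelfAdjoint_iff_isSymmetric.mp (hs i) x (E j x)
        refine h2.trans ?_
        have h3 : E i (E j x) = 0 := congrArg (fun A : H →L[ℂ] H => A x) (hE.ortho h)
        change inner ℂ x (E i (E j x)) = 0
        rw [h3, inner_zero_right]
    have h2 : (inner ℂ (specMap E z x) (specMap E z x) : ℂ)
        = ((∑ i, ‖z i‖ ^ 2 * ‖E i x‖ ^ 2 : ℝ) : ℂ) := by
      simp only [specMap, sum_apply, smul_apply, sum_inner,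
        inner_sum, inner_smul_left, inner_smul_right, h1]
      simp only [mul_ite, mul_zero, Finset.sum_ite_eq', Finset.mem_univ,
        if_true]
      push_cast
      refine Finset.sum_congr rfl fun i _ => ?_
      rw [← Complex.conj_mul']
      ring
    rw [inner_self_eq_norm_sq_to_K] at h2
    exact Complex.ofReal_injective (by simpa using h2)
  have h1 : ‖x‖ ^ 2 = ∑ i, ‖E i x‖ ^ 2 := by
    have := hsq fun _ => 1
    rw [specMap_one hE] at this
    simpa using this
  refine (sq_le_sq₀ (norm_nonneg _) (by positivity)).mp ?_
  rw [hsq, mul_pow, h1, Finset.mul_sum]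
  refine Finset.sum_le_sum fun i _ => ?_
  by_cases h : E i = 0
  · simp [h]
  · gcongr
    exact hz i h

end StrongLimits

/-! ### Spectral decomposition of sums of `σ_3^i`. -/

section SpinSpectrum

variable {d : ℕ}

/-- The self-adjoint operators commuting with all `σ_3^i` and with all spins outside `s`. -/
def spinDiagonal (s : Finset (Site d)) : Set (HSpin d →L[ℂ] HSpin d) :=
  {A | IsSelfAdjoint A ∧ ∀ a i, (i ∉ s ∨ a = 2) → Commute A (spinOp a i)}

theorem spinOp_two_commute (i : Site d) {a : Fin 3} {j : Site d} (h : j ≠ i ∨ a = 2) :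
    Commute (spinOp 2 i) (spinOp a j) := by
  by_cases hij : j = i
  · subst hij
    obtain rfl := h.resolve_left (by simp)
    exact Commute.refl _
  · exact spinOp_commute _ _ (Ne.symm hij)

/-- The spectral projections of `σ_3^i`. -/
def spinProj (i : Site d) (e : Bool) : HSpin d →L[ℂ] HSpin d :=
  (1 / 2 : ℂ) • (1 + (if e then (1 : ℂ) else -1) • spinOp 2 i)

theorem spinProj_COI (i : Site d) : CompleteOrthogonalIdempotents (spinProj i) := by
  rw [CompleteOrthogonalIdempotents.iff_ortho_complete]
  have h := spinOp_mul_self 2 i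
  constructor
  · intro e e' hne
    cases e <;> cases e' <;> first | exact absurd rfl hne |
      (simp only [spinProj, mul_add, add_mul, smul_mul_assoc, mul_smul_comm, h, smul_add,
        mul_one, one_mul, if_true, Bool.false_eq_true, if_false]; module)
  · simp only [spinProj, Fintype.sum_bool, ← smul_add]
    simp only [if_true, one_smul, Bool.false_eq_true, if_false, neg_smul]
    rw [add_add_add_comm, add_neg_cancel, add_zero, ← two_smul ℂ, smul_smul]
    norm_num

theorem specMap_spinProj (i : Site d) :
    specMap (spinProj i) (fun e => ((if e then (1 : ℝ) else -1 : ℝ) : ℂ)) = spinOp 2 i := by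
  simp only [specMap, spinProj, Fintype.sum_bool]
  simp
  rw [← sub_eq_zero]
  module

theorem spinProj_mem (i : Site d) (e : Bool) : spinProj i e ∈ spinDiagonal {i} := by
  constructor
  · unfold spinProj
    refine IsSelfAdjoint.smul (by simp [IsSelfAdjoint]) ((IsSelfAdjoint.one _).add ?_)
    exact IsSelfAdjoint.smul (by cases e <;> simp [IsSelfAdjoint]) (isSelfAdjoint_spinOp 2 i)
  · intro a j h
    unfold spinProj
    refine Commute.smul_left ((Commute.one_left _).add_left (Commute.smul_left ?_ _)) _
    exact spinOp_two_commute i (by simpa using h)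

theorem commute_spinProj {s : Finset (Site d)} {A : HSpin d →L[ℂ] HSpin d}
    (hA : A ∈ spinDiagonal s) (i : Site d) (e : Bool) : Commute A (spinProj i e) :=
  (((Commute.one_right _).add_right ((hA.2 2 i (Or.inr rfl)).smul_right _)).smul_right _)

theorem spinOp_mul_spinProj {a : Fin 3} (ha : a ≠ 2) (i : Site d) (e : Bool) :
    spinProj i e * spinOp a i = spinOp a i * spinProj i (!e) := by
  have h := spinOp_anticomm ha i
  cases e <;> simp [spinProj, mul_add, add_mul, h]

/-- Sites are added one at a time, with the two projections of each `σ_3^i`. That the resulting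
projections commute with every spin outside `s` is used later to move a flipped spin at a site `i ∉
s` past them. -/
theorem hasRealSpectrum_sum_spinOp (s : Finset (Site d)) :
    HasRealSpectrum (spinDiagonal s) (∑ i ∈ s, spinOp 2 i) := by
  classical
  induction s using Finset.induction_on with
  | empty =>
    exact HasRealSpectrum.zero ⟨IsSelfAdjoint.one _, fun _ _ _ => Commute.one_left _⟩
  | insert i s hi ih =>
    rw [Finset.sum_insert hi, add_comm]
    have h2 : HasRealSpectrum (Set.range (spinProj i)) (spinOp 2 i) :=
      ⟨Bool, inferInstance, spinProj i, _, spinProj_COI i, fun e => ⟨e, rfl⟩, specMap_spinProj i⟩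
    refine ih.add h2 ?_ ?_
    · rintro a ha _ ⟨e, rfl⟩
      exact commute_spinProj ha i e
    · rintro a ha _ ⟨e, rfl⟩
      refine ⟨(IsSelfAdjoint.commute_iff ha.1 (spinProj_mem i e).1).mp (commute_spinProj ha i e),
        fun b j h => ?_⟩
      refine Commute.mul_left (ha.2 b j ?_) ((spinProj_mem i e).2 b j ?_)
      · exact h.imp_left fun h => fun h' => h (Finset.mem_insert_of_mem h')
      · exact h.imp_left fun h => fun h' => h (by simp_all)

theorem norm_spinOp_le (a : Fin 3) (i : Site d) : ‖spinOp a i‖ ≤ 1 :=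
  ContinuousLinearMap.opNorm_le_bound _ zero_le_one fun x => by simp [norm_spinOp_apply]

theorem norm_meanSpin_le (V : Finset (Site d)) : ‖meanSpin V‖ ≤ 1 := by
  unfold meanSpin
  rw [norm_smul, norm_inv, Complex.norm_natCast]
  have h : ‖∑ i ∈ V, spinOp 2 i‖ ≤ V.card := by
    refine (norm_sum_le_of_le V fun i _ => norm_spinOp_le 2 i).trans (by simp)
  rcases V.card.eq_zero_or_pos with h0 | h0
  · simp [h0]
  · rw [inv_mul_le_iff₀ (by exact_mod_cast h0), mul_one]
    exact h

end SpinSpectrum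

/-! ### Finite matrices on the levels of a mode, and the spectrum of the field. -/

section ModeMatrices

variable {n : ℕ}

/-- The coefficients of a vector of `𝓓`. -/
def co (φ : D n) (m : Fin n → ℕ) : ℂ := coeff (toFock φ) m

theorem D_ext {φ ψ : D n} (h : ∀ m, co φ m = co ψ m) : φ = ψ :=
  toFock_injective (coeff_injective (funext h))

theorem Lplus_ext {X Y : Lplus n} (h : ∀ φ m, co (X.1 φ) m = co (Y.1 φ) m) : X = Y :=
  Subtype.ext (LinearMap.ext fun φ => D_ext (h φ))

@[simp] theorem co_add (φ ψ : D n) (m : Fin n → ℕ) : co (φ + ψ) m = co φ m + co ψ m := by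
  simp [co]

@[simp] theorem co_sub (φ ψ : D n) (m : Fin n → ℕ) : co (φ - ψ) m = co φ m - co ψ m := by
  simp [co]

@[simp] theorem co_zero (m : Fin n → ℕ) : co (0 : D n) m = 0 := by
  simp [co]

@[simp] theorem co_smul (c : ℂ) (φ : D n) (m : Fin n → ℕ) : co (c • φ) m = c * co φ m := by
  simp [co]

@[simp] theorem co_sum {ι : Type*} (s : Finset ι) (f : ι → D n) (m : Fin n → ℕ) :
    co (∑ i ∈ s, f i) m = ∑ i ∈ s, co (f i) m := by
  simp [co]

@[simp] theorem Lplus_mul_apply (X Y : Lplus n) (φ : D n) : (X * Y).1 φ = X.1 (Y.1 φ) := rfl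

@[simp] theorem Lplus_add_apply (X Y : Lplus n) (φ : D n) : (X + Y).1 φ = X.1 φ + Y.1 φ := rfl

@[simp] theorem Lplus_sub_apply (X Y : Lplus n) (φ : D n) : (X - Y).1 φ = X.1 φ - Y.1 φ := rfl

@[simp] theorem Lplus_smul_apply (c : ℂ) (X : Lplus n) (φ : D n) : (c • X).1 φ = c • X.1 φ := rfl

@[simp] theorem Lplus_one_apply (φ : D n) : (1 : Lplus n).1 φ = φ := rfl

@[simp] theorem Lplus_sum_apply {ι : Type*} (s : Finset ι) (f : ι → Lplus n) (φ : D n) :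
    (∑ i ∈ s, f i).1 φ = ∑ i ∈ s, (f i).1 φ := by
  classical
  induction s using Finset.induction_on with
  | empty => simp
  | insert a s ha ih => simp [Finset.sum_insert ha]

@[simp] theorem co_ann (j : Fin n) (φ : D n) (m : Fin n → ℕ) :
    co ((ann j).1 φ) m = (Real.sqrt (m j + 1) : ℝ) * co φ (up j m) := rfl

@[simp] theorem co_cre (j : Fin n) (φ : D n) (m : Fin n → ℕ) :
    co ((cre j).1 φ) m = (Real.sqrt (m j) : ℝ) * co φ (down j m) := rfl

@[simp] theorem co_occFun {g : (Fin n → ℕ) → ℝ} (hg : PolyGrowth g) (φ : D n) (m : Fin n → ℕ) :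
    co ((occFun g hg).1 φ) m = (g m : ℂ) * co φ m := rfl

@[simp] theorem co_cutoff (j : Fin n) (L : ℕ) (φ : D n) (m : Fin n → ℕ) :
    co ((cutoff j L).1 φ) m = if m j ≤ L then co φ m else 0 := by
  change ((if m j ≤ L then (1 : ℝ) else 0 : ℝ) : ℂ) * co φ m = _
  split_ifs <;> simp

theorem weight_le_update (j : Fin n) (q : ℕ) (m : Fin n → ℕ) :
    weight m ≤ ((m j : ℝ) + 1) * weight (Function.update m j q) := by
  unfold weight
  rw [← Finset.mul_prod_erase _ _ (Finset.mem_univ j),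
    ← Finset.mul_prod_erase (a := j) _ (fun i => ((Function.update m j q i : ℕ) : ℝ) + 1)
      (Finset.mem_univ j)]
  have h : ∀ i ∈ Finset.univ.erase j,
      (((Function.update m j q) i : ℕ) : ℝ) + 1 = (m i : ℝ) + 1 := by
    intro i hi
    rw [Function.update_of_ne (Finset.ne_of_mem_erase hi)]
  rw [Finset.prod_congr rfl h, Function.update_self]
  refine mul_le_mul_of_nonneg_left ?_ (by positivity)
  exact le_mul_of_one_le_left (Finset.prod_nonneg fun i _ => by positivity) (by simp)

/-- Exchange the occupation numbers `p` and `q` of mode `j`. -/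
def levelSwap (j : Fin n) (p q : ℕ) : Equiv.Perm (Fin n → ℕ) :=
  Function.Involutive.toPerm (fun m => Function.update m j (Equiv.swap p q (m j))) fun m => by simp

theorem levelSwap_apply (j : Fin n) (p q : ℕ) (m : Fin n → ℕ) :
    levelSwap j p q m = Function.update m j (Equiv.swap p q (m j)) := rfl

/-- The matrix unit `|p⟩⟨q|` of mode `j` on coefficients. -/
def unitMap (j : Fin n) (p q : ℕ) : ((Fin n → ℕ) → ℂ) →ₗ[ℂ] ((Fin n → ℕ) → ℂ) :=
  LinearMap.pi fun m => (if m j = p then (1 : ℂ) else 0) • LinearMap.proj (Function.update m j q)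

theorem unitMap_apply (j : Fin n) (p q : ℕ) (φ : (Fin n → ℕ) → ℂ) (m : Fin n → ℕ) :
    unitMap j p q φ m = if m j = p then φ (Function.update m j q) else 0 := by
  change (if m j = p then (1 : ℂ) else 0) • φ (Function.update m j q) = _
  split_ifs <;> simp

/-- On the support `m_j = p`, replacing `p` by `q` costs at most a factor `p + 1` in the weight. The
replacement is injective only there, so it is extended to the bijection that exchanges the two
levels. -/
theorem rapidDecay_unit (j : Fin n) (p q : ℕ) (φ : (Fin n → ℕ) → ℂ) (hφ : RapidDecay φ) :
    RapidDecay (unitMap j p q φ) := by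
  intro k
  refine Summable.of_nonneg_of_le (fun m => sq_nonneg _) (fun m => ?_)
    (((levelSwap j p q).summable_iff.mpr (hφ k)).mul_left ((((p : ℝ) + 1) ^ k) ^ 2))
  rw [unitMap_apply, Function.comp_apply, levelSwap_apply]
  split_ifs with h
  · rw [h, Equiv.swap_apply_left, ← mul_pow, ← mul_assoc, ← mul_pow]
    have h1 := weight_le_update j q m
    have h2 := zero_le_one.trans (one_le_weight m)
    rw [h] at h1
    gcongr
  · rw [norm_zero, mul_zero, zero_pow two_ne_zero]
    exact mul_nonneg (sq_nonneg _) (sq_nonneg _)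

theorem inner_unit (j : Fin n) (p q : ℕ) (φ ψ : D n) :
    inner ℂ (mkOp (unitMap j q p) (rapidDecay_unit j q p) ψ) φ
      = inner ℂ ψ (mkOp (unitMap j p q) (rapidDecay_unit j p q) φ) := by
  rw [D_inner_eq_tsum, D_inner_eq_tsum, ← (levelSwap j p q).tsum_eq]
  refine tsum_congr fun m => ?_
  simp only [coeff_mkOp, unitMap_apply, levelSwap_apply, Function.update_self,
    Function.update_idem]
  have h1 : Equiv.swap p q (m j) = q ↔ m j = p := by
    rw [Equiv.swap_apply_eq_iff, Equiv.swap_apply_right]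
  simp only [h1]
  split_ifs with h
  · rw [h, Equiv.swap_apply_left, ← h, Function.update_eq_self]
  · simp

/-- The matrix unit `|p⟩⟨q|` of mode `j`. -/
def modeUnit (j : Fin n) (p q : ℕ) : Lplus n :=
  ⟨mkOp (unitMap j p q) (rapidDecay_unit j p q), mkOp (unitMap j q p) (rapidDecay_unit j q p),
    inner_unit j p q⟩

theorem co_modeUnit (j : Fin n) (p q : ℕ) (φ : D n) (m : Fin n → ℕ) :
    co ((modeUnit j p q).1 φ) m = if m j = p then co φ (Function.update m j q) else 0 :=
  unitMap_apply j p q _ m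

theorem modeUnit_mul (j : Fin n) (p q r s : ℕ) :
    modeUnit j p q * modeUnit j r s = if q = r then modeUnit j p s else 0 := by
  refine Lplus_ext fun φ m => ?_
  split_ifs with h <;> simp [co_modeUnit, h]

theorem modeUnit_commute {j k : Fin n} (h : j ≠ k) (p q r s : ℕ) :
    Commute (modeUnit j p q) (modeUnit k r s) := by
  refine Lplus_ext fun φ m => ?_
  simp only [Lplus_mul_apply, co_modeUnit, Function.update_of_ne h, Function.update_of_ne h.symm,
    Function.update_comm h]
  split_ifs <;> rfl

theorem sum_modeUnit_mul (j : Fin n) {L : ℕ} (A B : Matrix (Fin L) (Fin L) ℂ) :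
    ∑ p, ∑ q, (A * B) p q • modeUnit j p q =
      (∑ p, ∑ q, A p q • modeUnit j p q) * ∑ p, ∑ q, B p q • modeUnit j p q := by
  rw [Finset.sum_mul]
  refine Finset.sum_congr rfl fun p _ => ?_
  rw [Finset.sum_mul]
  have h : ∀ q, A p q • modeUnit j (p : ℕ) q * ∑ r, ∑ s, B r s • modeUnit j (r : ℕ) s =
      ∑ s, (A p q * B q s) • modeUnit j (p : ℕ) s := fun q => by
    simp only [Finset.mul_sum, smul_mul_smul_comm, modeUnit_mul, Fin.val_inj, smul_ite, smul_zero]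
    rw [Finset.sum_comm]
    simp
  simp only [h, Matrix.mul_apply, Finset.sum_smul]
  rw [Finset.sum_comm]

/-- The action of `(L+1) × (L+1)` matrices on the levels `0, …, L` of mode `j`. -/
def modeMatrix (j : Fin n) (L : ℕ) : Matrix (Fin (L + 1)) (Fin (L + 1)) ℂ →ₙₐ[ℂ] Lplus n where
  toFun A := ∑ p, ∑ q, A p q • modeUnit j p q
  map_smul' c A := by simp [Finset.smul_sum, mul_smul]
  map_zero' := by simp
  map_add' A B := by simp [add_smul, Finset.sum_add_distrib]
  map_mul' := sum_modeUnit_mul j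

theorem co_modeMatrix (j : Fin n) (L : ℕ) (A : Matrix (Fin (L + 1)) (Fin (L + 1)) ℂ) (φ : D n)
    (m : Fin n → ℕ) : co ((modeMatrix j L A).1 φ) m =
      if h : m j < L + 1 then ∑ q : Fin (L + 1), A ⟨m j, h⟩ q * co φ (Function.update m j q)
      else 0 := by
  change co ((∑ p : Fin (L + 1), ∑ q : Fin (L + 1), A p q • modeUnit j p q).1 φ) m = _
  simp only [Lplus_sum_apply, co_sum, Lplus_smul_apply, co_smul, co_modeUnit]
  split_ifs with h
  · rw [Finset.sum_eq_single ⟨m j, h⟩]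
    · simp
    · intro p _ hp
      have : m j ≠ p := fun h' => hp (Fin.ext h'.symm)
      simp [this]
    · simp
  · refine Finset.sum_eq_zero fun p _ => Finset.sum_eq_zero fun q _ => ?_
    have : m j ≠ p := fun h' => h (h' ▸ p.2)
    simp [this]

/-- The matrix of `a + a†` on the levels `0, …, L`. -/
def jacobi (L : ℕ) : Matrix (Fin (L + 1)) (Fin (L + 1)) ℂ :=
  Matrix.of fun p q => (if (q : ℕ) = p + 1 then ((Real.sqrt (p + 1) : ℝ) : ℂ) else 0) +
    if (p : ℕ) = q + 1 then ((Real.sqrt (q + 1) : ℝ) : ℂ) else 0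

theorem isHermitian_jacobi (L : ℕ) : (jacobi L).IsHermitian := by
  ext p q
  simp only [jacobi, Matrix.conjTranspose_apply, Matrix.of_apply, star_add]
  rw [add_comm]
  congr 1 <;> split_ifs <;> simp

theorem modeMatrix_jacobi (j : Fin n) (L : ℕ) :
    modeMatrix j L (jacobi L) = annCut j L + creCut j L := by
  refine Lplus_ext fun φ m => ?_
  rw [co_modeMatrix]
  simp only [jacobi, Matrix.of_apply, add_mul, Finset.sum_add_distrib, ite_mul, zero_mul, annCut,
    creCut, Lplus_add_apply, Lplus_mul_apply, co_add, co_cutoff, co_ann, co_cre]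
  by_cases h : m j < L + 1
  · have hm : m j ≤ L := by omega
    rw [dif_pos h]
    simp only [if_pos hm]
    congr 1
    · by_cases h1 : m j + 1 < L + 1
      · rw [Finset.sum_eq_single ⟨m j + 1, h1⟩]
        · have : up j m j ≤ L := by simp [up]; omega
          rw [if_pos this]
          simp [up]
        · intro q _ hq
          rw [if_neg fun h' => hq (Fin.ext h')]
        · simp
      · have : ¬ up j m j ≤ L := by simp [up]; omega
        rw [if_neg this, mul_zero]
        refine Finset.sum_eq_zero fun q _ => if_neg fun h' => h1 ?_
        rw [← h']
        exact q.2
    · have h2 : down j m j ≤ L := by simp [down]; omega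
      rw [if_pos h2]
      -- At `m_j = 0` truncated subtraction makes `down j m` equal to `m`, but the factor `√(m_j)`
      -- vanishes.
      by_cases h1 : m j = 0
      · simp [h1]
      · rw [Finset.sum_eq_single ⟨m j - 1, by omega⟩]
        · have h3 : m j = m j - 1 + 1 := by omega
          rw [if_pos h3]
          have h4 : ((m j - 1 : ℕ) : ℝ) + 1 = m j := by
            rw [h3]; simp
          simp only [h4, down]
        · intro q _ hq
          rw [if_neg fun h' => hq (Fin.ext (by simp only at h' ⊢; omega))]
        · simp
  · have hm : ¬ m j ≤ L := by omega
    rw [dif_neg h]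
    simp only [if_neg hm, add_zero]

theorem hasRealSpectrum_of_isHermitian {m : ℕ} {M : Matrix (Fin m) (Fin m) ℂ}
    (hM : M.IsHermitian) : HasRealSpectrum Set.univ M := by
  classical
  let U : Matrix (Fin m) (Fin m) ℂ := hM.eigenvectorUnitary
  have hU : star U * U = 1 := Unitary.coe_star_mul_self _
  have hU' : U * star U = 1 := Unitary.coe_mul_star_self _
  refine ⟨Fin m, inferInstance, fun i => U * Matrix.single i i 1 * star U, hM.eigenvalues, ?_,
    fun _ => trivial, ?_⟩
  · rw [CompleteOrthogonalIdempotents.iff_ortho_complete]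
    constructor
    · intro i j hij
      have : U * Matrix.single i i 1 * star U * (U * Matrix.single j j 1 * star U) =
          U * (Matrix.single i i 1 * (star U * U) * Matrix.single j j 1) * star U := by
        simp only [mul_assoc]
      simp only [this, hU, mul_one]
      rw [Matrix.single_mul_single_of_ne _ _ _ _ hij]
      simp
    · rw [← Finset.sum_mul, ← Finset.mul_sum]
      have : ∑ i : Fin m, Matrix.single i i (1 : ℂ) = 1 := by
        rw [Matrix.sum_single_eq_diagonal (fun _ => (1 : ℂ)), Matrix.diagonal_one]
      rw [this, mul_one, hU']
  · conv_rhs => rw [hM.spectral_theorem]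
    rw [Unitary.conjStarAlgAut_apply, ← Matrix.sum_single_eq_diagonal, Finset.mul_sum,
      Finset.sum_mul]
    refine Finset.sum_congr rfl fun i _ => ?_
    have h : Matrix.single i i (((RCLike.ofReal ∘ hM.eigenvalues) i : ℂ)) =
        (hM.eigenvalues i : ℂ) • Matrix.single i i (1 : ℂ) := by
      rw [Matrix.smul_single, smul_eq_mul, mul_one]; rfl
    rw [h, mul_smul_comm, smul_mul_assoc]

/-- The images of the projections add up to `f 1`, which need not be `1`. The family is completed by
`1 - f 1` with eigenvalue `0`; for `modeMatrix` this is the projection on the levels above `L`. -/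
theorem HasRealSpectrum.map_nonUnital {A B : Type*} [Ring A] [Algebra ℂ A] [Ring B] [Algebra ℂ B]
    (f : A →ₙₐ[ℂ] B) {x : A} (h : HasRealSpectrum Set.univ x) {C : Set B}
    (hC : ∀ a, f a ∈ C) (hC' : ∀ a, 1 - f a ∈ C) : HasRealSpectrum C (f x) := by
  obtain ⟨ι, _, E, l, hE, -, rfl⟩ := h
  have ho : OrthogonalIdempotents (fun i => f (E i)) :=
    ⟨fun i => by rw [IsIdempotentElem, ← map_mul, hE.idem i], fun i j hij => by
      change f (E i) * f (E j) = 0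
      rw [← map_mul, hE.ortho hij, map_zero]⟩
  refine ⟨Option ι, inferInstance, _, fun o => o.elim 0 l, .option ho, ?_, ?_⟩
  · rintro (_ | i)
    · simpa [← map_sum] using hC' _
    · exact hC _
  · simp only [specMap, Fintype.sum_option, map_sum, map_smul]
    simp

/-- The operators commuting with the matrix units of all modes outside `s`. -/
def modeDiagonal (s : Finset (Fin n)) : Set (Lplus n) :=
  {X | ∀ j, j ∉ s → ∀ p q, Commute X (modeUnit j p q)}

theorem commute_modeMatrix {X : Lplus n} {j : Fin n} (h : ∀ p q, Commute X (modeUnit j p q))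
    (L : ℕ) (A : Matrix (Fin (L + 1)) (Fin (L + 1)) ℂ) : Commute X (modeMatrix j L A) :=
  Commute.sum_right _ _ _ fun p _ => Commute.sum_right _ _ _ fun q _ => (h p q).smul_right _

/-- The field operator `∑_j γ_j (a_{j,L} + a_{j,L}†)`. -/
def field (γ : Fin n → ℝ) (L : ℕ) : Lplus n :=
  ∑ j, ((γ j : ℝ) : ℂ) • (annCut j L + creCut j L)

theorem hasRealSpectrum_field (γ : Fin n → ℝ) (L : ℕ) : HasRealSpectrum Set.univ (field γ L) := by
  classical
  have key : ∀ s : Finset (Fin n), HasRealSpectrum (modeDiagonal s)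
      (∑ j ∈ s, ((γ j : ℝ) : ℂ) • (annCut j L + creCut j L)) := by
    intro s
    induction s using Finset.induction_on with
    | empty => exact HasRealSpectrum.zero fun _ _ _ _ => Commute.one_left _
    | insert j s hj ih =>
      rw [Finset.sum_insert hj, add_comm, ← modeMatrix_jacobi]
      -- A relative bicommutant of mode `j`: its elements commute with everything built from the
      -- other modes, and in particular with the projections already obtained for `s`.
      let C : Set (Lplus n) := {Y | ∀ X : Lplus n, (∀ p q, Commute X (modeUnit j p q)) → Commute X Y}
      have h2 : HasRealSpectrum C (modeMatrix j L (jacobi L)) :=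
        (hasRealSpectrum_of_isHermitian (isHermitian_jacobi L)).map_nonUnital _
          (fun A X hX => commute_modeMatrix hX L A)
          (fun A X hX => (Commute.one_right X).sub_right (commute_modeMatrix hX L A))
      refine ih.add (h2.smul (γ j)) (fun X hX Y hY => hY X (hX j hj)) fun X hX Y hY k hk p q => ?_
      rw [Finset.mem_insert, not_or] at hk
      exact (hX k hk.2 p q).mul_left (hY _ fun p' q' => modeUnit_commute hk.1 _ _ _ _).symm
  exact (key Finset.univ).mono (Set.subset_univ _)

end ModeMatrices

/-! ### Estimates in powers of the weight, uniform in the cutoff. -/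

section WeightedEstimates

variable {n : ℕ}

theorem summable_norm_co_sq (φ : D n) : Summable fun m => ‖co φ m‖ ^ 2 := by
  simpa [co] using rapidDecay_toFock φ 0

theorem norm_sq_eq_tsum (φ : D n) : ‖φ‖ ^ 2 = ∑' m, ‖co φ m‖ ^ 2 := by
  have h := D_inner_eq_tsum φ φ
  rw [inner_self_eq_norm_sq_to_K] at h
  have h1 : ∀ m, inner ℂ (coeff (toFock φ) m) (coeff (toFock φ) m) = ((‖co φ m‖ ^ 2 : ℝ) : ℂ) :=
    fun m => by rw [inner_self_eq_norm_sq_to_K]; simp [co]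
  simp only [h1, ← Complex.ofReal_tsum] at h
  exact Complex.ofReal_injective (by simpa using h)

/-- Each operator estimated below acts on coefficients by a multiplier and a shift, or is a sum of
two such. Since the shift is injective on the support, a pointwise bound passes to the `ℓ²` norm. -/
theorem norm_le_of_co {x y : D n} {C : ℝ} (hC : 0 ≤ C) (g : (Fin n → ℕ) → Fin n → ℕ)
    (hg : Set.InjOn g {m | co x m ≠ 0}) (h : ∀ m, co x m ≠ 0 → ‖co x m‖ ≤ C * ‖co y (g m)‖) :
    ‖x‖ ≤ C * ‖y‖ := by
  refine (sq_le_sq₀ (norm_nonneg _) (by positivity)).mp ?_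
  rw [mul_pow, norm_sq_eq_tsum, norm_sq_eq_tsum, ← tsum_mul_left]
  have hs : Function.support (fun m => ‖co x m‖ ^ 2) = {m | co x m ≠ 0} := by
    ext m; simp
  rw [← tsum_subtype_eq_of_support_subset hs.subset]
  refine Summable.tsum_le_tsum_of_inj (fun m : {m | co x m ≠ 0} => g m)
    (fun a b hab => Subtype.ext (hg a.2 b.2 hab)) (fun _ _ => by positivity) (fun m => ?_)
    ((summable_norm_co_sq x).subtype _) ((summable_norm_co_sq y).mul_left _)
  rw [← mul_pow]
  exact pow_le_pow_left₀ (norm_nonneg _) (h m m.2) 2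

theorem weight_pos (m : Fin n → ℕ) : 0 < weight m := zero_lt_one.trans_le (one_le_weight m)

theorem polyGrowth_zpow (K : ℤ) : PolyGrowth fun m : Fin n → ℕ => weight m ^ K :=
  ⟨1, K.natAbs, fun m => by
    rw [abs_of_nonneg (zpow_nonneg (weight_pos m).le _), one_mul, ← zpow_natCast]
    exact zpow_le_zpow_right₀ (one_le_weight m) Int.le_natAbs⟩

/-- The operator `(M_1 ⋯ M_n)^K`. -/
def wpow (K : ℤ) : Lplus n := occFun (fun m => weight m ^ K) (polyGrowth_zpow K)

@[simp] theorem co_wpow (K : ℤ) (φ : D n) (m : Fin n → ℕ) :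
    co ((wpow K).1 φ) m = ((weight m ^ K : ℝ) : ℂ) * co φ m := rfl

theorem wpow_wpow (K K' : ℤ) (φ : D n) : (wpow K).1 ((wpow K').1 φ) = (wpow (K + K')).1 φ :=
  D_ext fun m => by
    rw [co_wpow, co_wpow, co_wpow, zpow_add₀ (weight_pos m).ne', Complex.ofReal_mul, mul_assoc]

theorem wpow_zero (φ : D n) : (wpow 0).1 φ = φ := D_ext fun m => by simp

theorem inner_occFun {g : (Fin n → ℕ) → ℝ} (hg : PolyGrowth g) (φ ψ : D n) :
    inner ℂ ((occFun g hg).1 φ) ψ = inner ℂ φ ((occFun g hg).1 ψ) :=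
  inner_occ hg ψ φ

theorem inner_wpow (K : ℤ) (φ ψ : D n) :
    inner ℂ ((wpow K).1 φ) ψ = inner ℂ φ ((wpow K).1 ψ) :=
  inner_occFun _ φ ψ

theorem inner_cutoff (j : Fin n) (L : ℕ) (φ ψ : D n) :
    inner ℂ ((cutoff j L).1 φ) ψ = inner ℂ φ ((cutoff j L).1 ψ) :=
  inner_occFun _ φ ψ

theorem zpow_le_of_comparable {a b c : ℝ} (ha : 0 < a) (hb : 0 < b) (hab : a ≤ c * b)
    (hba : b ≤ c * a) (K : ℤ) : a ^ K ≤ c ^ K.natAbs * b ^ K := by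
  rcases K.natAbs_eq with h | h
  · rw [h]
    simp only [Int.natAbs_natCast, zpow_natCast]
    rw [← mul_pow]
    exact pow_le_pow_left₀ ha.le hab _
  · rw [h]
    simp only [Int.natAbs_neg, Int.natAbs_natCast, zpow_neg, zpow_natCast]
    rw [inv_le_iff_one_le_mul₀ (by positivity), mul_assoc, inv_mul_eq_div, ← mul_div_assoc,
      one_le_div (by positivity), ← mul_pow]
    exact pow_le_pow_left₀ hb.le hba _

theorem weight_up_comparable (j : Fin n) (m : Fin n → ℕ) (K : ℤ) :
    weight m ^ K ≤ 2 ^ K.natAbs * weight (up j m) ^ K :=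
  zpow_le_of_comparable (weight_pos _) (weight_pos _)
    ((weight_le_up j m).trans (by nlinarith [weight_pos (up j m)])) (weight_up_le j m) K

theorem weight_up_comparable' (j : Fin n) (m : Fin n → ℕ) (K : ℤ) :
    weight (up j m) ^ K ≤ 2 ^ K.natAbs * weight m ^ K :=
  zpow_le_of_comparable (weight_pos _) (weight_pos _) (weight_up_le j m)
    ((weight_le_up j m).trans (by nlinarith [weight_pos (up j m)])) K

theorem sqrt_le_weight (j : Fin n) (m : Fin n → ℕ) : Real.sqrt ((m j : ℝ) + 1) ≤ weight m :=
  (Real.sqrt_le_iff.mpr ⟨by positivity, by nlinarith [(m j).cast_nonneg (α := ℝ)]⟩ :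
    _ ≤ (m j : ℝ) + 1).trans (le_weight j m)

theorem co_annCut (j : Fin n) (L : ℕ) (φ : D n) (m : Fin n → ℕ) :
    co ((annCut j L).1 φ) m =
      if m j + 1 ≤ L then (Real.sqrt (m j + 1) : ℝ) * co φ (up j m) else 0 := by
  have h : up j m j = m j + 1 := by simp [up]
  simp only [annCut, Lplus_mul_apply, co_cutoff, co_ann, h]
  split_ifs <;> first | rfl | omega | simp

theorem co_creCut (j : Fin n) (L : ℕ) (φ : D n) (m : Fin n → ℕ) :
    co ((creCut j L).1 φ) m =
      if m j ≤ L then (Real.sqrt (m j) : ℝ) * co φ (down j m) else 0 := by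
  have h : down j m j = m j - 1 := by simp [down]
  simp only [creCut, Lplus_mul_apply, co_cutoff, co_cre, h]
  split_ifs <;> first | rfl | omega

theorem down_injOn (j : Fin n) : Set.InjOn (down j) {m : Fin n → ℕ | m j ≠ 0} := by
  intro a ha b hb hab
  rw [← up_down j a ha, ← up_down j b hb, hab]

theorem inner_creCut (j : Fin n) (L : ℕ) (φ ψ : D n) :
    inner ℂ ((creCut j L).1 ψ) φ = inner ℂ ψ ((annCut j L).1 φ) := by
  simp only [creCut, annCut, Lplus_mul_apply]
  rw [inner_cutoff, ← inner_cutoff j L ψ]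
  exact inner_cre_ann j _ _

/-- The factor `√(m_j + 1)` is paid by one power of the weight, and shifting the argument of `w^K`
by one level costs `2^{|K|}`. The cutoff only sets coefficients to zero, so the bound is uniform in
`L`. -/
theorem norm_wpow_annCut_le (j : Fin n) (L : ℕ) (K : ℤ) (φ : D n) :
    ‖(wpow K).1 ((annCut j L).1 φ)‖ ≤ 2 ^ K.natAbs * ‖(wpow (K + 1)).1 φ‖ := by
  refine norm_le_of_co (by positivity) (up j) (up_injective j).injOn fun m _ => ?_
  rw [co_wpow, co_annCut, co_wpow]
  split_ifs
  · simp only [norm_mul, Complex.norm_real, Real.norm_eq_abs, abs_of_nonneg (Real.sqrt_nonneg _),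
      abs_of_pos (zpow_pos (weight_pos _) _)]
    rw [← mul_assoc, ← mul_assoc, zpow_add_one₀ (weight_pos _).ne', ← mul_assoc]
    have h1 := (sqrt_le_weight j m).trans (weight_le_up j m)
    have h2 := zpow_pos (weight_pos (up j m)) K
    gcongr
    exact weight_up_comparable j m K
  · simp only [mul_zero, norm_zero]
    positivity

theorem co_creCut_up (j : Fin n) (L : ℕ) (φ : D n) (m : Fin n → ℕ) :
    co ((creCut j L).1 φ) (up j m) =
      if m j + 1 ≤ L then (Real.sqrt (m j + 1) : ℝ) * co φ m else 0 := by
  rw [co_creCut, down_up]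
  simp [up]

theorem co_creCut_of_eq_zero (j : Fin n) (L : ℕ) (φ : D n) {m : Fin n → ℕ} (h : m j = 0) :
    co ((creCut j L).1 φ) m = 0 := by
  simp [co_creCut, h]

theorem norm_wpow_creCut_le (j : Fin n) (L : ℕ) (K : ℤ) (φ : D n) :
    ‖(wpow K).1 ((creCut j L).1 φ)‖ ≤ 2 ^ K.natAbs * ‖(wpow (K + 1)).1 φ‖ := by
  have h0 : ∀ m, co ((wpow K).1 ((creCut j L).1 φ)) m ≠ 0 → m j ≠ 0 := fun m hm h =>
    hm (by rw [co_wpow, co_creCut_of_eq_zero j L φ h, mul_zero])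
  refine norm_le_of_co (by positivity) (down j) ((down_injOn j).mono h0) fun m hm => ?_
  obtain ⟨m, rfl⟩ : ∃ m', m = up j m' := ⟨_, (up_down j m (h0 m hm)).symm⟩
  rw [co_wpow, co_creCut_up, co_wpow, down_up]
  split_ifs
  · simp only [norm_mul, Complex.norm_real, Real.norm_eq_abs, abs_of_nonneg (Real.sqrt_nonneg _),
      abs_of_pos (zpow_pos (weight_pos _) _)]
    rw [← mul_assoc, ← mul_assoc, zpow_add_one₀ (weight_pos _).ne', ← mul_assoc]
    have h1 := sqrt_le_weight j m
    have h2 := zpow_pos (weight_pos m) K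
    gcongr
    exact weight_up_comparable' j m K
  · simp only [mul_zero, norm_zero]
    positivity

theorem one_add_pow_le {x : ℝ} (h0 : 0 ≤ x) (h1 : x ≤ 1) (N : ℕ) :
    (1 + x) ^ N ≤ 1 + 4 ^ N * x := by
  induction N with
  | zero => simpa using h0
  | succ N ih =>
    have h4 : (1 : ℝ) ≤ 4 ^ N := one_le_pow₀ (by norm_num)
    rw [pow_succ, pow_succ]
    nlinarith [mul_nonneg (sub_nonneg.mpr h4) h0, mul_nonneg (zero_le_one.trans h4) h0,
      mul_nonneg (mul_nonneg (zero_le_one.trans h4) h0) (sub_nonneg.mpr h1)]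

theorem abs_zpow_sub_zpow_neg_le {x : ℝ} (h0 : 0 ≤ x) (h1 : x ≤ 1) (K : ℤ) :
    |(1 + x) ^ K - (1 + x) ^ (-K)| ≤ 16 ^ K.natAbs * x := by
  have key : ∀ N : ℕ, |(1 + x) ^ N - ((1 + x) ^ N)⁻¹| ≤ 16 ^ N * x := fun N => by
    have h2 : 1 ≤ (1 + x) ^ N := one_le_pow₀ (by linarith)
    have h3 : ((1 + x) ^ N)⁻¹ ≤ 1 := inv_le_one_of_one_le₀ h2
    have h4 : 0 < ((1 + x) ^ N)⁻¹ := by positivity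
    -- For `a = (1 + x)^N ≥ 1` one has `a - a⁻¹ ≤ a² - 1`, and `a² = (1 + x)^{2N} ≤ 1 + 16^N x`.
    have h5 := one_add_pow_le h0 h1 (2 * N)
    rw [pow_mul, pow_mul, show (4 : ℝ) ^ 2 = 16 by norm_num, ← pow_mul, mul_comm 2 N, pow_mul] at h5
    rw [abs_of_nonneg (by linarith)]
    have h6 : (1 + x) ^ N * ((1 + x) ^ N)⁻¹ = 1 := mul_inv_cancel₀ (by positivity)
    nlinarith
  obtain ⟨N, rfl | rfl⟩ := K.eq_nat_or_neg
  · simpa using key N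
  · rw [abs_sub_comm]
    simpa using key N

/-- The commutator `w^K a† w^{-K} - w^{-K} a† w^K` of the weight with a creation operator. -/
def twist (j : Fin n) (L : ℕ) (K : ℤ) : Lplus n :=
  wpow K * creCut j L * wpow (-K) - wpow (-K) * creCut j L * wpow K

/-- Adding a boson multiplies the weight by `1 + x` with `x = 1/(m_j + 1)`. The twist therefore has
matrix elements `√(m_j + 1) ((1 + x)^K - (1 + x)^{-K})`, and the difference, of order `x`,
compensates the square root. No power of the weight is lost. -/
theorem norm_twist_le (j : Fin n) (L : ℕ) (K : ℤ) (φ : D n) :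
    ‖(twist j L K).1 φ‖ ≤ 16 ^ K.natAbs * ‖φ‖ := by
  have h0 : ∀ m, co ((twist j L K).1 φ) m ≠ 0 → m j ≠ 0 := fun m hm h =>
    hm (by simp [twist, co_creCut_of_eq_zero j L _ h])
  refine norm_le_of_co (by positivity) (down j) ((down_injOn j).mono h0) fun m hm => ?_
  obtain ⟨m, rfl⟩ : ∃ m', m = up j m' := ⟨_, (up_down j m (h0 m hm)).symm⟩
  rw [down_up]
  simp only [twist, Lplus_sub_apply, Lplus_mul_apply, co_sub, co_wpow, co_creCut_up]
  split_ifs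
  · have hx : (0 : ℝ) < (m j : ℝ) + 1 := by positivity
    have hw : weight (up j m) = weight m * (1 + ((m j : ℝ) + 1)⁻¹) := by
      have := weight_up j m
      field_simp
      linarith
    have hw0 := weight_pos m
    have hK : ∀ K : ℤ, weight (up j m) ^ K * weight m ^ (-K) = (1 + ((m j : ℝ) + 1)⁻¹) ^ K :=
      fun K => by
        rw [hw, mul_zpow, zpow_neg]
        have := zpow_pos hw0 K
        field_simp
    have e : ((weight (up j m) ^ K : ℝ) : ℂ) * (((Real.sqrt ((m j : ℝ) + 1) : ℝ) : ℂ) *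
        (((weight m ^ (-K) : ℝ) : ℂ) * co φ m)) - ((weight (up j m) ^ (-K) : ℝ) : ℂ) *
        (((Real.sqrt ((m j : ℝ) + 1) : ℝ) : ℂ) * (((weight m ^ K : ℝ) : ℂ) * co φ m)) =
        ((Real.sqrt ((m j : ℝ) + 1) * ((1 + ((m j : ℝ) + 1)⁻¹) ^ K -
          (1 + ((m j : ℝ) + 1)⁻¹) ^ (-K)) : ℝ) : ℂ) * co φ m := by
      rw [← hK K, ← hK (-K), neg_neg]
      push_cast
      ring
    rw [e, norm_mul, Complex.norm_real, Real.norm_eq_abs, abs_mul,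
      abs_of_nonneg (Real.sqrt_nonneg _)]
    refine mul_le_mul_of_nonneg_right ?_ (norm_nonneg _)
    have h1 := abs_zpow_sub_zpow_neg_le (x := ((m j : ℝ) + 1)⁻¹) (by positivity)
      (inv_le_one_of_one_le₀ (by simp)) K
    have h2 : Real.sqrt ((m j : ℝ) + 1) ≤ (m j : ℝ) + 1 :=
      Real.sqrt_le_iff.mpr ⟨by positivity, by nlinarith [(m j).cast_nonneg (α := ℝ)]⟩
    calc _ ≤ ((m j : ℝ) + 1) * (16 ^ K.natAbs * ((m j : ℝ) + 1)⁻¹) :=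
          mul_le_mul h2 h1 (abs_nonneg _) hx.le
      _ = 16 ^ K.natAbs := by field_simp
  · simp only [mul_zero, sub_zero, norm_zero]
    positivity

/-- Put `y = w^K φ`. Moving `a` to the other side as `a†` turns its contribution into the conjugate
of `⟨y, w^{-K} a† w^K y⟩`, so the imaginary part of the whole is that of `⟨y, twist y⟩`, a bounded
form. -/
theorem im_inner_wpow_le (j : Fin n) (L : ℕ) (K : ℤ) (φ : D n) :
    |(inner ℂ ((wpow K).1 φ) ((wpow K).1 ((annCut j L + creCut j L).1 φ)) : ℂ).im| ≤
      16 ^ K.natAbs * ‖(wpow K).1 φ‖ ^ 2 := by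
  set y := (wpow K).1 φ with hy
  have hφ : φ = (wpow (-K)).1 y := by rw [hy, wpow_wpow, neg_add_cancel, wpow_zero]
  have h1 : inner ℂ y ((wpow K).1 ((annCut j L).1 φ)) =
      (starRingEnd ℂ) (inner ℂ y ((wpow (-K)).1 ((creCut j L).1 ((wpow K).1 y)))) := by
    rw [inner_conj_symm, inner_wpow (-K), ← hφ, inner_creCut, inner_wpow K y]
  have h2 : (inner ℂ y ((wpow K).1 ((annCut j L + creCut j L).1 φ)) : ℂ).im =
      (inner ℂ y ((twist j L K).1 y) : ℂ).im := by
    rw [Lplus_add_apply, map_add, inner_add_right, h1, Complex.add_im, Complex.conj_im, twist,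
      Lplus_sub_apply, inner_sub_right, Complex.sub_im]
    simp only [Lplus_mul_apply, ← hφ]
    ring
  rw [h2]
  calc _ ≤ ‖(inner ℂ y ((twist j L K).1 y) : ℂ)‖ := Complex.abs_im_le_norm _
    _ ≤ ‖y‖ * ‖(twist j L K).1 y‖ := norm_inner_le_norm _ _
    _ ≤ ‖y‖ * (16 ^ K.natAbs * ‖y‖) := by gcongr; exact norm_twist_le j L K y
    _ = _ := by ring

theorem im_inner_wpow_field_le (γ : Fin n → ℝ) (L : ℕ) (K : ℤ) (φ : D n) :
    |(inner ℂ ((wpow K).1 φ) ((wpow K).1 ((field γ L).1 φ)) : ℂ).im| ≤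
      (∑ j, |γ j|) * 16 ^ K.natAbs * ‖(wpow K).1 φ‖ ^ 2 := by
  have h : inner ℂ ((wpow K).1 φ) ((wpow K).1 ((field γ L).1 φ)) =
      ∑ j, (γ j : ℂ) * inner ℂ ((wpow K).1 φ) ((wpow K).1 ((annCut j L + creCut j L).1 φ)) := by
    simp only [field, Lplus_sum_apply, Lplus_smul_apply, map_sum, map_smul, inner_sum,
      inner_smul_right]
  rw [h, Complex.im_sum, mul_assoc, Finset.sum_mul]
  refine (Finset.abs_sum_le_sum_abs _ _).trans (Finset.sum_le_sum fun j _ => ?_)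
  rw [Complex.im_ofReal_mul, abs_mul]
  exact mul_le_mul_of_nonneg_left (im_inner_wpow_le j L K φ) (abs_nonneg _)

theorem norm_wpow_field_le (γ : Fin n → ℝ) (L : ℕ) (K : ℤ) (φ : D n) :
    ‖(wpow K).1 ((field γ L).1 φ)‖ ≤
      (∑ j, |γ j|) * (2 * 2 ^ K.natAbs) * ‖(wpow (K + 1)).1 φ‖ := by
  simp only [field, Lplus_sum_apply, Lplus_smul_apply, map_sum, map_smul, Lplus_add_apply, map_add]
  rw [mul_assoc, Finset.sum_mul]
  refine norm_sum_le_of_le _ fun j _ => ?_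
  rw [norm_smul, Complex.norm_real, Real.norm_eq_abs]
  refine mul_le_mul_of_nonneg_left ?_ (abs_nonneg _)
  linarith [norm_add_le ((wpow K).1 ((annCut j L).1 φ)) ((wpow K).1 ((creCut j L).1 φ)),
    norm_wpow_annCut_le j L K φ, norm_wpow_creCut_le j L K φ]

/-- The deviation `[a_L + a_L†, a] + 1` of the regularized commutator from the canonical one. -/
def defect (j : Fin n) (L : ℕ) : Lplus n :=
  (annCut j L + creCut j L) * ann j - ann j * (annCut j L + creCut j L) + 1

/-- Below level `L` the diagonal part of the commutator is canonical. What remains is the diagonal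
at levels `≥ L` and, from the failure of `a_L` to commute with `a`, a single matrix element from
level `L + 1` to level `L - 1`. -/
theorem co_defect (j : Fin n) (L : ℕ) (φ : D n) (m : Fin n → ℕ) :
    co ((defect j L).1 φ) m =
      ((if m j < L then 0 else if m j = L then (m j : ℝ) + 1 else 1 : ℝ) : ℂ) * co φ m +
      if m j + 1 = L then ((Real.sqrt (m j + 1) * Real.sqrt (m j + 2) : ℝ) : ℂ) *
        co φ (up j (up j m)) else 0 := by
  have hu : up j m j = m j + 1 := by simp [up]
  have hs : ((Real.sqrt ((m j : ℝ) + 1) : ℝ) : ℂ) * ((Real.sqrt ((m j : ℝ) + 1) : ℝ) : ℂ) =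
      (m j : ℂ) + 1 := by
    rw [← Complex.ofReal_mul, Real.mul_self_sqrt (by positivity)]; simp
  have h2 : (m j : ℝ) + 1 + 1 = (m j : ℝ) + 2 := by ring
  simp only [defect, Lplus_add_apply, Lplus_sub_apply, Lplus_mul_apply, Lplus_one_apply, co_add,
    co_sub, co_annCut, co_ann, co_creCut_up, map_add, hu, Nat.cast_add, Nat.cast_one, h2]
  have h3 : (if m j ≤ L then ((Real.sqrt (m j) : ℝ) : ℂ) * co ((ann j).1 φ) (down j m) else 0) =
      if m j ≤ L then (m j : ℂ) * co φ m else 0 := by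
    by_cases h0 : m j = 0
    · simp [h0]
    · have h4 : ((down j m j : ℕ) : ℝ) + 1 = m j := by
        have : down j m j + 1 = m j := by simp [down]; omega
        exact_mod_cast this
      rw [co_ann, up_down j m h0, h4, ← mul_assoc, ← Complex.ofReal_mul,
        Real.mul_self_sqrt (by positivity)]
      simp
  rw [co_creCut]
  simp only [co_ann] at h3 ⊢
  rw [h3]
  split_ifs <;> first | omega | (push_cast; linear_combination (co φ m) * hs) |
    (push_cast; linear_combination (-co φ m) * hs) | (push_cast; ring)

theorem polyGrowth_defect (j : Fin n) (L : ℕ) : PolyGrowth fun m : Fin n → ℕ =>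
    (if m j < L then 0 else if m j = L then (m j : ℝ) + 1 else 1 : ℝ) :=
  ⟨1, 1, fun m => by
    have h1 := one_le_weight m
    have h2 := le_weight j m
    dsimp only
    split_ifs
    · simp; linarith
    · rw [abs_of_nonneg (by positivity)]; linarith
    · simpa using h1⟩

/-- The defect reads only coefficients whose weight is at least `L + 1`, and its entries are at most
`L + 1`. One power of the weight pays for the entry, another for the gain `1/(L + 1)`, and the third
is slack. The constants `1` and `4^{|K|}` belong to the diagonal and to the shift by two levels. -/
theorem norm_wpow_defect_le (j : Fin n) (L : ℕ) (K : ℤ) (φ : D n) :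
    ‖(wpow K).1 ((defect j L).1 φ)‖ ≤
      (1 + 4 ^ K.natAbs) / (L + 1) * ‖(wpow (K + 3)).1 φ‖ := by
  have hL : (0 : ℝ) < (L : ℝ) + 1 := by positivity
  let x := (wpow K).1 ((occFun _ (polyGrowth_defect j L)).1 φ)
  have h1 : ‖x‖ ≤ 1 / (L + 1) * ‖(wpow (K + 3)).1 φ‖ := by
    refine norm_le_of_co (by positivity) id Function.injective_id.injOn fun m _ => ?_
    simp only [x, co_wpow, co_occFun, norm_mul, Complex.norm_real, Real.norm_eq_abs, id,
      abs_of_pos (zpow_pos (weight_pos m) _), zpow_add₀ (weight_pos m).ne']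
    have hw := weight_pos m
    have hw1 := one_le_weight m
    have hz := zpow_pos hw K
    have hj := le_weight j m
    have hr : |(if m j < L then 0 else if m j = L then (m j : ℝ) + 1 else 1 : ℝ)| ≤
        1 / (L + 1) * weight m ^ (3 : ℤ) := by
      rw [div_mul_eq_mul_div, one_mul, le_div_iff₀ hL]
      have h3 : weight m ^ (3 : ℤ) = weight m * weight m * weight m := by
        rw [show (3 : ℤ) = ((3 : ℕ) : ℤ) from rfl, zpow_natCast]; ring
      rw [h3]
      split_ifs with ha hb
      · simp; positivity
      · rw [abs_of_nonneg (by positivity), ← hb]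
        nlinarith [mul_le_mul hj hj (by positivity) hw.le, mul_pos hw hw]
      · have : (L : ℝ) + 1 ≤ m j := by exact_mod_cast (by omega : L + 1 ≤ m j)
        rw [abs_one, one_mul]
        nlinarith [mul_pos hw hw]
    calc _ ≤ weight m ^ K * (1 / (L + 1) * weight m ^ (3 : ℤ) * ‖co φ m‖) := by gcongr
      _ = _ := by ring
  have h2 : ‖(wpow K).1 ((defect j L).1 φ) - x‖ ≤
      4 ^ K.natAbs / (L + 1) * ‖(wpow (K + 3)).1 φ‖ := by
    refine norm_le_of_co (by positivity) (fun m => up j (up j m))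
      ((up_injective j).comp (up_injective j)).injOn fun m _ => ?_
    have e : co ((wpow K).1 ((defect j L).1 φ) - x) m = ((weight m ^ K : ℝ) : ℂ) *
        if m j + 1 = L then ((Real.sqrt (m j + 1) * Real.sqrt (m j + 2) : ℝ) : ℂ) *
        co φ (up j (up j m)) else 0 := by
      simp only [x, co_sub, co_wpow, co_defect, co_occFun]
      ring
    rw [e, co_wpow]
    split_ifs with h
    · have hw := weight_pos (up j (up j m))
      have hw1 := one_le_weight (up j (up j m))
      have hu : up j (up j m) j = m j + 2 := by simp [up]
      have hj := le_weight j (up j (up j m))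
      rw [hu] at hj
      push_cast at hj
      have hLm : (L : ℝ) = m j + 1 := by exact_mod_cast h.symm
      have hz := zpow_pos hw K
      simp only [norm_mul, Complex.norm_real, Real.norm_eq_abs,
        abs_of_pos (zpow_pos (weight_pos _) _), abs_of_nonneg (Real.sqrt_nonneg _),
        zpow_add₀ hw.ne']
      have hs : Real.sqrt ((m j : ℝ) + 1) * Real.sqrt ((m j : ℝ) + 2) ≤
          1 / (L + 1) * weight (up j (up j m)) ^ (3 : ℤ) := by
        have h3 : weight (up j (up j m)) ^ (3 : ℤ) =
            weight (up j (up j m)) * weight (up j (up j m)) * weight (up j (up j m)) := by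
          rw [show (3 : ℤ) = ((3 : ℕ) : ℤ) from rfl, zpow_natCast]; ring
        have h4 : Real.sqrt ((m j : ℝ) + 1) * Real.sqrt ((m j : ℝ) + 2) ≤ L + 1 := by
          rw [← Real.sqrt_mul (by positivity), hLm]
          exact Real.sqrt_le_iff.mpr ⟨by positivity, by nlinarith [(m j).cast_nonneg (α := ℝ)]⟩
        rw [div_mul_eq_mul_div, one_mul, le_div_iff₀ hL, h3]
        have h5 : (L : ℝ) + 1 ≤ weight (up j (up j m)) := by linarith
        calc _ ≤ ((L : ℝ) + 1) * (L + 1) := by gcongr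
          _ ≤ weight (up j (up j m)) * weight (up j (up j m)) := by gcongr
          _ ≤ _ := le_mul_of_one_le_right (by positivity) hw1
      have hK : weight m ^ K ≤ 4 ^ K.natAbs * weight (up j (up j m)) ^ K := by
        refine zpow_le_of_comparable (weight_pos _) hw ?_ ?_ K
        · linarith [weight_le_up j m, weight_le_up j (up j m)]
        · linarith [weight_up_le j m, weight_up_le j (up j m)]
      calc _ ≤ (4 ^ K.natAbs * weight (up j (up j m)) ^ K) *
            ((1 / (L + 1) * weight (up j (up j m)) ^ (3 : ℤ)) * ‖co φ (up j (up j m))‖) := by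
            gcongr
        _ = _ := by ring
    · simp only [mul_zero, norm_zero]
      positivity
  calc _ = ‖x + ((wpow K).1 ((defect j L).1 φ) - x)‖ := by rw [add_sub_cancel]
    _ ≤ _ := norm_add_le _ _
    _ ≤ _ := add_le_add h1 h2
    _ = _ := by ring

theorem annCut_commute_ann {j k : Fin n} (h : k ≠ j) (L : ℕ) : Commute (annCut k L) (ann j) := by
  refine Lplus_ext fun φ m => ?_
  have h1 : up j m k = m k := by simp [up, h]
  have h2 : up k m j = m j := by simp [up, h.symm]
  have h3 : up j (up k m) = up k (up j m) := by
    simp [up, h, h.symm, Function.update_comm h]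
  simp only [Lplus_mul_apply, co_annCut, co_ann, h1, h2, h3]
  split_ifs <;> ring

theorem creCut_commute_ann {j k : Fin n} (h : k ≠ j) (L : ℕ) : Commute (creCut k L) (ann j) := by
  refine Lplus_ext fun φ m => ?_
  have h1 : up j m k = m k := by simp [up, h]
  have h2 : down k m j = m j := by simp [down, h.symm]
  have h3 : up j (down k m) = down k (up j m) := by
    simp [up, down, h, h.symm, Function.update_comm h]
  simp only [Lplus_mul_apply, co_creCut, co_ann, h1, h2, h3]
  split_ifs <;> ring

theorem field_mul_ann (γ : Fin n → ℝ) (L : ℕ) (j : Fin n) :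
    field γ L * ann j - ann j * field γ L = (γ j : ℂ) • (defect j L - 1) := by
  classical
  simp only [field, Finset.sum_mul, Finset.mul_sum, ← Finset.sum_sub_distrib, smul_mul_assoc,
    mul_smul_comm, ← smul_sub]
  rw [Finset.sum_eq_single j]
  · rw [defect, add_sub_cancel_right]
  · intro k _ hk
    rw [((annCut_commute_ann hk L).add_left (creCut_commute_ann hk L)).eq, sub_self, smul_zero]
  · exact fun h => absurd (Finset.mem_univ j) h

end WeightedEstimates

/-! ### The unitary group of the field and its action on `a_j`. -/

section WeylOperators

variable {n : ℕ} {γ : Fin n → ℝ} {L : ℕ} {ι : Type*} [Fintype ι] {E : ι → Lplus n} {l : ι → ℝ}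

/-- The unitary group `e^{i s B}` of `B = ∑ l_i E_i`. -/
def weyl (E : ι → Lplus n) (l : ι → ℝ) (s : ℝ) : Lplus n :=
  specMap E fun i => Complex.exp (Complex.I * s * l i)

theorem mul_weyl (hE : CompleteOrthogonalIdempotents E)
    (hB : specMap E (fun i => (l i : ℂ)) = field γ L) (s : ℝ) :
    field γ L * weyl E l s = specMap E fun i => l i * Complex.exp (Complex.I * s * l i) := by
  rw [← hB, weyl, specMap_mul hE]

theorem weyl_mul (hE : CompleteOrthogonalIdempotents E)
    (hB : specMap E (fun i => (l i : ℂ)) = field γ L) (s : ℝ) :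
    weyl E l s * field γ L = field γ L * weyl E l s := by
  rw [← hB, weyl, specMap_mul hE, specMap_mul hE]
  simp only [mul_comm]

theorem weyl_mul_weyl_neg (hE : CompleteOrthogonalIdempotents E) (s : ℝ) :
    weyl E l s * weyl E l (-s) = 1 := by
  rw [weyl, weyl, specMap_mul hE, ← specMap_one hE]
  congr 1
  funext i
  rw [← Complex.exp_add]
  simp

theorem weyl_zero (hE : CompleteOrthogonalIdempotents E) : weyl E l 0 = 1 := by
  rw [weyl, ← specMap_one hE]
  simp

variable {V : Type*} [NormedAddCommGroup V] [NormedSpace ℂ V]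

/-- The path from `1` to `e^{isB}` is parametrized by `r ∈ [0, 1]`, so that the mean value and
Gronwall estimates treat both signs of `s` at once. -/
theorem hasDerivAt_weyl (hE : CompleteOrthogonalIdempotents E)
    (hB : specMap E (fun i => (l i : ℂ)) = field γ L) (T : Lplus n →ₗ[ℂ] V) (s r : ℝ) :
    HasDerivAt (fun r : ℝ => T (weyl E l (r * s)))
      ((Complex.I * s) • T (field γ L * weyl E l (r * s))) r := by
  have h := hasDerivAt_specMap (E := E) T (fun i => Complex.I * s * l i) r
  have e : ∀ (r : ℝ) (i : ι), (r : ℂ) * (Complex.I * s * l i) = Complex.I * ((r * s : ℝ) : ℂ) * l i :=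
    fun r i => by push_cast; ring
  simp only [e, mul_assoc (Complex.I * (s : ℂ))] at h
  rw [mul_weyl hE hB, ← map_smul, ← specMap_smul]
  exact h

theorem hasDerivAt_weyl_conj (hE : CompleteOrthogonalIdempotents E)
    (hB : specMap E (fun i => (l i : ℂ)) = field γ L) (T : Lplus n →ₗ[ℂ] Lplus n →ₗ[ℂ] V)
    (s r : ℝ) :
    HasDerivAt (fun r : ℝ => T (weyl E l (r * s)) (weyl E l (-(r * s))))
      ((Complex.I * s) • (T (field γ L * weyl E l (r * s)) (weyl E l (-(r * s))) -
        T (weyl E l (r * s)) (field γ L * weyl E l (-(r * s))))) r := by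
  have h := hasDerivAt_specMap₂ (E := E) T (fun i => Complex.I * s * l i)
    (fun i => -(Complex.I * s) * l i) r
  have e : ∀ (r : ℝ) (i : ι), (r : ℂ) * (Complex.I * s * l i) = Complex.I * ((r * s : ℝ) : ℂ) * l i :=
    fun r i => by push_cast; ring
  have e' : ∀ (r : ℝ) (i : ι), (r : ℂ) * (-(Complex.I * s) * l i) =
      Complex.I * ((-(r * s) : ℝ) : ℂ) * l i := fun r i => by push_cast; ring
  simp only [e, e', mul_assoc (Complex.I * (s : ℂ)), mul_assoc (-(Complex.I * (s : ℂ)))] at h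
  refine h.congr_deriv ?_
  rw [specMap_smul, specMap_smul, mul_weyl hE hB, mul_weyl hE hB, map_smul, map_smul,
    LinearMap.smul_apply, neg_smul, smul_sub, sub_eq_add_neg]
  rfl

/-- `X ↦ w^K X φ`. -/
def evalWeight (K : ℤ) (φ : D n) : Lplus n →ₗ[ℂ] D n where
  toFun X := (wpow K).1 (X.1 φ)
  map_add' X Y := by simp
  map_smul' c X := by simp

/-- Energy estimate: for `v = w^K e^{irsB} φ` the derivative of `‖v‖²` is `-2s` times the imaginary
part bounded in `im_inner_wpow_field_le`, hence at most a constant times `‖v‖²`, and Gronwall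
applies. -/
theorem norm_wpow_weyl_le (hE : CompleteOrthogonalIdempotents E)
    (hB : specMap E (fun i => (l i : ℂ)) = field γ L) (K : ℤ) (s : ℝ) (φ : D n) :
    ‖(wpow K).1 ((weyl E l s).1 φ)‖ ≤
      Real.exp ((∑ j, |γ j|) * 16 ^ K.natAbs * |s|) * ‖(wpow K).1 φ‖ := by
  set C := (∑ j, |γ j|) * 16 ^ K.natAbs with hC
  let v : ℝ → D n := fun r => (wpow K).1 ((weyl E l (r * s)).1 φ)
  let v' : ℝ → D n := fun r =>
    (Complex.I * s) • (wpow K).1 ((field γ L).1 ((weyl E l (r * s)).1 φ))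
  have hv : ∀ r, HasDerivAt v (v' r) r := fun r => hasDerivAt_weyl hE hB (evalWeight K φ) s r
  have hg : ∀ r, HasDerivAt (fun r => ‖v r‖ ^ 2) (2 * (inner ℂ (v r) (v' r) : ℂ).re) r := fun r => by
    have h1 := ((hv r).inner ℂ (hv r))
    have h2 := Complex.reCLM.hasFDerivAt.comp_hasDerivAt r h1
    have h3 : (Complex.reCLM : ℂ → ℝ) ∘ (fun r => inner ℂ (v r) (v r)) = fun r => ‖v r‖ ^ 2 := by
      funext r
      simp [inner_self_eq_norm_sq_to_K, ← Complex.ofReal_pow]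
    rw [h3] at h2
    refine h2.congr_deriv ?_
    have h4 : (inner ℂ (v' r) (v r) : ℂ).re = (inner ℂ (v r) (v' r) : ℂ).re :=
      inner_re_symm (𝕜 := ℂ) _ _
    simp only [Complex.reCLM_apply, Complex.add_re, h4]
    ring
  have hbound : ∀ r, ‖2 * (inner ℂ (v r) (v' r) : ℂ).re‖ ≤ 2 * C * |s| * ‖‖v r‖ ^ 2‖ := fun r => by
    have h1 := im_inner_wpow_field_le γ L K ((weyl E l (r * s)).1 φ)
    have h2 : (inner ℂ (v r) (v' r) : ℂ).re =
        -(s * (inner ℂ (v r) ((wpow K).1 ((field γ L).1 ((weyl E l (r * s)).1 φ))) : ℂ).im) := by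
      simp only [v', inner_smul_right]
      simp
    rw [h2, Real.norm_eq_abs, Real.norm_eq_abs, abs_of_nonneg (sq_nonneg ‖v r‖), abs_mul, abs_neg,
      abs_mul, abs_two]
    calc _ ≤ 2 * (|s| * (C * ‖v r‖ ^ 2)) := by gcongr
      _ = _ := by ring
  have hgr := norm_le_gronwallBound_of_norm_deriv_right_le (a := 0) (b := 1) (ε := 0)
    (δ := ‖v 0‖ ^ 2) (K := 2 * C * |s|) (f := fun r => ‖v r‖ ^ 2)
    (f' := fun r => 2 * (inner ℂ (v r) (v' r) : ℂ).re)
    (fun r _ => (hg r).continuousAt.continuousWithinAt) (fun r _ => (hg r).hasDerivWithinAt)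
    (by simp) (fun r _ => by simpa using hbound r) 1 (by simp)
  rw [gronwallBound_ε0, sub_zero, mul_one] at hgr
  have h0 : v 0 = (wpow K).1 φ := by simp [v, weyl_zero hE]
  have h1 : v 1 = (wpow K).1 ((weyl E l s).1 φ) := by simp [v]
  rw [h0, h1, Real.norm_eq_abs, abs_of_nonneg (sq_nonneg _)] at hgr
  refine (sq_le_sq₀ (norm_nonneg _) (by positivity)).mp (hgr.trans_eq ?_)
  rw [mul_pow, ← Real.exp_nat_mul, mul_comm]
  congr 2
  push_cast
  ring

/-- The bound on the growth of `w^K` under the field dynamics up to time `s`. -/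
def growth (γ : Fin n → ℝ) (K : ℤ) (s : ℝ) : ℝ :=
  Real.exp ((∑ j, |γ j|) * 16 ^ K.natAbs * s)

theorem growth_mono (γ : Fin n → ℝ) (K : ℤ) {s s' : ℝ} (h : s ≤ s') :
    growth γ K s ≤ growth γ K s' := by
  unfold growth
  gcongr

theorem norm_wpow_weyl_le_growth (hE : CompleteOrthogonalIdempotents E)
    (hB : specMap E (fun i => (l i : ℂ)) = field γ L) (K : ℤ) {s T : ℝ} (hs : |s| ≤ T) (φ : D n) :
    ‖(wpow K).1 ((weyl E l s).1 φ)‖ ≤ growth γ K T * ‖(wpow K).1 φ‖ :=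
  (norm_wpow_weyl_le hE hB K s φ).trans
    (mul_le_mul_of_nonneg_right (growth_mono γ K hs) (norm_nonneg _))

theorem abs_mul_le_of_mem {r s T : ℝ} (hr : r ∈ Set.Ico (0 : ℝ) 1) (hs : |s| ≤ T) : |r * s| ≤ T := by
  rw [abs_mul, abs_of_nonneg hr.1]
  exact (mul_le_of_le_one_left (abs_nonneg s) hr.2.le).trans hs

/-- Mean value inequality: the derivative contains one factor `B`, which costs one power of the
weight, and the propagator is then bounded in the norm of `w^{K+1}`. -/
theorem norm_wpow_weyl_sub_one_le (hE : CompleteOrthogonalIdempotents E)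
    (hB : specMap E (fun i => (l i : ℂ)) = field γ L) (K : ℤ) {s T : ℝ} (hs : |s| ≤ T) (φ : D n) :
    ‖(wpow K).1 ((weyl E l s - 1).1 φ)‖ ≤
      |s| * ((∑ j, |γ j|) * (2 * 2 ^ K.natAbs) * growth γ (K + 1) T) * ‖(wpow (K + 1)).1 φ‖ := by
  have h := norm_image_sub_le_of_norm_deriv_le_segment_01'
    (f := fun r : ℝ => evalWeight K φ (weyl E l (r * s)))
    (C := |s| * ((∑ j, |γ j|) * (2 * 2 ^ K.natAbs) * growth γ (K + 1) T) * ‖(wpow (K + 1)).1 φ‖)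
    (fun r _ => (hasDerivAt_weyl hE hB (evalWeight K φ) s r).hasDerivWithinAt) fun r hr => by
      rw [norm_smul, norm_mul, Complex.norm_I, one_mul, Complex.norm_real, Real.norm_eq_abs]
      have h1 := norm_wpow_field_le γ L K ((weyl E l (r * s)).1 φ)
      have h2 := norm_wpow_weyl_le_growth hE hB (K + 1) (abs_mul_le_of_mem hr hs) φ
      calc _ ≤ |s| * ((∑ j, |γ j|) * (2 * 2 ^ K.natAbs) *
            (growth γ (K + 1) T * ‖(wpow (K + 1)).1 φ‖)) := by
            refine mul_le_mul_of_nonneg_left (h1.trans ?_) (abs_nonneg _)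
            gcongr
        _ = _ := by ring
  simpa [evalWeight, weyl_zero hE, ← map_sub] using h

/-- `(X, Y) ↦ w^K X A Y φ`. -/
def evalConj (K : ℤ) (A : Lplus n) (φ : D n) : Lplus n →ₗ[ℂ] Lplus n →ₗ[ℂ] D n :=
  LinearMap.mk₂ ℂ (fun X Y => (wpow K).1 (X.1 (A.1 (Y.1 φ))))
    (fun _ _ _ => by simp) (fun _ _ _ => by simp) (fun _ _ _ => by simp) (fun _ _ _ => by simp)

/-- The deviation of `e^{isB} a_j e^{-isB}` from its limit `a_j - i γ_j s`. -/
def annDefect (γ : Fin n → ℝ) (E : ι → Lplus n) (l : ι → ℝ) (j : Fin n) (s : ℝ) : Lplus n :=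
  weyl E l s * ann j * weyl E l (-s) - ann j + (Complex.I * γ j * s) • 1

/-- Duhamel's principle: the derivative along the path is `isγ_j e^{irsB} (defect) e^{-irsB}`. The
outer propagator is bounded in the norm of `w^K`, the defect passes from `w^{K+3}` to `w^K` with the
gain `1/(L + 1)`, and the inner propagator is bounded in the norm of `w^{K+3}`. -/
theorem norm_wpow_annDefect_le (hE : CompleteOrthogonalIdempotents E)
    (hB : specMap E (fun i => (l i : ℂ)) = field γ L) (j : Fin n) (K : ℤ) {s T : ℝ} (hs : |s| ≤ T)
    (φ : D n) :
    ‖(wpow K).1 ((annDefect γ E l j s).1 φ)‖ ≤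
      T * |γ j| * growth γ K T * (1 + 4 ^ K.natAbs) * growth γ (K + 3) T / (L + 1) *
        ‖(wpow (K + 3)).1 φ‖ := by
  have hT : 0 ≤ T := (abs_nonneg s).trans hs
  -- The term linear in `r` removes the canonical part `-γ_j` of the commutator, and `f 1 - f 0` is
  -- the vector to be estimated.
  let f : ℝ → D n := fun r => evalConj K (ann j) φ (weyl E l (r * s)) (weyl E l (-(r * s))) +
    (r : ℂ) • ((Complex.I * γ j * s) • (wpow K).1 φ)
  let f' : ℝ → D n := fun r => (Complex.I * s * γ j) •
    (wpow K).1 ((weyl E l (r * s)).1 ((defect j L).1 ((weyl E l (-(r * s))).1 φ)))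
  have hf : ∀ r, HasDerivAt f (f' r) r := fun r => by
    have h1 := hasDerivAt_weyl_conj hE hB (evalConj K (ann j) φ) s r
    have h2 : HasDerivAt (fun r : ℝ => (r : ℂ) • ((Complex.I * γ j * s) • (wpow K).1 φ))
        ((1 : ℂ) • ((Complex.I * γ j * s) • (wpow K).1 φ)) r :=
      (Complex.ofRealCLM.hasDerivAt (x := r)).smul_const _
    refine (h1.add h2).congr_deriv ?_
    have e1 : evalConj K (ann j) φ (field γ L * weyl E l (r * s)) (weyl E l (-(r * s))) -
        evalConj K (ann j) φ (weyl E l (r * s)) (field γ L * weyl E l (-(r * s))) =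
        (γ j : ℂ) • ((wpow K).1 ((weyl E l (r * s)).1 ((defect j L).1 ((weyl E l (-(r * s))).1 φ)))
          - (wpow K).1 φ) := by
      have e2 : field γ L * weyl E l (r * s) * ann j * weyl E l (-(r * s)) -
          weyl E l (r * s) * ann j * (field γ L * weyl E l (-(r * s))) =
          (γ j : ℂ) • (weyl E l (r * s) * defect j L * weyl E l (-(r * s)) - 1) := by
        have e3 : field γ L * weyl E l (r * s) * ann j * weyl E l (-(r * s)) -
          weyl E l (r * s) * ann j * (field γ L * weyl E l (-(r * s))) =
            weyl E l (r * s) * (field γ L * ann j - ann j * field γ L) * weyl E l (-(r * s)) := by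
          rw [← weyl_mul hE hB]
          simp only [mul_sub, sub_mul, mul_assoc]
        rw [e3, field_mul_ann, mul_smul_comm, smul_mul_assoc, mul_sub, sub_mul, mul_one,
          weyl_mul_weyl_neg hE]
      have e4 := congrArg (fun X : Lplus n => (wpow K).1 (X.1 φ)) e2
      simp only [Lplus_sub_apply, Lplus_mul_apply, Lplus_smul_apply, Lplus_one_apply, map_sub,
        map_smul] at e4
      exact e4
    rw [e1]
    simp only [f', smul_sub, smul_smul, one_mul]
    rw [mul_right_comm Complex.I (γ j : ℂ)]
    abel
  have h := norm_image_sub_le_of_norm_deriv_le_segment_01' (f := f) (f' := f')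
    (C := T * |γ j| * growth γ K T * (1 + 4 ^ K.natAbs) * growth γ (K + 3) T / (L + 1) *
        ‖(wpow (K + 3)).1 φ‖)
    (fun r _ => (hf r).hasDerivWithinAt) fun r hr => by
      have hrs := abs_mul_le_of_mem hr hs
      have hrs' : |-(r * s)| ≤ T := by rwa [abs_neg]
      rw [norm_smul, norm_mul, norm_mul, Complex.norm_I, one_mul, Complex.norm_real,
        Complex.norm_real, Real.norm_eq_abs, Real.norm_eq_abs]
      have hg1 : 0 ≤ growth γ K T := (Real.exp_pos _).le
      have hg2 : 0 ≤ growth γ (K + 3) T := (Real.exp_pos _).le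
      calc _ ≤ T * |γ j| * (growth γ K T * ((1 + 4 ^ K.natAbs) / (L + 1) *
            (growth γ (K + 3) T * ‖(wpow (K + 3)).1 φ‖))) := by
            gcongr
            refine (norm_wpow_weyl_le_growth hE hB K hrs _).trans ?_
            gcongr
            refine (norm_wpow_defect_le j L K _).trans ?_
            gcongr
            exact norm_wpow_weyl_le_growth hE hB (K + 3) hrs' φ
        _ = _ := by ring
  have e : f 1 - f 0 = (wpow K).1 ((annDefect γ E l j s).1 φ) := by
    simp only [f, evalConj, LinearMap.mk₂_apply, annDefect, one_mul, zero_mul, neg_zero,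
      weyl_zero hE, Lplus_add_apply, Lplus_sub_apply, Lplus_mul_apply, Lplus_smul_apply,
      Lplus_one_apply, map_add, map_sub, map_smul, Complex.ofReal_one, Complex.ofReal_zero,
      one_smul, zero_smul, add_zero]
    abel
  rwa [e] at h

end WeylOperators

/-! ### Bounds for the seminorms of `τ`. -/

section SeminormBounds

variable {d n : ℕ}

/-- The bound `‖X‖^Ψ ≤ ε`. -/
def StrongBound (Ψ : HSpin d) (X : Obs d n) (ε : ℝ) : Prop :=
  ∀ (χ₁ : HSpin d) (χ₂ φ₂ : D n), ‖χ₁‖ ≤ 1 → ‖χ₂‖ ≤ 1 → ‖φ₂‖ ≤ 1 →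
    ‖inner ℂ (χ₁ ⊗ₜ[ℂ] χ₂) (act d n X (Ψ ⊗ₜ[ℂ] φ₂))‖ ≤ ε

theorem StrongBound.seminorm_le {Ψ : HSpin d} {X : Obs d n} {ε : ℝ} (h : StrongBound Ψ X ε) :
    strongSeminorm Ψ X ≤ ENNReal.ofReal ε := by
  refine iSup_le fun χ₁ => iSup_le fun χ₂ => iSup_le fun φ₂ => iSup_le fun h₁ => iSup_le fun h₂ =>
    iSup_le fun h₃ => ?_
  rw [← ofReal_norm]
  exact ENNReal.ofReal_le_ofReal (h χ₁ χ₂ φ₂ h₁ h₂ h₃)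

theorem StrongBound.add {Ψ : HSpin d} {X Y : Obs d n} {ε δ : ℝ} (hX : StrongBound Ψ X ε)
    (hY : StrongBound Ψ Y δ) : StrongBound Ψ (X + Y) (ε + δ) := fun χ₁ χ₂ φ₂ h₁ h₂ h₃ => by
  rw [map_add, LinearMap.add_apply, inner_add_right]
  exact (norm_add_le _ _).trans (add_le_add (hX χ₁ χ₂ φ₂ h₁ h₂ h₃) (hY χ₁ χ₂ φ₂ h₁ h₂ h₃))

/-- The bound `‖X‖^{f,k,Ψ} ≤ ε`. -/
def TauBound (f : Fin n → RapidFun) (k : Fin n → ℕ) (Ψ : HSpin d) (X : Obs d n) (ε : ℝ) : Prop :=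
  StrongBound Ψ ((1 ⊗ₜ opF f) * X * (1 ⊗ₜ opM k)) ε ∧
    StrongBound Ψ ((1 ⊗ₜ opM k) * X * (1 ⊗ₜ opF f)) ε

theorem TauBound.seminorm_le {f : Fin n → RapidFun} {k : Fin n → ℕ} {Ψ : HSpin d} {X : Obs d n}
    {ε : ℝ} (h : TauBound f k Ψ X ε) : tauSeminorm f k Ψ X ≤ ENNReal.ofReal ε :=
  max_le h.1.seminorm_le h.2.seminorm_le

theorem TauBound.add {f : Fin n → RapidFun} {k : Fin n → ℕ} {Ψ : HSpin d} {X Y : Obs d n}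
    {ε δ : ℝ} (hX : TauBound f k Ψ X ε) (hY : TauBound f k Ψ Y δ) :
    TauBound f k Ψ (X + Y) (ε + δ) := by
  constructor
  · rw [mul_add, add_mul]
    exact hX.1.add hY.1
  · rw [mul_add, add_mul]
    exact hX.2.add hY.2

theorem tendsto_tauSeminorm {κ : Type*} {l : Filter κ} {f : Fin n → RapidFun} {k : Fin n → ℕ}
    {Ψ : HSpin d} {X : κ → Obs d n} {ε : κ → ℝ} (h : ∀ᶠ p in l, TauBound f k Ψ (X p) (ε p))
    (hε : Tendsto ε l (𝓝 0)) : Tendsto (fun p => tauSeminorm f k Ψ (X p)) l (𝓝 0) := by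
  refine tendsto_of_tendsto_of_tendsto_of_le_of_le' tendsto_const_nhds
    (by simpa using ENNReal.tendsto_ofReal hε) (.of_forall fun _ => bot_le)
    (h.mono fun p hp => hp.seminorm_le)

theorem strongBound_tmul (Ψ : HSpin d) (A : HSpin d →L[ℂ] HSpin d) {Z : Lplus n} {ε : ℝ}
    (hZ : ∀ φ, ‖Z.1 φ‖ ≤ ε * ‖φ‖) (hε : 0 ≤ ε) : StrongBound Ψ (A ⊗ₜ Z) (‖A Ψ‖ * ε) :=
  fun χ₁ χ₂ φ₂ h₁ h₂ h₃ => by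
    rw [act_tmul, TensorProduct.inner_tmul, norm_mul]
    refine mul_le_mul ((norm_inner_le_norm _ _).trans (mul_le_of_le_one_left (norm_nonneg _) h₁))
      ?_ (norm_nonneg _) (norm_nonneg _)
    calc _ ≤ ‖χ₂‖ * ‖Z.1 φ₂‖ := norm_inner_le_norm _ _
      _ ≤ 1 * (ε * 1) := by
        refine mul_le_mul h₂ ((hZ φ₂).trans ?_) (norm_nonneg _) zero_le_one
        gcongr
      _ = ε := by ring

/-- For fixed `χ₂` and `φ₂` the boson factors become numbers `z_i`, and the matrix element is that
of `A ∑ z_i P_i`, whose norm is governed by the largest `|z_i|`. The bound is thus independent of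
the number of blocks, which grows with `V`. -/
theorem strongBound_sum {ι : Type*} [Fintype ι] {P : ι → HSpin d →L[ℂ] HSpin d}
    (hP : CompleteOrthogonalIdempotents P) (hs : ∀ i, IsSelfAdjoint (P i)) (Ψ : HSpin d)
    {A : HSpin d →L[ℂ] HSpin d} (hA : ‖A‖ ≤ 1) {Z : ι → Lplus n} {ε : ℝ} (hε : 0 ≤ ε)
    (hZ : ∀ i, P i ≠ 0 → ∀ φ, ‖(Z i).1 φ‖ ≤ ε * ‖φ‖) :
    StrongBound Ψ (∑ i, (A * P i) ⊗ₜ[ℂ] Z i) (ε * ‖Ψ‖) := fun χ₁ χ₂ φ₂ h₁ h₂ h₃ => by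
  let z : ι → ℂ := fun i => inner ℂ χ₂ ((Z i).1 φ₂)
  have hz : ∀ i, P i ≠ 0 → ‖z i‖ ≤ ε := fun i hi => by
    calc _ ≤ ‖χ₂‖ * ‖(Z i).1 φ₂‖ := norm_inner_le_norm _ _
      _ ≤ 1 * (ε * 1) := by
        refine mul_le_mul h₂ ((hZ i hi φ₂).trans ?_) (norm_nonneg _) zero_le_one
        gcongr
      _ = ε := by ring
  have e : inner ℂ (χ₁ ⊗ₜ[ℂ] χ₂) (act d n (∑ i, (A * P i) ⊗ₜ[ℂ] Z i) (Ψ ⊗ₜ[ℂ] φ₂)) =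
      inner ℂ χ₁ (A (specMap P z Ψ)) := by
    rw [map_sum, LinearMap.sum_apply, inner_sum]
    simp only [act_tmul, TensorProduct.inner_tmul, specMap, sum_apply, smul_apply, map_sum,
      map_smul, inner_sum, inner_smul_right]
    exact Finset.sum_congr rfl fun i _ => mul_comm _ _
  rw [e]
  calc _ ≤ ‖χ₁‖ * ‖A (specMap P z Ψ)‖ := norm_inner_le_norm _ _
    _ ≤ 1 * (1 * (ε * ‖Ψ‖)) := by
      refine mul_le_mul h₁ ((A.le_opNorm _).trans ?_) (norm_nonneg _) zero_le_one
      exact mul_le_mul hA (norm_specMap_apply_le hP hs hz hε Ψ) (norm_nonneg _) zero_le_one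
    _ = _ := by ring

/-- Boundedness of `f(M) Z M^k` and `M^k Z f(M)` by `ε`. -/
def WeightBound (f : Fin n → RapidFun) (k : Fin n → ℕ) (Z : Lplus n) (ε : ℝ) : Prop :=
  (∀ φ, ‖(opF f * Z * opM k).1 φ‖ ≤ ε * ‖φ‖) ∧ ∀ φ, ‖(opM k * Z * opF f).1 φ‖ ≤ ε * ‖φ‖

theorem tauBound_tmul {f : Fin n → RapidFun} {k : Fin n → ℕ} (Ψ : HSpin d)
    (A : HSpin d →L[ℂ] HSpin d) {Z : Lplus n} {ε : ℝ} (hZ : WeightBound f k Z ε) (hε : 0 ≤ ε) :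
    TauBound f k Ψ (A ⊗ₜ Z) (‖A Ψ‖ * ε) := by
  constructor
  · simpa only [Algebra.TensorProduct.tmul_mul_tmul, one_mul, mul_one] using
      strongBound_tmul Ψ A hZ.1 hε
  · simpa only [Algebra.TensorProduct.tmul_mul_tmul, one_mul, mul_one] using
      strongBound_tmul Ψ A hZ.2 hε

theorem tauBound_sum {ι : Type*} [Fintype ι] {P : ι → HSpin d →L[ℂ] HSpin d}
    (hP : CompleteOrthogonalIdempotents P) (hs : ∀ i, IsSelfAdjoint (P i)) (Ψ : HSpin d)
    {A : HSpin d →L[ℂ] HSpin d} (hA : ‖A‖ ≤ 1) {f : Fin n → RapidFun} {k : Fin n → ℕ}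
    {Z : ι → Lplus n} {ε : ℝ} (hε : 0 ≤ ε) (hZ : ∀ i, P i ≠ 0 → WeightBound f k (Z i) ε) :
    TauBound f k Ψ (∑ i, (A * P i) ⊗ₜ[ℂ] Z i) (ε * ‖Ψ‖) := by
  constructor
  · simpa only [Finset.mul_sum, Finset.sum_mul, Algebra.TensorProduct.tmul_mul_tmul, one_mul,
      mul_one] using strongBound_sum hP hs Ψ hA hε fun i hi => (hZ i hi).1
  · simpa only [Finset.mul_sum, Finset.sum_mul, Algebra.TensorProduct.tmul_mul_tmul, one_mul,
      mul_one] using strongBound_sum hP hs Ψ hA hε fun i hi => (hZ i hi).2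

theorem RapidFun.exists_le (f : RapidFun) (N : ℕ) :
    ∃ C : ℝ, 0 ≤ C ∧ ∀ x, 0 ≤ x → x ^ N * f.toFun x ≤ C := by
  obtain ⟨B, hB⟩ := f.bounded
  have hB0 : 0 ≤ B := (f.pos 0 le_rfl).le.trans (hB 0 le_rfl)
  obtain ⟨R, hR⟩ := ((f.decay N).eventually (Iio_mem_nhds zero_lt_one)).exists_forall_of_atTop
  refine ⟨1 + |R| ^ N * B, by positivity, fun x hx => ?_⟩
  rcases le_total R x with h | h
  · exact (hR x h).le.trans (le_add_of_nonneg_right (by positivity))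
  · have h1 : x ^ N * f.toFun x ≤ |R| ^ N * B := by
      refine mul_le_mul ?_ (hB x hx) (f.pos x hx).le (by positivity)
      exact pow_le_pow_left₀ hx (h.trans (le_abs_self R)) N
    linarith

theorem norm_opF_le (f : Fin n → RapidFun) (N : ℕ) : ∃ C : ℝ, 0 ≤ C ∧ ∀ (K : ℤ) (φ : D n),
    ‖(wpow (K + N)).1 ((opF f).1 φ)‖ ≤ C * ‖(wpow K).1 φ‖ := by
  choose C hC0 hC using fun j => (f j).exists_le N
  refine ⟨∏ j, C j, Finset.prod_nonneg fun j _ => hC0 j, fun K φ => ?_⟩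
  refine norm_le_of_co (Finset.prod_nonneg fun j _ => hC0 j) id Function.injective_id.injOn
    fun m _ => ?_
  have hp : 0 ≤ ∏ j, (f j).toFun ((m j : ℝ) + 1) :=
    Finset.prod_nonneg fun j _ => ((f j).pos _ (by positivity)).le
  have h1 : weight m ^ (N : ℤ) * ∏ j, (f j).toFun ((m j : ℝ) + 1) ≤ ∏ j, C j := by
    rw [zpow_natCast, weight, ← Finset.prod_pow, ← Finset.prod_mul_distrib]
    exact Finset.prod_le_prod
      (fun j _ => mul_nonneg (by positivity) ((f j).pos _ (by positivity)).le)
      fun j _ => hC j _ (by positivity)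
  have hz := zpow_pos (weight_pos m) K
  rw [id, co_wpow, opF, co_occFun, co_wpow, norm_mul, norm_mul, norm_mul, Complex.norm_real,
    Complex.norm_real, Complex.norm_real, Real.norm_eq_abs, Real.norm_eq_abs, Real.norm_eq_abs,
    abs_of_nonneg hp, abs_of_pos hz, abs_of_pos (zpow_pos (weight_pos m) _),
    zpow_add₀ (weight_pos m).ne']
  calc _ = (weight m ^ (N : ℤ) * ∏ j, (f j).toFun ((m j : ℝ) + 1)) *
        (weight m ^ K * ‖co φ m‖) := by ring
    _ ≤ _ := by gcongr

theorem norm_opM_le (k : Fin n → ℕ) : ∃ (C : ℝ) (N : ℕ), 0 ≤ C ∧ ∀ (K : ℤ) (φ : D n),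
    ‖(wpow K).1 ((opM k).1 φ)‖ ≤ C * ‖(wpow (K + N)).1 φ‖ := by
  obtain ⟨C, N, h⟩ := polyGrowth_pow k
  have hC : 0 ≤ C := by
    have := (abs_nonneg _).trans (h 0)
    exact nonneg_of_mul_nonneg_left this (pow_pos (weight_pos _) _)
  refine ⟨C, N, hC, fun K φ => norm_le_of_co hC id Function.injective_id.injOn fun m _ => ?_⟩
  have hz := zpow_pos (weight_pos m) K
  rw [id, co_wpow, opM, co_occFun, co_wpow, norm_mul, norm_mul, norm_mul, Complex.norm_real,
    Complex.norm_real, Complex.norm_real, Real.norm_eq_abs, Real.norm_eq_abs, Real.norm_eq_abs,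
    abs_of_pos hz, abs_of_pos (zpow_pos (weight_pos m) _), zpow_add₀ (weight_pos m).ne',
    zpow_natCast]
  calc _ ≤ weight m ^ K * (C * weight m ^ N * ‖co φ m‖) := by gcongr; exact h m
    _ = _ := by ring

/-- Polynomially weighted bounds control the weighted operators in the topology `τ`. -/
theorem exists_weightBound (f : Fin n → RapidFun) (k : Fin n → ℕ) (q : ℕ) :
    ∃ (C : ℝ) (K₁ K₂ : ℤ), 0 ≤ C ∧ ∀ (Z : Lplus n) (ε : ℝ), 0 ≤ ε →
      (∀ φ, ‖(wpow K₁).1 (Z.1 φ)‖ ≤ ε * ‖(wpow (K₁ + q)).1 φ‖) →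
      (∀ φ, ‖(wpow K₂).1 (Z.1 φ)‖ ≤ ε * ‖(wpow (K₂ + q)).1 φ‖) → WeightBound f k Z (C * ε) := by
  obtain ⟨C, N, hC, hM⟩ := norm_opM_le k
  obtain ⟨C', hC', hF⟩ := norm_opF_le f (N + q)
  -- Here `M^k` costs `N` powers of the weight, `Z` costs `q`, and `f(M)` gains `N + q`. Read from
  -- left to right, `f(M) Z M^k` passes through the exponents `0, -(N+q), -N, 0`, and `M^k Z f(M)`
  -- through `0, N, N+q, 0`.
  refine ⟨C * C', -(N + q : ℕ), N, by positivity, fun Z ε hε h₁ h₂ => ⟨fun φ => ?_, fun φ => ?_⟩⟩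
  · have h3 := hF (-(N + q : ℕ)) (Z.1 ((opM k).1 φ))
    rw [neg_add_cancel, wpow_zero] at h3
    have h4 := hM (-(N : ℤ)) φ
    rw [neg_add_cancel, wpow_zero] at h4
    have h5 := h₁ ((opM k).1 φ)
    have e : (-((N + q : ℕ) : ℤ) + (q : ℤ)) = -(N : ℤ) := by push_cast; ring
    rw [e] at h5
    calc _ ≤ C' * ‖(wpow (-((N + q : ℕ) : ℤ))).1 (Z.1 ((opM k).1 φ))‖ := h3
      _ ≤ C' * (ε * (C * ‖φ‖)) := by
        refine mul_le_mul_of_nonneg_left (h5.trans ?_) hC'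
        gcongr
      _ = _ := by ring
  · have h3 := hM 0 (Z.1 ((opF f).1 φ))
    rw [wpow_zero, zero_add] at h3
    have h4 := hF 0 φ
    rw [wpow_zero, zero_add] at h4
    have h5 := h₂ ((opF f).1 φ)
    have e : ((N : ℤ) + (q : ℤ)) = ((N + q : ℕ) : ℤ) := by push_cast; ring
    rw [e] at h5
    calc _ ≤ C * ‖(wpow N).1 (Z.1 ((opF f).1 φ))‖ := h3
      _ ≤ C * (ε * (C' * ‖φ‖)) := by
        refine mul_le_mul_of_nonneg_left (h5.trans ?_) hC
        gcongr
      _ = _ := by ring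

end SeminormBounds

/-! ### The exponentials of the Hamiltonian as elements of the algebra. -/

section Evolution

variable {d n : ℕ} {ι : Type*} [Fintype ι] {P : ι → HSpin d →L[ℂ] HSpin d}

/-- The observable `∑ P_i ⊗ X_i`. -/
def blockSum (P : ι → HSpin d →L[ℂ] HSpin d) (X : ι → Lplus n) : Obs d n := ∑ i, P i ⊗ₜ[ℂ] X i

theorem blockSum_mul (hP : CompleteOrthogonalIdempotents P) (X Y : ι → Lplus n) :
    blockSum P X * blockSum P Y = blockSum P fun i => X i * Y i := by
  classical
  simp only [blockSum, Finset.sum_mul_sum, Algebra.TensorProduct.tmul_mul_tmul, hP.mul_eq]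
  refine Finset.sum_congr rfl fun i _ => ?_
  rw [Finset.sum_eq_single i]
  · simp
  · intro j _ hj
    rw [if_neg (Ne.symm hj), TensorProduct.zero_tmul]
  · simp

theorem blockSum_const (hP : CompleteOrthogonalIdempotents P) (X : Lplus n) :
    blockSum P (fun _ => X) = 1 ⊗ₜ X := by
  rw [blockSum, ← TensorProduct.sum_tmul, hP.complete]

theorem blockSum_smul_one (c : ι → ℂ) :
    blockSum P (fun i => c i • (1 : Lplus n)) = specMap P c ⊗ₜ 1 := by
  simp only [blockSum, specMap, TensorProduct.sum_tmul, TensorProduct.tmul_smul,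
    TensorProduct.smul_tmul']

theorem blockSum_add (X Y : ι → Lplus n) :
    blockSum P (fun i => X i + Y i) = blockSum P X + blockSum P Y := by
  simp only [blockSum, TensorProduct.tmul_add, Finset.sum_add_distrib]

theorem hasRealSpectrum_meanSpin (V : Finset (Site d)) :
    HasRealSpectrum (spinDiagonal V) (meanSpin V) := by
  have h := (hasRealSpectrum_sum_spinOp V).smul ((V.card : ℝ)⁻¹)
  simpa [meanSpin] using h

theorem hamiltonian_eq (J : ℝ) (γ : Fin n → ℝ) (V : Finset (Site d)) (L : ℕ) :
    hamiltonian J γ V L = ((J * V.card : ℝ) : ℂ) • ((meanSpin V ^ 2) ⊗ₜ[ℂ] (1 : Lplus n)) +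
      meanSpin V ⊗ₜ[ℂ] field γ L := by
  simp only [hamiltonian, field, TensorProduct.tmul_sum, TensorProduct.tmul_smul]

variable {κ : Type*} [Fintype κ] {E : κ → Lplus n} {l : κ → ℝ} {lam : ι → ℝ}
  {γ : Fin n → ℝ} {L : ℕ} {V : Finset (Site d)}

theorem COI_tmul (hP : CompleteOrthogonalIdempotents P) (hE : CompleteOrthogonalIdempotents E) :
    CompleteOrthogonalIdempotents
      (fun p : ι × κ => (P p.1 ⊗ₜ[ℂ] (1 : Lplus n)) * ((1 : HSpin d →L[ℂ] HSpin d) ⊗ₜ[ℂ] E p.2)) :=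
  COI_mul (COI_map (Algebra.TensorProduct.includeLeft (R := ℂ) (S := ℂ) (B := Lplus n)) hP)
    (COI_map (Algebra.TensorProduct.includeRight (R := ℂ) (A := HSpin d →L[ℂ] HSpin d)) hE)
    fun i k => by simp [Commute, SemiconjBy, Algebra.TensorProduct.tmul_mul_tmul]

theorem specMap_hamiltonian (J : ℝ) (hP : CompleteOrthogonalIdempotents P)
    (hE : CompleteOrthogonalIdempotents E) (hS : specMap P (fun i => (lam i : ℂ)) = meanSpin V)
    (hB : specMap E (fun i => (l i : ℂ)) = field γ L) :
    specMap (fun p : ι × κ => (P p.1 ⊗ₜ[ℂ] (1 : Lplus n)) *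
        ((1 : HSpin d →L[ℂ] HSpin d) ⊗ₜ[ℂ] E p.2))
      (fun p => ((J * V.card * lam p.1 ^ 2 + lam p.1 * l p.2 : ℝ) : ℂ)) = hamiltonian J γ V L := by
  have hE' := COI_map (Algebra.TensorProduct.includeRight (R := ℂ) (A := HSpin d →L[ℂ] HSpin d)) hE
  have h1 := specMap_fst (E := fun i => P i ⊗ₜ[ℂ] (1 : Lplus n)) hE'
    (fun i => ((J * V.card : ℝ) : ℂ) * (lam i : ℂ) ^ 2)
  have h2 := specMap_prod (E := fun i => P i ⊗ₜ[ℂ] (1 : Lplus n))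
    (F := fun k => (1 : HSpin d →L[ℂ] HSpin d) ⊗ₜ[ℂ] E k) (fun i => (lam i : ℂ))
    (fun k => (l k : ℂ))
  have h3 : ∀ c : ι → ℂ, specMap (fun i => P i ⊗ₜ[ℂ] (1 : Lplus n)) c = specMap P c ⊗ₜ 1 :=
    fun c => specMap_map (Algebra.TensorProduct.includeLeft (R := ℂ) (S := ℂ) (B := Lplus n)) c
  have h4 : ∀ c : κ → ℂ, specMap (fun k => (1 : HSpin d →L[ℂ] HSpin d) ⊗ₜ[ℂ] E k) c =
      1 ⊗ₜ specMap E c :=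
    fun c => specMap_map (Algebra.TensorProduct.includeRight (R := ℂ)
      (A := HSpin d →L[ℂ] HSpin d)) c
  have h5 : specMap P (fun i => ((J * V.card : ℝ) : ℂ) * (lam i : ℂ) ^ 2) =
      ((J * V.card : ℝ) : ℂ) • meanSpin V ^ 2 := by
    rw [specMap_smul, ← specMap_pow hP, hS]
  rw [h3, h5] at h1
  rw [h3, h4, hS, hB, Algebra.TensorProduct.tmul_mul_tmul, one_mul, mul_one] at h2
  rw [hamiltonian_eq, TensorProduct.smul_tmul', ← h2]
  refine Eq.trans ?_ (congrArg (· + _) h1)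
  refine Eq.trans ?_ (specMap_add _ _ _)
  congr 1
  funext p
  push_cast
  ring

theorem hasRealSpectrum_hamiltonian (J : ℝ) (γ : Fin n → ℝ) (V : Finset (Site d)) (L : ℕ) :
    HasRealSpectrum Set.univ (hamiltonian J γ V L) := by
  obtain ⟨ι, _, P, lam, hP, -, hS⟩ := hasRealSpectrum_meanSpin V
  obtain ⟨κ, _, E, l, hE, -, hB⟩ := hasRealSpectrum_field γ L
  exact ⟨ι × κ, inferInstance, _, _, COI_tmul hP hE, fun _ => trivial,
    specMap_hamiltonian J hP hE hS hB⟩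

/-- The formula is demanded for every spectral family of the Hamiltonian, so that each observable
can be conjugated in a family adapted to it. -/
theorem exists_evolution (J : ℝ) (γ : Fin n → ℝ) (V : Finset (Site d)) (L : ℕ) :
    ∃ U : ℝ → Obs d n, ∀ (κ : Type) [Fintype κ] (F : κ → Obs d n) (h : κ → ℝ),
      CompleteOrthogonalIdempotents F → specMap F (fun i => (h i : ℂ)) = hamiltonian J γ V L →
      ∀ t, U t = specMap F fun i => Complex.exp (Complex.I * t * h i) := by
  obtain ⟨ι, _, E, l, hE, -, hH⟩ := hasRealSpectrum_hamiltonian J γ V L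
  exact ⟨fun t => specMap E fun i => Complex.exp (Complex.I * t * l i),
    fun κ _ F h hF hFH t => specMap_comp_eq hE hF (hH.trans hFH.symm)
      fun z => Complex.exp (Complex.I * t * z)⟩

/-- The group `e^{i t H_{V,L}}` in `𝓐`. -/
def evolution (J : ℝ) (γ : Fin n → ℝ) (V : Finset (Site d)) (L : ℕ) : ℝ → Obs d n :=
  (exists_evolution J γ V L).choose

theorem evolution_eq_specMap {J : ℝ} {γ : Fin n → ℝ} {V : Finset (Site d)} {L : ℕ} {κ : Type}
    [Fintype κ] {F : κ → Obs d n} {h : κ → ℝ} (hF : CompleteOrthogonalIdempotents F)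
    (hH : specMap F (fun i => (h i : ℂ)) = hamiltonian J γ V L) (t : ℝ) :
    evolution J γ V L t = specMap F fun i => Complex.exp (Complex.I * t * h i) :=
  (exists_evolution J γ V L).choose_spec κ F h hF hH t

theorem isExp_evolution (J : ℝ) (γ : Fin n → ℝ) (V : Finset (Site d)) (L : ℕ) (t : ℝ) :
    IsExp ((Complex.I * (t : ℂ)) • hamiltonian J γ V L) (evolution J γ V L t) := by
  obtain ⟨ι, _, E, l, hE, -, hH⟩ := hasRealSpectrum_hamiltonian J γ V L
  intro v
  rw [evolution_eq_specMap hE hH t, ← hH, ← specMap_smul]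
  exact hasSum_exp_specMap hE ((LinearMap.applyₗ v).comp (act d n).toLinearMap) _

/-- The cut-off dynamics. -/
def dynamics (J : ℝ) (γ : Fin n → ℝ) (V : Finset (Site d)) (L : ℕ) (t : ℝ) (X : Obs d n) :
    Obs d n :=
  evolution J γ V L t * X * evolution J γ V L (-t)

theorem isCutoffDynamics_dynamics (J : ℝ) (γ : Fin n → ℝ) (V : Finset (Site d)) (L : ℕ) :
    IsCutoffDynamics J γ V L (dynamics J γ V L) := fun t =>
  ⟨evolution J γ V L t, evolution J γ V L (-t), isExp_evolution J γ V L t, by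
    have h := isExp_evolution J γ V L (-t)
    rwa [Complex.ofReal_neg, mul_neg] at h, fun _ => rfl⟩

end Evolution

/-! ### Conjugation by the evolution, block by block. -/

section Blocks

variable {d n : ℕ} {ι κ : Type} [Fintype ι] [Fintype κ] {P : ι → HSpin d →L[ℂ] HSpin d}
  {E : κ → Lplus n} {l : κ → ℝ} {lam : ι → ℝ} {γ : Fin n → ℝ} {L : ℕ} {V : Finset (Site d)}

theorem evolution_eq_blockSum (J : ℝ) (hP : CompleteOrthogonalIdempotents P)
    (hE : CompleteOrthogonalIdempotents E) (hS : specMap P (fun i => (lam i : ℂ)) = meanSpin V)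
    (hB : specMap E (fun i => (l i : ℂ)) = field γ L) (t : ℝ) :
    evolution J γ V L t = blockSum P fun i =>
      Complex.exp (Complex.I * t * (J * V.card * lam i ^ 2 : ℝ)) • weyl E l (t * lam i) := by
  rw [evolution_eq_specMap (COI_tmul hP hE) (specMap_hamiltonian J hP hE hS hB) t]
  simp only [specMap, blockSum, weyl, Fintype.sum_prod_type, TensorProduct.tmul_smul,
    TensorProduct.tmul_sum, Finset.smul_sum, smul_smul, ← Complex.exp_add,
    Algebra.TensorProduct.tmul_mul_tmul, one_mul, mul_one]
  refine Finset.sum_congr rfl fun i _ => Finset.sum_congr rfl fun k _ => ?_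
  congr 2
  push_cast
  ring

theorem dynamics_ann (J : ℝ) (hP : CompleteOrthogonalIdempotents P)
    (hE : CompleteOrthogonalIdempotents E) (hS : specMap P (fun i => (lam i : ℂ)) = meanSpin V)
    (hB : specMap E (fun i => (l i : ℂ)) = field γ L) (t : ℝ) (j : Fin n) :
    dynamics J γ V L t (1 ⊗ₜ ann j) =
      blockSum P (fun i => annDefect γ E l j (t * lam i)) + 1 ⊗ₜ ann j +
        (-(Complex.I * γ j * t)) • (meanSpin V ⊗ₜ 1) := by
  rw [dynamics, evolution_eq_blockSum J hP hE hS hB, evolution_eq_blockSum J hP hE hS hB,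
    ← blockSum_const hP, blockSum_mul hP, blockSum_mul hP, ← hS, TensorProduct.smul_tmul',
    ← specMap_smul, ← blockSum_smul_one, ← blockSum_add, ← blockSum_add]
  congr 1
  funext i
  rw [smul_mul_assoc, smul_mul_assoc, mul_smul_comm, smul_smul, ← Complex.exp_add, annDefect]
  have h : Complex.I * (t : ℂ) * (J * V.card * lam i ^ 2 : ℝ) +
      Complex.I * ((-t : ℝ) : ℂ) * (J * V.card * lam i ^ 2 : ℝ) = 0 := by push_cast; ring
  rw [h, Complex.exp_zero, one_smul, neg_mul]
  push_cast
  module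

/-- From `P_i S = λ_i P_i` and `‖S‖ ≤ 1`. This bounds the effective time `tλ_i` of each block
uniformly in `V`. -/
theorem abs_le_one_of_meanSpin (hP : CompleteOrthogonalIdempotents P)
    (hS : specMap P (fun i => (lam i : ℂ)) = meanSpin V) {i : ι} (hi : P i ≠ 0) : |lam i| ≤ 1 := by
  have h : ‖P i * meanSpin V‖ = |lam i| * ‖P i‖ := by
    rw [← hS, mul_specMap hP, norm_smul, Complex.norm_real, Real.norm_eq_abs]
  have h0 : 0 < ‖P i‖ := norm_pos_iff.mpr hi
  have h1 : ‖P i * meanSpin V‖ ≤ ‖P i‖ * 1 :=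
    (norm_mul_le (P i) (meanSpin V)).trans
      (mul_le_mul_of_nonneg_left (norm_meanSpin_le V) h0.le)
  rw [h, mul_comm] at h1
  exact le_of_mul_le_mul_left h1 h0

theorem blockSum_mul_tmul_one {A : HSpin d →L[ℂ] HSpin d} (σ : Equiv.Perm ι)
    (h : ∀ i, P i * A = A * P (σ i)) (X : ι → Lplus n) :
    blockSum P X * (A ⊗ₜ 1) = (A ⊗ₜ 1) * blockSum P fun i => X (σ.symm i) := by
  simp only [blockSum, Finset.sum_mul, Finset.mul_sum, Algebra.TensorProduct.tmul_mul_tmul,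
    mul_one, one_mul, h]
  exact Fintype.sum_equiv σ _ _ fun i => by simp

theorem weyl_add (hE : CompleteOrthogonalIdempotents E) (s s' : ℝ) :
    weyl E l s * weyl E l s' = weyl E l (s + s') := by
  rw [weyl, weyl, weyl, specMap_mul hE]
  congr 1
  funext i
  rw [← Complex.exp_add]
  push_cast
  ring_nf

/-- Moving `A` to the left past the first exponential permutes its blocks, and the two exponentials
then combine into differences of energies and of field times. The permutation is trivial for `σ_3^i`
and flips the `i`-th spin for the other two Pauli matrices. -/
theorem dynamics_of_perm (J : ℝ) (hP : CompleteOrthogonalIdempotents P)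
    (hE : CompleteOrthogonalIdempotents E) (hS : specMap P (fun i => (lam i : ℂ)) = meanSpin V)
    (hB : specMap E (fun i => (l i : ℂ)) = field γ L) (t : ℝ) {A : HSpin d →L[ℂ] HSpin d}
    (σ : Equiv.Perm ι) (h : ∀ i, P i * A = A * P (σ i)) :
    dynamics J γ V L t (A ⊗ₜ 1) = (A ⊗ₜ 1) * blockSum P fun i =>
      Complex.exp (Complex.I * t * (J * V.card * (lam (σ.symm i) ^ 2 - lam i ^ 2) : ℝ)) •
        weyl E l (t * (lam (σ.symm i) - lam i)) := by
  rw [dynamics, evolution_eq_blockSum J hP hE hS hB, evolution_eq_blockSum J hP hE hS hB,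
    blockSum_mul_tmul_one σ h, mul_assoc, blockSum_mul hP]
  congr 2
  funext i
  rw [smul_mul_smul_comm, ← Complex.exp_add, weyl_add hE]
  congr 2
  · push_cast
    ring
  · ring

end Blocks

/-! ### The limit of `a_j`, and convergence of the spin-flip phase. -/

section Limits

variable {d n : ℕ}

theorem exists_weightBound_one (f : Fin n → RapidFun) (k : Fin n → ℕ) :
    ∃ C : ℝ, 0 ≤ C ∧ WeightBound f k 1 C := by
  obtain ⟨C, K₁, K₂, hC, h⟩ := exists_weightBound f k 0
  refine ⟨C * 1, by positivity, h 1 1 zero_le_one ?_ ?_⟩ <;> intro φ <;> simp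

theorem exists_tauTendsto_dynamics_ann (J : ℝ) (γ : Fin n → ℝ) (𝓥 : Filter (Finset (Site d)))
    (t : ℝ) (j : Fin n) : ∃ X : Obs d n, TauTendsto 𝓥 (𝓥 ×ˢ atTop)
      (fun p : Finset (Site d) × ℕ => dynamics J γ p.1 p.2 t (1 ⊗ₜ ann j)) X := by
  -- One operator is fixed before the relevant vector is given; on each such vector it agrees with
  -- the limit of the mean spin.
  obtain ⟨S, hS⟩ := exists_strongLimit 𝓥 meanSpin 1 norm_meanSpin_le
  refine ⟨1 ⊗ₜ ann j + (-(Complex.I * γ j * t)) • (S ⊗ₜ 1), ?_⟩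
  rintro f k Ψ ⟨S', -, -, hΨ⟩
  have hlim := hS Ψ _ hΨ
  obtain ⟨C₀, hC₀, hW₀⟩ := exists_weightBound_one f k
  obtain ⟨C, K₁, K₂, hC, hW⟩ := exists_weightBound f k 3
  let b : ℤ → ℝ := fun K =>
    |t| * |γ j| * growth γ K |t| * (1 + 4 ^ K.natAbs) * growth γ (K + 3) |t|
  have hb : ∀ K, 0 ≤ b K := fun K => by
    have h1 : 0 ≤ growth γ K |t| := (Real.exp_pos _).le
    have h2 : 0 ≤ growth γ (K + 3) |t| := (Real.exp_pos _).le
    positivity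
  -- The sum dominates the constants for both weight exponents, which come from the two orders of
  -- `f(M)` and `M^k`.
  let ε : ℕ → ℝ := fun L => (b K₁ + b K₂) * (1 / ((L : ℝ) + 1))
  have hε0 : ∀ L, 0 ≤ ε L := fun L => by
    have := hb K₁
    have := hb K₂
    positivity
  have hε : Tendsto ε atTop (𝓝 0) := by
    have h := (tendsto_one_div_add_atTop_nhds_zero_nat (𝕜 := ℝ)).const_mul (b K₁ + b K₂)
    rw [mul_zero] at h
    exact h
  let z : ℂ := -(Complex.I * γ j * t)
  refine tendsto_tauSeminorm (ε := fun p : Finset (Site d) × ℕ =>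
    C * ε p.2 * ‖Ψ‖ + ‖(z • (meanSpin p.1 - S)) Ψ‖ * C₀) (.of_forall fun p => ?_) ?_
  · obtain ⟨V, L⟩ := p
    obtain ⟨ι, _, P, lam, hP, hPV, hPS⟩ := hasRealSpectrum_meanSpin V
    obtain ⟨κ, _, E, l, hE, -, hB⟩ := hasRealSpectrum_field γ L
    have e : dynamics J γ V L t (1 ⊗ₜ ann j) - (1 ⊗ₜ ann j + z • (S ⊗ₜ 1)) =
        ∑ i, (1 * P i) ⊗ₜ[ℂ] annDefect γ E l j (t * lam i) + (z • (meanSpin V - S)) ⊗ₜ 1 := by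
      rw [dynamics_ann J hP hE hPS hB]
      simp only [blockSum, one_mul, smul_sub, TensorProduct.sub_tmul, TensorProduct.smul_tmul', z]
      abel
    change TauBound f k Ψ (dynamics J γ V L t (1 ⊗ₜ ann j) - (1 ⊗ₜ ann j + z • (S ⊗ₜ 1))) _
    rw [e]
    refine (tauBound_sum hP (fun i => (hPV i).1) Ψ ContinuousLinearMap.norm_id_le
      (mul_nonneg hC (hε0 L)) fun i hi => ?_).add (tauBound_tmul Ψ _ hW₀ hC₀)
    have hlam : |t * lam i| ≤ |t| := by
      rw [abs_mul]
      exact mul_le_of_le_one_right (abs_nonneg t) (abs_le_one_of_meanSpin hP hPS hi)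
    have key : ∀ K, b K ≤ b K₁ + b K₂ → ∀ φ : D n,
        ‖(wpow K).1 ((annDefect γ E l j (t * lam i)).1 φ)‖ ≤ ε L * ‖(wpow (K + (3 : ℕ))).1 φ‖ :=
      fun K hK φ => by
        refine (norm_wpow_annDefect_le hE hB j K hlam φ).trans ?_
        rw [div_eq_mul_one_div]
        exact mul_le_mul_of_nonneg_right
          (mul_le_mul_of_nonneg_right hK (by positivity)) (norm_nonneg _)
    exact hW _ _ (hε0 L) (key K₁ (le_add_of_nonneg_right (hb K₂)))
      (key K₂ (le_add_of_nonneg_left (hb K₁)))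
  · have h1 : Tendsto (fun p : Finset (Site d) × ℕ => C * ε p.2 * ‖Ψ‖) (𝓥 ×ˢ atTop) (𝓝 0) := by
      simpa using ((hε.comp tendsto_snd).const_mul C).mul_const ‖Ψ‖
    have h2 : Tendsto (fun V : Finset (Site d) => ‖(z • (meanSpin V - S)) Ψ‖ * C₀) 𝓥 (𝓝 0) := by
      have := ((tendsto_sub_nhds_zero_iff.mpr hlim).const_smul z).norm.mul_const C₀
      simpa using this
    simpa using h1.add (h2.comp tendsto_fst)

/-- The operator `z (σ_3^i σ_3^V - |V|⁻¹)`, the generator of the phase acquired by a spin flip. -/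
def spinGen (z : ℂ) (i : Site d) (V : Finset (Site d)) : HSpin d →L[ℂ] HSpin d :=
  z • (spinOp 2 i * meanSpin V - (V.card : ℂ)⁻¹ • 1)

theorem norm_spinGen_le (z : ℂ) (i : Site d) (V : Finset (Site d)) :
    ‖spinGen z i V‖ ≤ ‖z‖ * 2 := by
  rw [spinGen, norm_smul]
  refine mul_le_mul_of_nonneg_left ?_ (norm_nonneg z)
  have h1 : ‖spinOp 2 i * meanSpin V‖ ≤ 1 * 1 := (norm_mul_le _ _).trans
    (mul_le_mul (norm_spinOp_le 2 i) (norm_meanSpin_le V) (norm_nonneg _) zero_le_one)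
  have h2 : ‖(V.card : ℂ)⁻¹ • (1 : HSpin d →L[ℂ] HSpin d)‖ ≤ 1 * 1 := by
    rw [norm_smul, norm_inv, Complex.norm_natCast]
    refine mul_le_mul ?_ ContinuousLinearMap.norm_id_le (norm_nonneg _) zero_le_one
    rcases V.card.eq_zero_or_pos with h | h
    · simp [h]
    · exact inv_le_one_of_one_le₀ (by exact_mod_cast h)
  linarith [norm_sub_le (spinOp 2 i * meanSpin V) ((V.card : ℂ)⁻¹ • (1 : HSpin d →L[ℂ] HSpin d))]

theorem exists_norm_exp_spinGen_le (z : ℂ) (i : Site d) :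
    ∃ C : ℝ, ∀ V : Finset (Site d), ‖NormedSpace.exp (spinGen z i V)‖ ≤ C := by
  refine ⟨Real.exp (‖z‖ * 2), fun V => ContinuousLinearMap.opNorm_le_bound _ (Real.exp_pos _).le
    fun x => ?_⟩
  have h1 := (ContinuousLinearMap.apply ℂ (HSpin d) x).hasSum
    (NormedSpace.exp_series_hasSum_exp' (𝕂 := ℂ) (spinGen z i V))
  have h2 : HasSum (fun p : ℕ => (‖z‖ * 2) ^ p / p.factorial * ‖x‖) (Real.exp (‖z‖ * 2) * ‖x‖) := by
    have := NormedSpace.expSeries_div_hasSum_exp (‖z‖ * 2)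
    rw [← Real.exp_eq_exp_ℝ] at this
    exact this.mul_right _
  have h3 := tsum_of_norm_bounded
    (f := fun p : ℕ => (((p.factorial : ℂ)⁻¹) • (spinGen z i V ^ p)) x) h2 fun p => by
      change ‖((p.factorial : ℂ)⁻¹) • ((spinGen z i V ^ p) x)‖ ≤ _
      rw [norm_smul, norm_inv, Complex.norm_natCast, div_eq_inv_mul, mul_assoc]
      gcongr
      exact norm_pow_apply_le (norm_spinGen_le z i V) p x
  have h4 := h1.tsum_eq
  change ∑' p : ℕ, (((p.factorial : ℂ)⁻¹) • (spinGen z i V ^ p)) x = _ at h4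
  rw [h4] at h3
  exact h3

theorem meanSpin_commute_of_mem {S : HSpin d →L[ℂ] HSpin d} (hS : S ∈ (spinOps d).centralizer)
    (V : Finset (Site d)) : Commute (meanSpin V) S := by
  unfold meanSpin
  exact Commute.smul_left (Commute.sum_left _ _ _ fun i _ => hS _ ⟨(2, i), rfl⟩) _

theorem spinOp_two_commute_meanSpin (i : Site d) (V : Finset (Site d)) :
    Commute (spinOp 2 i) (meanSpin V) := by
  unfold meanSpin
  exact (Commute.sum_right _ _ _ fun j _ => spinOp_two_commute i (Or.inr rfl)).smul_right _

/-- The generators converge on `Ψ` to `z σ_3^i σ_3^∞`, as `|V|⁻¹ → 0`. Since `σ_3^∞` commutes with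
all spins, this limit commutes with every generator, as `tendsto_exp_apply` requires. -/
theorem tendsto_exp_spinGen {𝓥 : Filter (Finset (Site d))} (h𝓥 : Tendsto Finset.card 𝓥 atTop)
    (z : ℂ) (i : Site d) {Ψ : HSpin d} (hΨ : Ψ ∈ relevant 𝓥) :
    ∃ y, Tendsto (fun V => NormedSpace.exp (spinGen z i V) Ψ) 𝓥 (𝓝 y) := by
  obtain ⟨S, ⟨hS, -⟩, -, hlim⟩ := hΨ
  have hσ : Commute (spinOp 2 i) S := hS _ ⟨(2, i), rfl⟩
  refine ⟨_, tendsto_exp_apply (Y := z • (spinOp 2 i * S)) (norm_spinGen_le z i) (fun V => ?_) ?_⟩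
  · have hm := meanSpin_commute_of_mem hS V
    have hc := spinOp_two_commute_meanSpin i V
    unfold spinGen
    refine Commute.smul_left (Commute.smul_right (Commute.sub_left ?_ ?_) _) _
    · exact (Commute.mul_right (Commute.refl _) hσ).mul_left (hc.symm.mul_right hm)
    · exact Commute.smul_left (Commute.one_left _) _
  · have hinv : Tendsto (fun V : Finset (Site d) => (V.card : ℂ)⁻¹) 𝓥 (𝓝 0) :=
      (tendsto_inv_atTop_nhds_zero_nat (𝕜 := ℂ)).comp h𝓥
    have h1 := ((((spinOp 2 i).continuous.tendsto _).comp hlim).sub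
      (hinv.smul_const Ψ)).const_smul z
    simpa [spinGen] using h1

end Limits

/-! ### Conjugation of a flipped spin, with site `i` split off from `V`. -/

section FlippedSpin

variable {d n : ℕ} {ι κ : Type} [Fintype ι] [Fintype κ] {P : ι → HSpin d →L[ℂ] HSpin d}
  {E : κ → Lplus n} {l : κ → ℝ} {ρ : ι → ℝ} {γ : Fin n → ℝ} {L : ℕ} {V : Finset (Site d)}

/-- The value `±1` of `σ_3`. -/
def spinVal (e : Bool) : ℝ := if e then 1 else -1

theorem spinVal_not (e : Bool) : spinVal (!e) = -spinVal e := by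
  cases e <;> simp [spinVal]

theorem spinVal_mul_self (e : Bool) : spinVal e * spinVal e = 1 := by
  cases e <;> simp [spinVal]

theorem abs_spinVal (e : Bool) : |spinVal e| = 1 := by
  cases e <;> simp [spinVal]

variable {i : Site d} (hP : CompleteOrthogonalIdempotents P)
  (hPi : ∀ p, P p ∈ spinDiagonal (V.erase i))
  (hR : specMap P (fun p => (ρ p : ℂ)) = ∑ i ∈ V.erase i, spinOp 2 i)

include hP hPi in
theorem COI_spin : CompleteOrthogonalIdempotents
    (fun p : ι × Bool => P p.1 * spinProj i p.2) :=
  COI_mul hP (spinProj_COI i) fun p e => commute_spinProj (hPi p) i e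

omit [Fintype ι] in
include hPi in
theorem isSelfAdjoint_spin (p : ι × Bool) : IsSelfAdjoint (P p.1 * spinProj i p.2) :=
  (IsSelfAdjoint.commute_iff (hPi p.1).1 (spinProj_mem i p.2).1).mp (commute_spinProj (hPi p.1) i p.2)

include hP hR in
theorem specMap_spin_meanSpin (hi : i ∈ V) :
    specMap (fun p : ι × Bool => P p.1 * spinProj i p.2)
      (fun p => (((V.card : ℝ)⁻¹ * (ρ p.1 + spinVal p.2) : ℝ) : ℂ)) = meanSpin V := by
  have h1 := specMap_fst (E := P) (spinProj_COI i) (fun p => (ρ p : ℂ))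
  have h2 := specMap_snd (F := spinProj i) hP (fun e => (spinVal e : ℂ))
  rw [hR] at h1
  rw [show specMap (spinProj i) (fun e => (spinVal e : ℂ)) = spinOp 2 i from specMap_spinProj i] at h2
  rw [meanSpin, ← Finset.sum_erase_add V _ hi, ← h1, ← h2, ← specMap_add, ← specMap_smul]
  congr 1
  funext p
  push_cast
  ring

-- On the block with values `ρ` of the other spins and `e = ±1` of `σ_3^i`, the relation `e² = 1`
-- gives `σ_3^i σ_3^V = |V|⁻¹(ρe + 1)`. The subtraction of `|V|⁻¹` in `spinGen` leaves exactly
-- `|V|⁻¹ρe`.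
include hP hPi hR in
theorem specMap_spin_exp (hi : i ∈ V) (z : ℂ) :
    specMap (fun p : ι × Bool => P p.1 * spinProj i p.2)
      (fun p => Complex.exp (z * (((V.card : ℝ)⁻¹ * (ρ p.1 * spinVal p.2) : ℝ) : ℂ))) =
      NormedSpace.exp (spinGen z i V) := by
  have hF := COI_spin hP hPi
  have h2 := specMap_snd (F := spinProj i) hP (fun e => (spinVal e : ℂ))
  rw [show specMap (spinProj i) (fun e => (spinVal e : ℂ)) = spinOp 2 i from specMap_spinProj i] at h2
  have h3 : specMap (fun p : ι × Bool => P p.1 * spinProj i p.2)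
      (fun p => z * (((V.card : ℝ)⁻¹ * (ρ p.1 * spinVal p.2) : ℝ) : ℂ)) = spinGen z i V := by
    rw [specMap_smul, spinGen, ← specMap_spin_meanSpin hP hR hi, ← h2, specMap_mul hF]
    congr 1
    rw [eq_sub_iff_add_eq, ← specMap_one hF, ← specMap_smul, ← specMap_add]
    congr 1
    funext p
    have h5 : ((spinVal p.2 : ℝ) : ℂ) * (spinVal p.2 : ℝ) = 1 := by
      rw [← Complex.ofReal_mul, spinVal_mul_self]
      simp
    push_cast
    linear_combination (-(V.card : ℂ)⁻¹) * h5
  have h1 := hasSum_exp_specMap hF LinearMap.id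
    (fun p => z * (((V.card : ℝ)⁻¹ * (ρ p.1 * spinVal p.2) : ℝ) : ℂ))
  rw [h3] at h1
  exact h1.unique (NormedSpace.exp_series_hasSum_exp' (𝕂 := ℂ) (spinGen z i V))

-- The flip changes `λ = |V|⁻¹(ρ + e)` into `|V|⁻¹(ρ - e)`. The energy difference `J|V|(λ'² - λ²) =
-- -4J|V|⁻¹ρe` stays bounded as `V` grows, while the field time `t(λ' - λ) = -2t|V|⁻¹e` is small.
include hP hPi hR in
theorem dynamics_spinOp (J : ℝ) (hE : CompleteOrthogonalIdempotents E)
    (hB : specMap E (fun i => (l i : ℂ)) = field γ L) (t : ℝ) (hi : i ∈ V) {a : Fin 3} (ha : a ≠ 2) :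
    dynamics J γ V L t (spinOp a i ⊗ₜ 1) =
      (spinOp a i * NormedSpace.exp (spinGen (-(4 * Complex.I * t * J)) i V)) ⊗ₜ 1 +
      ∑ p : ι × Bool, (spinOp a i * (P p.1 * spinProj i p.2)) ⊗ₜ[ℂ]
        (Complex.exp (-(4 * Complex.I * t * J) *
          (((V.card : ℝ)⁻¹ * (ρ p.1 * spinVal p.2) : ℝ) : ℂ)) •
          (weyl E l (-2 * t * (V.card : ℝ)⁻¹ * spinVal p.2) - 1)) := by
  have hF := COI_spin hP hPi
  have hc : (V.card : ℝ) ≠ 0 := by exact_mod_cast (Finset.card_pos.mpr ⟨i, hi⟩).ne'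
  let σ : Equiv.Perm (ι × Bool) := Equiv.prodCongr (Equiv.refl ι) Equiv.boolNot
  have hσ : ∀ p : ι × Bool, P p.1 * spinProj i p.2 * spinOp a i =
      spinOp a i * (P (σ p).1 * spinProj i (σ p).2) := fun p => by
    have h1 : Commute (P p.1) (spinOp a i) := (hPi p.1).2 a i (Or.inl (by simp))
    rw [mul_assoc, spinOp_mul_spinProj ha, ← mul_assoc, h1.eq, mul_assoc]
    rfl
  rw [dynamics_of_perm J hF hE (specMap_spin_meanSpin hP hR hi) hB t σ hσ,
    ← specMap_spin_exp hP hPi hR hi]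
  have e : ((spinOp a i * specMap (fun p : ι × Bool => P p.1 * spinProj i p.2)
      fun p => Complex.exp (-(4 * Complex.I * t * J) *
        (((V.card : ℝ)⁻¹ * (ρ p.1 * spinVal p.2) : ℝ) : ℂ))) ⊗ₜ 1 : Obs d n) =
      (spinOp a i ⊗ₜ 1) * (specMap (fun p : ι × Bool => P p.1 * spinProj i p.2)
      fun p => Complex.exp (-(4 * Complex.I * t * J) *
        (((V.card : ℝ)⁻¹ * (ρ p.1 * spinVal p.2) : ℝ) : ℂ))) ⊗ₜ 1 := by
    rw [Algebra.TensorProduct.tmul_mul_tmul, one_mul]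
  rw [e, ← blockSum_smul_one]
  have e' : ∀ Z : ι × Bool → Lplus n,
      ∑ p : ι × Bool, (spinOp a i * (P p.1 * spinProj i p.2)) ⊗ₜ[ℂ] Z p =
      (spinOp a i ⊗ₜ 1) * blockSum (fun p : ι × Bool => P p.1 * spinProj i p.2) Z := fun Z => by
    simp only [blockSum, Finset.mul_sum, Algebra.TensorProduct.tmul_mul_tmul, one_mul]
  rw [e', ← mul_add, ← blockSum_add]
  congr 2
  funext p
  -- The pure phase term cancels the subtracted `1`, leaving phase times propagator to compare in
  -- each block.
  rw [smul_sub, add_sub_cancel]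
  have hs : (σ.symm p).2 = !p.2 := rfl
  have hs' : (σ.symm p).1 = p.1 := rfl
  rw [hs, hs', spinVal_not]
  congr 2
  · have : J * V.card * (((V.card : ℝ)⁻¹ * (ρ p.1 + -spinVal p.2)) ^ 2 -
        ((V.card : ℝ)⁻¹ * (ρ p.1 + spinVal p.2)) ^ 2) =
        -4 * J * ((V.card : ℝ)⁻¹ * (ρ p.1 * spinVal p.2)) := by
      field_simp
      ring
    rw [this]
    push_cast
    ring
  · ring

end FlippedSpin

/-! ### The limit of the spin operators. -/

section SpinLimit

variable {d n : ℕ}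

theorem weightBound_smul {f : Fin n → RapidFun} {k : Fin n → ℕ} {Z : Lplus n} {ε : ℝ}
    (h : WeightBound f k Z ε) {z : ℂ} (hz : ‖z‖ = 1) : WeightBound f k (z • Z) ε := by
  constructor <;> intro φ
  · rw [mul_smul_comm, smul_mul_assoc, Lplus_smul_apply, norm_smul, hz, one_mul]
    exact h.1 φ
  · rw [mul_smul_comm, smul_mul_assoc, Lplus_smul_apply, norm_smul, hz, one_mul]
    exact h.2 φ

theorem dynamics_spinOp_two (J : ℝ) (γ : Fin n → ℝ) (V : Finset (Site d)) (L : ℕ) (t : ℝ)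
    (i : Site d) : dynamics J γ V L t (spinOp 2 i ⊗ₜ 1) = spinOp 2 i ⊗ₜ 1 := by
  obtain ⟨ι, _, P, lam, hP, hPV, hPS⟩ := hasRealSpectrum_meanSpin V
  obtain ⟨κ, _, E, l, hE, -, hB⟩ := hasRealSpectrum_field γ L
  rw [dynamics_of_perm J hP hE hPS hB t (Equiv.refl ι) fun p => (hPV p).2 2 i (Or.inr rfl)]
  simp only [Equiv.refl_symm, Equiv.refl_apply, sub_self, mul_zero, Complex.ofReal_zero,
    Complex.exp_zero, one_smul, weyl_zero hE, blockSum_const hP,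
    Algebra.TensorProduct.tmul_mul_tmul, mul_one]

theorem exists_tauTendsto_dynamics_spinOp (J : ℝ) (γ : Fin n → ℝ) {𝓥 : Filter (Finset (Site d))}
    (h𝓥 : Tendsto Finset.card 𝓥 atTop) (t : ℝ) (a : Fin 3) (i : Site d) (hi : ∀ᶠ V in 𝓥, i ∈ V) :
    ∃ X : Obs d n, TauTendsto 𝓥 (𝓥 ×ˢ atTop)
      (fun p : Finset (Site d) × ℕ => dynamics J γ p.1 p.2 t (spinOp a i ⊗ₜ 1)) X := by
  by_cases ha : a = 2
  · subst ha
    refine ⟨spinOp 2 i ⊗ₜ 1, fun f k Ψ _ => ?_⟩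
    simp only [dynamics_spinOp_two, sub_self]
    refine tendsto_tauSeminorm (ε := fun _ => 0) (.of_forall fun p => ?_) tendsto_const_nhds
    constructor <;> intro χ₁ χ₂ φ₂ _ _ _ <;> simp
  let z : ℂ := -(4 * Complex.I * t * J)
  have hz : ∀ r : ℝ, ‖Complex.exp (z * r)‖ = 1 := fun r => by
    have : z * r = ((-(4 * t * J * r) : ℝ) : ℂ) * Complex.I := by simp only [z]; push_cast; ring
    rw [this, Complex.norm_exp_ofReal_mul_I]
  obtain ⟨B, hBd⟩ := exists_norm_exp_spinGen_le z i
  obtain ⟨G, hG⟩ := exists_strongLimit 𝓥 (fun V => NormedSpace.exp (spinGen z i V)) B hBd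
  refine ⟨(spinOp a i * G) ⊗ₜ 1, fun f k Ψ hΨ => ?_⟩
  obtain ⟨y, hy⟩ := tendsto_exp_spinGen h𝓥 z i hΨ
  have hlim := hG Ψ y hy
  obtain ⟨C₀, hC₀, hW₀⟩ := exists_weightBound_one f k
  obtain ⟨C, K₁, K₂, hC, hW⟩ := exists_weightBound f k 1
  -- The field times have absolute value `2|t|/|V| ≤ 2|t|`, since `V` contains `i` and so is
  -- nonempty.
  let T : ℝ := 2 * |t|
  let b : ℤ → ℝ := fun K => (∑ j, |γ j|) * (2 * 2 ^ K.natAbs) * growth γ (K + 1) T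
  have hb : ∀ K, 0 ≤ b K := fun K => by
    have h1 : 0 ≤ growth γ (K + 1) T := (Real.exp_pos _).le
    have h2 : 0 ≤ ∑ j, |γ j| := Finset.sum_nonneg fun _ _ => abs_nonneg _
    positivity
  let ε : Finset (Site d) → ℝ := fun V => T * (V.card : ℝ)⁻¹ * (b K₁ + b K₂)
  have hT : 0 ≤ T := by positivity
  have hε0 : ∀ V, 0 ≤ ε V := fun V => by
    have := hb K₁
    have := hb K₂
    positivity
  have hε : Tendsto ε 𝓥 (𝓝 0) := by
    have := (((tendsto_inv_atTop_nhds_zero_nat (𝕜 := ℝ)).comp h𝓥).const_mul T).mul_const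
      (b K₁ + b K₂)
    simpa using this
  refine tendsto_tauSeminorm (ε := fun p : Finset (Site d) × ℕ =>
    ‖(spinOp a i * (NormedSpace.exp (spinGen z i p.1) - G)) Ψ‖ * C₀ + C * ε p.1 * ‖Ψ‖) ?_ ?_
  · filter_upwards [tendsto_fst.eventually hi] with p hp
    obtain ⟨V, L⟩ := p
    have hiV : i ∈ V := hp
    obtain ⟨ι, _, P, ρ, hP, hPi, hR⟩ := hasRealSpectrum_sum_spinOp (V.erase i)
    obtain ⟨κ, _, E, l, hE, -, hB⟩ := hasRealSpectrum_field γ L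
    have hc : (1 : ℝ) ≤ V.card := by exact_mod_cast Finset.card_pos.mpr ⟨i, hiV⟩
    have hc' : (V.card : ℝ)⁻¹ ≤ 1 := inv_le_one_of_one_le₀ hc
    have hc0 : 0 ≤ (V.card : ℝ)⁻¹ := by positivity
    -- The error splits into the strong convergence of the phase, which involves the spins only, and
    -- the deviation of the propagators from `1`, which is small uniformly in `L`.
    rw [dynamics_spinOp hP hPi hR J hE hB t hiV ha, add_sub_right_comm, ← TensorProduct.sub_tmul,
      ← mul_sub]
    refine (tauBound_tmul Ψ _ hW₀ hC₀).add (tauBound_sum (COI_spin hP hPi) (isSelfAdjoint_spin hPi)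
      Ψ (norm_spinOp_le a i) (mul_nonneg hC (hε0 V)) fun p _ => weightBound_smul ?_ (hz _))
    have habs : |-2 * t * (V.card : ℝ)⁻¹ * spinVal p.2| = T * (V.card : ℝ)⁻¹ := by
      rw [abs_mul, abs_mul, abs_mul, abs_spinVal, abs_of_nonneg hc0]
      simp [T]
    have hs : |-2 * t * (V.card : ℝ)⁻¹ * spinVal p.2| ≤ T := by
      rw [habs]
      exact mul_le_of_le_one_right hT hc'
    have key : ∀ K, b K ≤ b K₁ + b K₂ → ∀ φ : D n,
        ‖(wpow K).1 ((weyl E l (-2 * t * (V.card : ℝ)⁻¹ * spinVal p.2) - 1).1 φ)‖ ≤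
          ε V * ‖(wpow (K + (1 : ℕ))).1 φ‖ := fun K hK φ => by
      refine (norm_wpow_weyl_sub_one_le hE hB K hs φ).trans ?_
      rw [habs]
      exact mul_le_mul_of_nonneg_right
        (mul_le_mul_of_nonneg_left hK (by positivity)) (norm_nonneg _)
    exact hW _ _ (hε0 V) (key K₁ (le_add_of_nonneg_right (hb K₂)))
      (key K₂ (le_add_of_nonneg_left (hb K₁)))
  · have h1 : Tendsto (fun V : Finset (Site d) => C * ε V * ‖Ψ‖) 𝓥 (𝓝 0) := by
      simpa using (hε.const_mul C).mul_const ‖Ψ‖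
    have h2 : Tendsto (fun V : Finset (Site d) =>
        ‖(spinOp a i * (NormedSpace.exp (spinGen z i V) - G)) Ψ‖ * C₀) 𝓥 (𝓝 0) := by
      have h3 := ((spinOp a i).continuous.tendsto 0).comp (tendsto_sub_nhds_zero_iff.mpr hlim)
      rw [map_zero] at h3
      simpa using h3.norm.mul_const C₀
    simpa using (h2.comp tendsto_fst).add (h1.comp tendsto_fst)

end SpinLimit

end

end SpinBoson

theorem proposition5p1 (d n : ℕ) (J : ℝ) (γ : Fin n → ℝ)
    (𝓥 : Filter (Finset (SpinBoson.Site d)))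
    (h𝓥 : Filter.Tendsto Finset.card 𝓥 Filter.atTop) :
    ∃ α : Finset (SpinBoson.Site d) → ℕ → ℝ → SpinBoson.Obs d n → SpinBoson.Obs d n,
      (∀ V L, SpinBoson.IsCutoffDynamics J γ V L (α V L)) ∧
      (∀ (t : ℝ) (j : Fin n), ∃ X : SpinBoson.Obs d n,
        SpinBoson.TauTendsto 𝓥 (𝓥 ×ˢ Filter.atTop)
          (fun p : Finset (SpinBoson.Site d) × ℕ =>
            α p.1 p.2 t (1 ⊗ₜ[ℂ] SpinBoson.ann j)) X) ∧
      (∀ r : ℕ, 1 < r → ∀ (t : ℝ) (a : Fin 3) (i : SpinBoson.Site d),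
        (∀ᶠ V in 𝓥, i ∈ V) → ∃ X : SpinBoson.Obs d n,
          SpinBoson.TauTendsto 𝓥
            ((𝓥 ×ˢ Filter.atTop) ⊓
              Filter.principal {p : Finset (SpinBoson.Site d) × ℕ | p.1.card = p.2 ^ r})
            (fun p : Finset (SpinBoson.Site d) × ℕ =>
              α p.1 p.2 t (SpinBoson.spinOp a i ⊗ₜ[ℂ] 1)) X) := by
  refine ⟨SpinBoson.dynamics J γ, SpinBoson.isCutoffDynamics_dynamics J γ,
    SpinBoson.exists_tauTendsto_dynamics_ann J γ 𝓥, fun r _ t a i hi => ?_⟩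
  obtain ⟨X, hX⟩ := SpinBoson.exists_tauTendsto_dynamics_spinOp (n := n) J γ h𝓥 t a i hi
  -- Convergence along the whole product filter restricts to the pairs with `|V| = L^r`.
  exact ⟨X, fun f k Ψ hΨ => (hX f k Ψ hΨ).mono_left inf_le_left⟩
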